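/- **Setting.** For $x\in\mathbb R^d$ let $x^{\otimes 2}\in\mathbb R^{d^2}$ be its tensor square, and for $z\in\mathbb R^{d^2}$ let $\mathcal M(z)$ be $z$ viewed as a $d\times d$ matrix, so that $\mathcal M(x^{\otimes 2})=xx^\top$; $\|\cdot\|_{\rm op}$ is the spectral norm. The spectral autoencoder class $\mathcal H^{\rm sa}_{k,2}$ consists of the pairs $(h_A,g_B)$ with $h_A(x)=Ax^{\otimes 2}$, $A\in\mathbb R^{k\times d^2}$, and $g_B(y)=v_{\max}(By)$, $B\in\mathbb R^{d^2\times k}$, where $v_{\max}(z)$ is a (unit) top right-singular vector of $\mathcal M(z)$. For a distribution $\mathcal D$ on the unit sphere of $\mathbb R^d$ put $$L_{\mathcal D}(A,B)=\mathbb E_{x\sim\mathcal D}\,\|\mathcal M(BAx^{\otimes 2})-xx^\top\|_{\rm op},\qquad \mathrm{rec}_{\mathcal D}(h,g)=\mathbb E_{x\sim\mathcal D}\,\min\big(\|g(h(x))-x\|^2,\|g(h(x))+x\|^2\big).$$ $\mathcal D$ is *$(k,\varepsilon)$-regularly spectral decodable* (with constant $\tau\ge 1$) if there are $A\in\mathbb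 R^{k\times d^2}$, $B\in\mathbb R^{d^2\times k}$ with $\|BA\|_{\rm op}\le\tau$ and $\|\mathcal M(BAx^{\otimes 2})-xx^\top\|_{\rm op}\le\varepsilon$ with probability $1$ for $x\sim\mathcal D$. **Theorem.** There are one (uniform, deterministic) algorithm on the real RAM, with unit-cost operations $+,-,\times,/$ and comparisons on reals, and absolute constants $C,c$ with the following properties. The input consists of $d,k,m$, real numbers $\tau\ge1$, $\delta,\alpha>0$, $0<\eta<1$, and a sample of $m$ points of $\mathbb R^d$. The algorithm stops after at most $c\,(d+k+m+\tau+1/\delta+1/\alpha+\log(1/\eta))^c$ steps and returns $\hat A\in\mathbb R^{k'\times d^2}$, $\hat B\in\mathbb R^{d^2\times k'}$, that is, a hypothesis in $\mathcal H^{\rm sa}_{k',2}$ encoding into $k'$ real numbers, with encoding length $$k'\le C\,\tau^4k^4/\delta^4 .$$ Moreover, if $m\ge c\,(d+\tau+1/\alpha+\log(1/\eta))^c$ and the sample is drawn i.i.d. from a distribution $\mathcal D$ on the unit sphere of $\mathbb R^d$ that is $(k,\varepsilon)$-regularly spectral decodable with constant $\tau$ (for any $\varepsilon$, which the algorithm is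 not given), then with probability at least $1-\eta$: 1. (learnability with bias $\delta$ and accuracy $\alpha$) $L_{\mathcal D}(\hat A,\hat B)\le L_{\mathcal D}(A,B)+\delta+\alpha$ for all $A\in\mathbb R^{k\times d^2}$, $B\in\mathbb R^{d^2\times k}$ with $\|BA\|_{\rm op}\le\tau$; 2. $L_{\mathcal D}(\hat A,\hat B)\le\varepsilon+\delta+\alpha$; 3. $\mathrm{rec}_{\mathcal D}(h_{\hat A},g_{\hat B})\le 4\varepsilon+\delta+\alpha$, for every choice of the singular vectors in $g_{\hat B}$. -/

import Mathlib

open MeasureTheory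
open scoped Matrix

/-! ### Spectral autoencoders -/

/-- The operator (spectral) norm of a real square matrix acting on Euclidean space. -/
noncomputable def opNorm {n : Type*} [Fintype n] [DecidableEq n] (M : Matrix n n ℝ) : ℝ :=
  ‖Matrix.toEuclideanCLM (n := n) (𝕜 := ℝ) M‖

/-- The tensor square of a vector, with coordinates indexed by pairs. -/
def tensorSq {d : ℕ} (x : EuclideanSpace ℝ (Fin d)) : Fin d × Fin d → ℝ :=
  fun p => x p.1 * x p.2

/-- A vector of dimension `d * d` viewed as a `d` by `d` matrix. -/
def asMatrix {d : ℕ} (z : Fin d × Fin d → ℝ) : Matrix (Fin d) (Fin d) ℝ :=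
  Matrix.of fun i j => z (i, j)

/-- `v` is a top right-singular vector of `M`: a unit vector at which `M` attains its operator
norm. It is never unique (`-v` is another one). -/
def IsTopRightSingularVector {d : ℕ} (M : Matrix (Fin d) (Fin d) ℝ)
    (v : EuclideanSpace ℝ (Fin d)) : Prop :=
  ‖v‖ = 1 ∧ ‖Matrix.toEuclideanCLM (n := Fin d) (𝕜 := ℝ) M v‖ = opNorm M

/-- The pairs `(h, g)` with `h x = A x^{⊗2}` and `g y = v_max (B y)`, one pair for every way of
choosing the top right-singular vectors. The spectral autoencoder class with codes of length `k`
is the union of these sets over all `A` and `B`. -/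
def spectralAutoencoder {d k : ℕ} (A : Matrix (Fin k) (Fin d × Fin d) ℝ)
    (B : Matrix (Fin d × Fin d) (Fin k) ℝ) :
    Set ((EuclideanSpace ℝ (Fin d) → (Fin k → ℝ)) × ((Fin k → ℝ) → EuclideanSpace ℝ (Fin d))) :=
  {f | (∀ x, f.1 x = A *ᵥ tensorSq x) ∧
    ∀ y, IsTopRightSingularVector (asMatrix (B *ᵥ y)) (f.2 y)}

/-- The spectral error at `x`, i.e. the operator norm of `E` in `asMatrix (B A x^{⊗2}) = x xᵀ + E`. -/
noncomputable def spectralError {d k : ℕ} (A : Matrix (Fin k) (Fin d × Fin d) ℝ)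
    (B : Matrix (Fin d × Fin d) (Fin k) ℝ) (x : EuclideanSpace ℝ (Fin d)) : ℝ :=
  opNorm (asMatrix (B *ᵥ (A *ᵥ tensorSq x)) - Matrix.vecMulVec x x)

/-- Expected spectral error. -/
noncomputable def spectralLoss {d k : ℕ} (D : Measure (EuclideanSpace ℝ (Fin d)))
    (A : Matrix (Fin k) (Fin d × Fin d) ℝ) (B : Matrix (Fin d × Fin d) (Fin k) ℝ) : ENNReal :=
  ∫⁻ x, ENNReal.ofReal (spectralError A B x) ∂D

/-- Expected squared Euclidean reconstruction error of an encoding and decoding pair, up to the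
sign of the reconstruction (`x` and `-x` have the same tensor square, hence the same code, and
singular vectors are defined up to sign). -/
noncomputable def reconstructionLoss {d k : ℕ} (D : Measure (EuclideanSpace ℝ (Fin d)))
    (f : (EuclideanSpace ℝ (Fin d) → (Fin k → ℝ)) × ((Fin k → ℝ) → EuclideanSpace ℝ (Fin d))) :
    ENNReal :=
  ∫⁻ x, ENNReal.ofReal (min (‖f.2 (f.1 x) - x‖ ^ 2) (‖f.2 (f.1 x) + x‖ ^ 2)) ∂D

/-- `D` is `(k, ε)`-regularly spectral decodable, with regularity constant `τ`. -/
def IsRegularlySpectralDecodable {d : ℕ} (τ : ℝ) (k : ℕ) (ε : ℝ)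
    (D : Measure (EuclideanSpace ℝ (Fin d))) : Prop :=
  ∃ (A : Matrix (Fin k) (Fin d × Fin d) ℝ) (B : Matrix (Fin d × Fin d) (Fin k) ℝ),
    opNorm (B * A) ≤ τ ∧ ∀ᵐ x ∂D, spectralError A B x ≤ ε

/-! ### Algorithms: real RAM programs with a step count -/

namespace RealRAM

/-- The memory: integer registers, and arrays (named by a number) of real cells, addressed by
finite lists of natural numbers. -/
structure Mem where
  nat : ℕ → ℕ
  real : ℕ → List ℕ → ℝ

/-- Integer expressions: constants, registers, sums. -/
inductive NExp where
  | const (c : ℕ)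
  | reg (i : ℕ)
  | add (a b : NExp)

def NExp.eval (M : Mem) : NExp → ℕ
  | const c => c
  | reg i => M.nat i
  | add a b => a.eval M + b.eval M

def NExp.cost : NExp → ℕ
  | const _ => 1
  | reg _ => 1
  | add a b => a.cost + b.cost + 1

/-- The cost of computing an address. -/
def addrCost (idx : List NExp) : ℕ := (idx.map NExp.cost).sum + 1

/-- Real expressions: rational constants, cells, integers, and the four arithmetic operations
(there is no rounding and there are no roots; division by zero returns zero). -/
inductive RExp where
  | const (q : ℚ)
  | cell (a : ℕ) (idx : List NExp)
  | cast (n : NExp)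
  | add (a b : RExp)
  | sub (a b : RExp)
  | mul (a b : RExp)
  | div (a b : RExp)

noncomputable def RExp.eval (M : Mem) : RExp → ℝ
  | const q => (q : ℝ)
  | cell a idx => M.real a (idx.map (NExp.eval M))
  | cast n => (n.eval M : ℝ)
  | add a b => a.eval M + b.eval M
  | sub a b => a.eval M - b.eval M
  | mul a b => a.eval M * b.eval M
  | div a b => a.eval M / b.eval M

def RExp.cost : RExp → ℕ
  | const _ => 1
  | cell _ idx => addrCost idx
  | cast n => n.cost + 1
  | add a b => a.cost + b.cost + 1
  | sub a b => a.cost + b.cost + 1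
  | mul a b => a.cost + b.cost + 1
  | div a b => a.cost + b.cost + 1

/-- Tests: comparisons of integers or of reals, and negations. -/
inductive Test where
  | natLT (a b : NExp)
  | realLT (a b : RExp)
  | neg (t : Test)

def Test.holds (M : Mem) : Test → Prop
  | natLT a b => a.eval M < b.eval M
  | realLT a b => a.eval M < b.eval M
  | neg t => ¬ t.holds M

def Test.cost : Test → ℕ
  | natLT a b => a.cost + b.cost + 1
  | realLT a b => a.cost + b.cost + 1
  | neg t => t.cost + 1

/-- Programs: assignments to a register or to a cell, composition, branching, while loops. -/
inductive Program where
  | setNat (i : ℕ) (e : NExp)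
  | setReal (a : ℕ) (idx : List NExp) (e : RExp)
  | seq (P Q : Program)
  | branch (b : Test) (P Q : Program)
  | loop (b : Test) (P : Program)

def Mem.setNat (M : Mem) (i v : ℕ) : Mem :=
  { M with nat := Function.update M.nat i v }

noncomputable def Mem.setReal (M : Mem) (a : ℕ) (idx : List ℕ) (v : ℝ) : Mem :=
  { M with real := Function.update M.real a (Function.update (M.real a) idx v) }

/-- `Runs P M M' t`: started in memory `M`, the program `P` halts in memory `M'` after `t` steps. -/
inductive Runs : Program → Mem → Mem → ℕ → Prop where
  | setNat (i : ℕ) (e : NExp) (M : Mem) :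
      Runs (.setNat i e) M (M.setNat i (e.eval M)) (e.cost + 1)
  | setReal (a : ℕ) (idx : List NExp) (e : RExp) (M : Mem) :
      Runs (.setReal a idx e) M (M.setReal a (idx.map (NExp.eval M)) (e.eval M))
        (e.cost + addrCost idx + 1)
  | seq {P Q : Program} {M₁ M₂ M₃ : Mem} {s t : ℕ} :
      Runs P M₁ M₂ s → Runs Q M₂ M₃ t → Runs (.seq P Q) M₁ M₃ (s + t)
  | branchTrue {b : Test} {P Q : Program} {M M' : Mem} {t : ℕ} :
      b.holds M → Runs P M M' t → Runs (.branch b P Q) M M' (b.cost + t + 1)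
  | branchFalse {b : Test} {P Q : Program} {M M' : Mem} {t : ℕ} :
      ¬ b.holds M → Runs Q M M' t → Runs (.branch b P Q) M M' (b.cost + t + 1)
  | loopStop {b : Test} {P : Program} {M : Mem} :
      ¬ b.holds M → Runs (.loop b P) M M (b.cost + 1)
  | loopStep {b : Test} {P : Program} {M₁ M₂ M₃ : Mem} {s t : ℕ} :
      b.holds M₁ → Runs P M₁ M₂ s → Runs (.loop b P) M₂ M₃ t →
        Runs (.loop b P) M₁ M₃ (b.cost + s + t + 1)

/-- The initial memory of a learner: `d`, `k`, `m` in the registers `0`, `1`, `2`, the parameters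
`τ`, `δ`, `α`, `η` in the arrays `0`, `1`, `2`, `3` (at the empty index), and the coordinate `j` of
the example `i` in the cell `[i, j]` of the array `4`; zeros elsewhere. -/
noncomputable def input (d k m : ℕ) (τ δ α η : ℝ) (X : Fin m → EuclideanSpace ℝ (Fin d)) : Mem where
  nat
    | 0 => d
    | 1 => k
    | 2 => m
    | _ => 0
  real
    | 0, [] => τ
    | 1, [] => δ
    | 2, [] => α
    | 3, [] => η
    | 4, [i, j] => if h : i < m ∧ j < d then X ⟨i, h.1⟩ ⟨j, h.2⟩ else 0
    | _, _ => 0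

/-- The code length chosen by a learner, left in the register `0`. -/
def Mem.codeLength (M : Mem) : ℕ := M.nat 0

/-- The encoding matrix returned by a learner, left in the array `0`. -/
def Mem.encoder (d : ℕ) (M : Mem) : Matrix (Fin M.codeLength) (Fin d × Fin d) ℝ :=
  Matrix.of fun r p => M.real 0 [r, p.1, p.2]

/-- The decoding matrix returned by a learner, left in the array `1`. -/
def Mem.decoder (d : ℕ) (M : Mem) : Matrix (Fin d × Fin d) (Fin M.codeLength) ℝ :=
  Matrix.of fun p r => M.real 1 [p.1, p.2, r]

end RealRAM

set_option linter.unusedSectionVars false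

/-! Only the product R = BA matters for the spectral loss, and the loss R ↦ ‖M(R x^{⊗2}) - xxᵀ‖ is
convex in R. So the rank constraint is relaxed: a competitor has rank at most min(k, d²) and
operator norm at most τ, hence squared Frobenius norm at most r = τ² min(k, d²)
(`frob_mul_self_le`). It suffices to compete with that Frobenius ball, provided the answer itself
has low rank.

Low rank comes from stochastic subgradient descent started at 0. If W is a subgradient of the
operator norm at the error matrix, the subgradient of the loss is vec(W)(x^{⊗2})ᵀ, of rank one and
Frobenius norm at most one. With step β/4, blocks of T + 1 examples where T = ⌊16r/β²⌋ have average
regret at most 3β/8 (`regret_bound`, `regret_le`), and every iterate is a sum of at most T rank-one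
terms, which is a factorization into a decoder and an encoder of code length at most T
(`iterate_eq_sum`, `IsOutput.decoder_mul_encoder`).

Each iterate is independent of the example it meets, so within a block the mean of the average risk
is at most the optimum plus 3β/8 (`lintegral_block_le`). By Markov some iterate of a block is within
β/2 of the optimum with probability bounded below (`measure_badBlock_le`). Restarting makes the
blocks independent, so the chance that all of them fail decays geometrically
(`measure_badBlocks_le`). The second half of the sample is held out; Hoeffding's inequality and a
union bound show that the iterate with the least hold-out score is almost as good as the best one
(`measure_deviation_le`, `risk_le_of_selected`).

The real RAM has neither roots nor singular vectors. With Q = (EᵀE)^q the quotient ‖EQ‖²/‖Q‖²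
(Frobenius norms) approximates ‖E‖² up to a factor 1 + ξ once q ≥ n/ξ, by log-convexity of the norms
along the power iteration. Newton's method gives the root, and EQQᵀ, suitably scaled, is an
approximate subgradient (`opNorm_le_rayleigh`, `frob_dualMat_le`, `le_frob_dualMat`). All that the
analysis needs is that its pairing with any N is at most ‖N‖ and its pairing with E almost ‖E‖.

Running time and correctness of the program are proved together in a small total-correctness logic
with step counts. Finally, a top singular vector of xxᵀ + E has squared distance at most 4‖E‖ from x
or -x (`min_norm_sq_le`), so β = (δ + α)/4 serves all three conclusions. -/

namespace SpectralAutoencoder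

/-! ### The Frobenius inner product -/

section Frobenius

variable {ι κ : Type*} [Fintype ι] [Fintype κ]

/-- The Frobenius inner product of real matrices. -/
def frob (A B : Matrix ι κ ℝ) : ℝ := ∑ i, ∑ j, A i j * B i j

theorem frob_comm (A B : Matrix ι κ ℝ) : frob A B = frob B A := by
  simp only [frob, mul_comm]

theorem frob_self_nonneg (A : Matrix ι κ ℝ) : 0 ≤ frob A A :=
  Finset.sum_nonneg fun _ _ => Finset.sum_nonneg fun _ _ => mul_self_nonneg _

theorem frob_eq_trace (A B : Matrix ι κ ℝ) : frob A B = (Aᵀ * B).trace := by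
  rw [frob, Finset.sum_comm]
  simp [Matrix.trace, Matrix.mul_apply]

theorem frob_mul_left {μ : Type*} [Fintype μ] (E : Matrix μ ι ℝ) (A : Matrix ι κ ℝ)
    (B : Matrix μ κ ℝ) : frob (E * A) B = frob A (Eᵀ * B) := by
  simp only [frob_eq_trace, Matrix.transpose_mul, Matrix.mul_assoc]

theorem frob_sq_le (A B : Matrix ι κ ℝ) : frob A B ^ 2 ≤ frob A A * frob B B := by
  have h := Finset.sum_mul_sq_le_sq_mul_sq (Finset.univ : Finset (ι × κ))
    (fun p => A p.1 p.2) (fun p => B p.1 p.2)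
  simpa only [frob, Fintype.sum_prod_type, sq (A _ _), sq (B _ _)] using h

theorem frob_self_eq_zero {A : Matrix ι κ ℝ} (h : frob A A = 0) : A = 0 := by
  ext i j
  have h1 := (Finset.sum_eq_zero_iff_of_nonneg
    (fun i _ => Finset.sum_nonneg fun j _ => mul_self_nonneg (A i j))).1 h i (Finset.mem_univ i)
  have h2 := (Finset.sum_eq_zero_iff_of_nonneg
    (fun j _ => mul_self_nonneg (A i j))).1 h1 j (Finset.mem_univ j)
  exact mul_self_eq_zero.1 h2

theorem frob_smul_left (c : ℝ) (A B : Matrix ι κ ℝ) : frob (c • A) B = c * frob A B := by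
  simp only [frob, Matrix.smul_apply, smul_eq_mul, Finset.mul_sum, mul_assoc]

theorem frob_smul_right (c : ℝ) (A B : Matrix ι κ ℝ) : frob A (c • B) = c * frob A B := by
  rw [frob_comm, frob_smul_left, frob_comm]

theorem frob_sub_left (A A' B : Matrix ι κ ℝ) : frob (A - A') B = frob A B - frob A' B := by
  simp only [frob, Matrix.sub_apply, sub_mul, Finset.sum_sub_distrib]

theorem frob_sub_right (A B B' : Matrix ι κ ℝ) : frob A (B - B') = frob A B - frob A B' := by
  simp only [frob, Matrix.sub_apply, mul_sub, Finset.sum_sub_distrib]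

theorem sqrt_frob_add_le (A B : Matrix ι κ ℝ) :
    √(frob (A + B) (A + B)) ≤ √(frob A A) + √(frob B B) := by
  classical
  have h : ∀ M : Matrix ι κ ℝ, √(frob M M) =
      ‖(WithLp.toLp 2 (fun p : ι × κ => M p.1 p.2) : EuclideanSpace ℝ (ι × κ))‖ := by
    intro M
    rw [EuclideanSpace.norm_eq, Fintype.sum_prod_type]
    simp [frob, sq]
  rw [h, h, h]
  exact norm_add_le (WithLp.toLp 2 (fun p : ι × κ => A p.1 p.2) : EuclideanSpace ℝ (ι × κ))
    (WithLp.toLp 2 (fun p : ι × κ => B p.1 p.2))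

end Frobenius

/-! ### The operator norm -/

section OpNorm

variable {n : Type*} [Fintype n] [DecidableEq n]

theorem opNorm_nonneg (M : Matrix n n ℝ) : 0 ≤ opNorm M := norm_nonneg _

theorem norm_toLp_sq (v : n → ℝ) : ‖(WithLp.toLp 2 v : EuclideanSpace ℝ n)‖ ^ 2 = ∑ i, v i * v i := by
  rw [EuclideanSpace.norm_sq_eq]
  simp [sq]

theorem norm_mulVec_le (M : Matrix n n ℝ) (v : n → ℝ) :
    ‖(WithLp.toLp 2 (M *ᵥ v) : EuclideanSpace ℝ n)‖ ≤ opNorm M * ‖(WithLp.toLp 2 v : EuclideanSpace ℝ n)‖ :=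
  (Matrix.toEuclideanCLM (n := n) (𝕜 := ℝ) M).le_opNorm (WithLp.toLp 2 v)

theorem opNorm_le {M : Matrix n n ℝ} {b : ℝ} (hb : 0 ≤ b)
    (h : ∀ v : n → ℝ, ‖(WithLp.toLp 2 (M *ᵥ v) : EuclideanSpace ℝ n)‖
      ≤ b * ‖(WithLp.toLp 2 v : EuclideanSpace ℝ n)‖) : opNorm M ≤ b :=
  ContinuousLinearMap.opNorm_le_bound _ hb fun v => h v.ofLp

theorem opNorm_sub_le (M N : Matrix n n ℝ) : opNorm (M - N) ≤ opNorm M + opNorm N := by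
  unfold opNorm
  rw [map_sub]
  exact norm_sub_le _ _

theorem sum_mulVec_sq_le_frob (M : Matrix n n ℝ) (v : n → ℝ) :
    ∑ i, (M *ᵥ v) i * (M *ᵥ v) i ≤ frob M M * ∑ i, v i * v i := by
  rw [frob, Finset.sum_mul]
  refine Finset.sum_le_sum fun i _ => ?_
  have := Finset.sum_mul_sq_le_sq_mul_sq Finset.univ (M i) v
  simpa only [Matrix.mulVec, dotProduct, sq] using this

theorem opNorm_le_sqrt_frob (M : Matrix n n ℝ) : opNorm M ≤ √(frob M M) := by
  refine opNorm_le (Real.sqrt_nonneg _) fun v => ?_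
  refine le_of_sq_le_sq ?_ (by positivity)
  rw [mul_pow, Real.sq_sqrt (frob_self_nonneg M), norm_toLp_sq, norm_toLp_sq]
  exact sum_mulVec_sq_le_frob M v

/-- Cauchy–Schwarz on each column of Q. This replaces the duality of nuclear and operator norms for
matrices of the form M Q Qᵀ, so that no singular value decomposition is needed. -/
theorem frob_mulVec_le {κ : Type*} [Fintype κ] (M N : Matrix n n ℝ) (Q : Matrix n κ ℝ) :
    frob (M * Q) (N * Q) ≤ opNorm M * opNorm N * frob Q Q := by
  have hcol : ∀ A B : Matrix n κ ℝ, frob A B = ∑ j, ∑ i, A i j * B i j := fun A B => Finset.sum_comm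
  rw [hcol, hcol, Finset.mul_sum]
  refine Finset.sum_le_sum fun j _ => ?_
  have h1 : ∑ i, (M * Q) i j * (N * Q) i j =
      inner ℝ (WithLp.toLp 2 (N *ᵥ fun i => Q i j) : EuclideanSpace ℝ n)
        (WithLp.toLp 2 (M *ᵥ fun i => Q i j)) := by
    simp [PiLp.inner_apply, Matrix.mul_apply, Matrix.mulVec, dotProduct]
  rw [h1, ← norm_toLp_sq]
  refine (real_inner_le_norm _ _).trans ?_
  have a := norm_mulVec_le M fun i => Q i j
  have b := norm_mulVec_le N fun i => Q i j
  calc _ ≤ (opNorm N * ‖(WithLp.toLp 2 (fun i => Q i j) : EuclideanSpace ℝ n)‖) *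
        (opNorm M * ‖(WithLp.toLp 2 (fun i => Q i j) : EuclideanSpace ℝ n)‖) := by
        gcongr
        exact (norm_nonneg _).trans b
    _ = _ := by ring

end OpNorm

/-! ### Logarithmically convex sequences -/

section LogConvex

variable {t : ℕ → ℝ}

theorem pos_of_logConvex (ht : ∀ n, 0 ≤ t n) (hc : ∀ n, t (n + 1) ^ 2 ≤ t n * t (n + 2))
    (h0 : 0 < t 0) (h1 : 0 < t 1) (n : ℕ) : 0 < t n ∧ 0 < t (n + 1) := by
  induction n with
  | zero => exact ⟨h0, h1⟩
  | succ n ih =>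
    refine ⟨ih.2, (ht _).lt_of_ne fun h => ?_⟩
    have := hc n
    rw [show n + 2 = n + 1 + 1 from rfl, ← h, mul_zero] at this
    nlinarith [ih.2]

/-- The ratios t (n + 1) / t n increase, so each of them is at least the first, which is t 1. -/
theorem pow_le_of_logConvex (ht : ∀ n, 0 ≤ t n) (hc : ∀ n, t (n + 1) ^ 2 ≤ t n * t (n + 2))
    (h0 : t 0 = 1) (n : ℕ) : t 1 ^ n ≤ t n := by
  rcases (ht 1).eq_or_lt with h1 | h1
  · rcases n with _ | n
    · simp [h0]
    · rw [← h1, zero_pow n.succ_ne_zero]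
      exact ht _
  have hp := pos_of_logConvex ht hc (h0 ▸ one_pos) h1
  have key : ∀ n, t 1 * t n ≤ t (n + 1) := by
    intro n
    induction n with
    | zero => simp [h0]
    | succ n ih =>
      have := hc n
      have h3 : t n * (t 1 * t (n + 1)) ≤ t n * t (n + 2) := by nlinarith [(hp n).2]
      exact le_of_mul_le_mul_left h3 (hp n).1
  induction n with
  | zero => simp [h0]
  | succ n ih =>
    rw [pow_succ']
    exact (mul_le_mul_of_nonneg_left ih h1.le).trans (key n)

/-- The same monotonicity read from the other end: every ratio up to N is at most the last one, and
t N is t 0 times N such ratios. -/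
theorem le_pow_of_logConvex (ht : ∀ n, 0 ≤ t n) (hc : ∀ n, t (n + 1) ^ 2 ≤ t n * t (n + 2))
    (h0 : 0 < t 0) (h1 : 0 < t 1) (N : ℕ) : t N ≤ t 0 * (t (N + 1) / t N) ^ N := by
  have hp := pos_of_logConvex ht hc h0 h1
  have key : ∀ k n, t (n + 1) * t (n + k) ≤ t n * t (n + k + 1) := by
    intro k n
    induction k with
    | zero => simp [mul_comm]
    | succ k ih =>
      have h3 := hc (n + k)
      have p0 := (hp (n + k)).1
      have p1 := (hp (n + k)).2
      have p2 := (hp n).1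
      have : t (n + k) * (t (n + 1) * t (n + (k + 1))) ≤ t (n + k) * (t n * t (n + (k + 1) + 1)) := by
        have e1 : n + (k + 1) = n + k + 1 := rfl
        have e2 : n + (k + 1) + 1 = n + k + 2 := rfl
        rw [e1]
        rw [show n + k + 1 + 1 = n + k + 2 from rfl]
        nlinarith [mul_le_mul_of_nonneg_right ih p1.le, mul_le_mul_of_nonneg_left h3 p2.le]
      exact le_of_mul_le_mul_left this p0
  have step : ∀ n, n ≤ N → t (n + 1) ≤ t (N + 1) / t N * t n := by
    intro n hn
    obtain ⟨k, rfl⟩ := Nat.exists_eq_add_of_le hn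
    rw [div_mul_eq_mul_div, le_div_iff₀ (hp _).1]
    linarith [key k n]
  have hr : 0 ≤ t (N + 1) / t N := div_nonneg (ht _) (ht _)
  have : ∀ n, n ≤ N → t n ≤ t 0 * (t (N + 1) / t N) ^ n := by
    intro n
    induction n with
    | zero => simp
    | succ n ih =>
      intro hn
      calc _ ≤ _ := step n (by omega)
        _ ≤ t (N + 1) / t N * (t 0 * (t (N + 1) / t N) ^ n) :=
          mul_le_mul_of_nonneg_left (ih (by omega)) hr
        _ = _ := by ring
  exact this N le_rfl

end LogConvex

/-! ### The power method -/

section Power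

variable {ι κ : Type*} [Fintype ι] [Fintype κ]

/-- The `j`-th iterate of `EᵀE` started at `Q`. -/
def powIter (E : Matrix ι ι ℝ) (Q : Matrix ι κ ℝ) (j : ℕ) : Matrix ι κ ℝ :=
  (fun Q => Eᵀ * (E * Q))^[j] Q

theorem powIter_succ (E : Matrix ι ι ℝ) (Q : Matrix ι κ ℝ) (j : ℕ) :
    powIter E Q (j + 1) = Eᵀ * (E * powIter E Q j) :=
  Function.iterate_succ_apply' _ _ _

/-- The squared norms of `Q`, `E Q`, `EᵀE Q`, `E EᵀE Q`, and so on. -/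
def powNorm (E : Matrix ι ι ℝ) (Q : Matrix ι κ ℝ) (n : ℕ) : ℝ :=
  if n % 2 = 0 then frob (powIter E Q (n / 2)) (powIter E Q (n / 2))
  else frob (E * powIter E Q (n / 2)) (E * powIter E Q (n / 2))

theorem powNorm_two_mul (E : Matrix ι ι ℝ) (Q : Matrix ι κ ℝ) (j : ℕ) :
    powNorm E Q (2 * j) = frob (powIter E Q j) (powIter E Q j) := by
  simp [powNorm]

theorem powNorm_two_mul_add_one (E : Matrix ι ι ℝ) (Q : Matrix ι κ ℝ) (j : ℕ) :
    powNorm E Q (2 * j + 1) = frob (E * powIter E Q j) (E * powIter E Q j) := by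
  rw [powNorm, if_neg (by omega), show (2 * j + 1) / 2 = j by omega]

theorem powNorm_nonneg (E : Matrix ι ι ℝ) (Q : Matrix ι κ ℝ) (n : ℕ) : 0 ≤ powNorm E Q n := by
  unfold powNorm
  split <;> exact frob_self_nonneg _

/-- Moving one factor E or Eᵀ across the inner product turns the squared norm of a term of the chain
Q, EQ, EᵀEQ, … into the inner product of its two neighbours; then Cauchy–Schwarz applies. -/
theorem powNorm_logConvex (E : Matrix ι ι ℝ) (Q : Matrix ι κ ℝ) (n : ℕ) :
    powNorm E Q (n + 1) ^ 2 ≤ powNorm E Q n * powNorm E Q (n + 2) := by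
  obtain ⟨j, rfl | rfl⟩ := Nat.even_or_odd' n
  · rw [show 2 * j + 2 = 2 * (j + 1) by ring, powNorm_two_mul, powNorm_two_mul,
      powNorm_two_mul_add_one, powIter_succ, frob_mul_left]
    exact frob_sq_le _ _
  · rw [show 2 * j + 1 + 1 = 2 * (j + 1) by ring, show 2 * j + 1 + 2 = 2 * (j + 1) + 1 by ring,
      powNorm_two_mul, powNorm_two_mul_add_one, powNorm_two_mul_add_one]
    have : frob (powIter E Q (j + 1)) (powIter E Q (j + 1)) =
        frob (E * powIter E Q j) (E * powIter E Q (j + 1)) := by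
      conv_lhs => rw [powIter_succ]
      rw [frob_mul_left, Matrix.transpose_transpose, ← powIter_succ]
    rw [this]
    exact frob_sq_le _ _

/-- Started at the identity, the iteration contains the iteration from every vector. This makes the
power method deterministic: no random start and no spectral gap are needed. -/
theorem powIter_mul {μ : Type*} [Fintype μ] (E : Matrix ι ι ℝ) (Q : Matrix ι κ ℝ)
    (V : Matrix κ μ ℝ) (j : ℕ) : powIter E (Q * V) j = powIter E Q j * V := by
  induction j with
  | zero => rfl
  | succ j ih => rw [powIter_succ, ih, powIter_succ, Matrix.mul_assoc, Matrix.mul_assoc]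

end Power

/-! ### Approximate operator norms and their subgradients. -/

section Dual

variable {n : Type*} [Fintype n] [DecidableEq n]

/-- The squared operator norm of `E` is estimated by the Rayleigh quotient at `(EᵀE)^q`. -/
noncomputable def rayleigh (q : ℕ) (E : Matrix n n ℝ) : ℝ :=
  powNorm E (1 : Matrix n n ℝ) (2 * q + 1) / powNorm E (1 : Matrix n n ℝ) (2 * q)

/-- The square root of `r`, by `q` steps of Newton's method. -/
noncomputable def newtonSqrt (q : ℕ) (r : ℝ) : ℝ :=
  (fun l => (l + r / l) / 2)^[q] (1 + r)

/-- An upper estimate of the operator norm of `E`. -/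
noncomputable def normEst (ξ : ℝ) (q : ℕ) (E : Matrix n n ℝ) : ℝ :=
  (1 + ξ) * newtonSqrt q (rayleigh q E)

/-- A matrix of nuclear norm at most one whose inner product with `E` is almost the operator norm
of `E`, that is, an approximate subgradient of the operator norm at `E`. -/
noncomputable def dualMat (ξ : ℝ) (q : ℕ) (E : Matrix n n ℝ) : Matrix n n ℝ :=
  (normEst ξ q E * powNorm E (1 : Matrix n n ℝ) (2 * q))⁻¹ • (E * powIter E (1 : Matrix n n ℝ) q * (powIter E (1 : Matrix n n ℝ) q)ᵀ)

/-- By the arithmetic-geometric mean inequality the iterates stay above √r, so r / l is below √r and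
each step at least halves the error; the start 1 + r has error at most 1 + r. -/
theorem newtonSqrt_bounds {r : ℝ} (hr : 0 ≤ r) (q : ℕ) :
    0 < newtonSqrt q r ∧ √r ≤ newtonSqrt q r ∧ newtonSqrt q r ≤ √r + (1 + r) / 2 ^ q := by
  have hs := Real.sqrt_nonneg r
  have hsq := Real.sq_sqrt hr
  induction q with
  | zero =>
    refine ⟨?_, ?_, ?_⟩ <;> simp only [newtonSqrt, Function.iterate_zero, id, pow_zero] <;>
      nlinarith [sq_nonneg (√r - 1)]
  | succ q ih =>
    obtain ⟨h0, h1, h2⟩ := ih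
    have e : newtonSqrt (q + 1) r = (newtonSqrt q r + r / newtonSqrt q r) / 2 :=
      Function.iterate_succ_apply' _ _ _
    rw [e]
    set l := newtonSqrt q r
    have hl : r / l ≤ √r := by
      rw [div_le_iff₀ h0]
      nlinarith
    have hd : 0 ≤ r / l := div_nonneg hr h0.le
    refine ⟨by linarith, ?_, ?_⟩
    · have : √r * 2 * l ≤ (l + r / l) * l := by
        rw [add_mul, div_mul_cancel₀ _ h0.ne']
        nlinarith [sq_nonneg (l - √r)]
      have := le_of_mul_le_mul_right this h0
      linarith
    · rw [pow_succ, ← div_div]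
      linarith

theorem rayleigh_nonneg (q : ℕ) (E : Matrix n n ℝ) : 0 ≤ rayleigh q E := by
  unfold rayleigh
  exact div_nonneg (powNorm_nonneg _ _ _) (powNorm_nonneg _ _ _)

theorem rayleigh_le (q : ℕ) (E : Matrix n n ℝ) : rayleigh q E ≤ opNorm E ^ 2 := by
  unfold rayleigh
  refine div_le_of_le_mul₀ (powNorm_nonneg _ _ _) (sq_nonneg _) ?_
  rw [powNorm_two_mul_add_one, powNorm_two_mul, sq]
  exact frob_mulVec_le E E _

theorem powNorm_zero_one (E : Matrix n n ℝ) : powNorm E (1 : Matrix n n ℝ) 0 = Fintype.card n := by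
  have h := powNorm_two_mul E (1 : Matrix n n ℝ) 0
  rw [mul_zero] at h
  rw [h, frob_eq_trace]
  simp [powIter, Matrix.trace_one]

theorem powNorm_one_one (E : Matrix n n ℝ) : powNorm E (1 : Matrix n n ℝ) 1 = frob E E := by
  have := powNorm_two_mul_add_one E (1 : Matrix n n ℝ) 0
  simpa [powIter] using this

theorem card_pos_of_ne_zero {E : Matrix n n ℝ} (hE : E ≠ 0) : (0 : ℝ) < Fintype.card n := by
  have : Nonempty n := by
    by_contra h
    rw [not_nonempty_iff] at h
    exact hE (Subsingleton.elim _ _)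
  exact_mod_cast Fintype.card_pos

theorem powNorm_pos {E : Matrix n n ℝ} (hE : E ≠ 0) (N : ℕ) :
    0 < powNorm E (1 : Matrix n n ℝ) N := by
  refine (pos_of_logConvex (powNorm_nonneg E (1 : Matrix n n ℝ)) (powNorm_logConvex E (1 : Matrix n n ℝ)) ?_ ?_ N).1
  · rw [powNorm_zero_one]
    exact card_pos_of_ne_zero hE
  · rw [powNorm_one_one]
    exact (frob_self_nonneg E).lt_of_ne fun h => hE (frob_self_eq_zero h.symm)

/-- Log-convexity of the chain started at the unit vector v, whose term 0 is 1, followed by ‖(EᵀE)^q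
v‖ ≤ ‖(EᵀE)^q‖ in Frobenius norm. -/
theorem sum_mulVec_pow_le (E : Matrix n n ℝ) (v : n → ℝ) (hv : ∑ i, v i * v i = 1) (q : ℕ) :
    (∑ i, (E *ᵥ v) i * (E *ᵥ v) i) ^ (2 * q) ≤ powNorm E (1 : Matrix n n ℝ) (2 * q) := by
  let V : Matrix n Unit ℝ := Matrix.of fun i _ => v i
  have h0 : powNorm E V 0 = 1 := by
    have := powNorm_two_mul E V 0
    rw [mul_zero] at this
    rw [this, ← hv]
    simp [frob, powIter, V]
  have h1 : powNorm E V 1 = ∑ i, (E *ᵥ v) i * (E *ᵥ v) i := by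
    have := powNorm_two_mul_add_one E V 0
    rw [mul_zero, zero_add] at this
    rw [this]
    simp [frob, powIter, V, Matrix.mul_apply, Matrix.mulVec, dotProduct]
  have h2 := pow_le_of_logConvex (powNorm_nonneg E V) (powNorm_logConvex E V) h0 (2 * q)
  rw [h1] at h2
  refine h2.trans ?_
  rw [powNorm_two_mul, powNorm_two_mul]
  have h3 : powIter E V q = powIter E (1 : Matrix n n ℝ) q * V := by
    have := powIter_mul E (1 : Matrix n n ℝ) V q
    rwa [Matrix.one_mul] at this
  rw [h3]
  have h4 := sum_mulVec_sq_le_frob (powIter E (1 : Matrix n n ℝ) q) v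
  rw [hv, mul_one] at h4
  refine le_trans (le_of_eq ?_) h4
  have h5 : ∀ i, (powIter E (1 : Matrix n n ℝ) q * V) i () = (powIter E (1 : Matrix n n ℝ) q *ᵥ v) i :=
    fun i => by rw [Matrix.mul_apply]; rfl
  simp only [frob, Finset.univ_unique, Finset.sum_singleton]
  exact Finset.sum_congr rfl fun i _ => by rw [← h5]

/-- For a unit vector v and the Rayleigh quotient ρ, the two log-convexity bounds give (‖Ev‖²)^{2q}
≤ n ρ^{2q}. The dimension n is the squared Frobenius norm of the identity, and Bernoulli's
inequality absorbs it into (1 + ξ)^{2q}. -/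
theorem opNorm_le_rayleigh {ξ : ℝ} {q : ℕ} (hξ : 0 ≤ ξ) (hq : Fintype.card n ≤ q * ξ) (hq0 : 0 < q)
    (E : Matrix n n ℝ) : opNorm E ≤ (1 + ξ) * √(rayleigh q E) := by
  by_cases hE : E = 0
  · have : opNorm E = 0 := by rw [hE]; simp [opNorm]
    rw [this]
    positivity
  have hR := rayleigh_nonneg q E
  have hunit : ∀ v : n → ℝ, ∑ i, v i * v i = 1 →
      ‖(WithLp.toLp 2 (E *ᵥ v) : EuclideanSpace ℝ n)‖ ≤ (1 + ξ) * √(rayleigh q E) := by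
    intro v hv
    have h1 := sum_mulVec_pow_le E v hv q
    have h2 := le_pow_of_logConvex (powNorm_nonneg E (1 : Matrix n n ℝ)) (powNorm_logConvex E (1 : Matrix n n ℝ))
      (by rw [powNorm_zero_one]; exact card_pos_of_ne_zero hE) (powNorm_pos hE 1) (2 * q)
    rw [powNorm_zero_one] at h2
    have h3 : (Fintype.card n : ℝ) ≤ (1 + ξ) ^ (2 * q) := by
      refine le_trans ?_ (one_add_mul_le_pow (by linarith) _)
      push_cast
      nlinarith
    have h4 : (∑ i, (E *ᵥ v) i * (E *ᵥ v) i) ^ (2 * q) ≤ ((1 + ξ) * rayleigh q E) ^ (2 * q) := by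
      rw [mul_pow]
      refine h1.trans (h2.trans ?_)
      exact mul_le_mul_of_nonneg_right h3 (pow_nonneg hR _)
    have h5 := le_of_pow_le_pow_left₀ (by omega) (by positivity) h4
    rw [← norm_toLp_sq] at h5
    refine le_of_sq_le_sq ?_ (by positivity)
    rw [mul_pow, Real.sq_sqrt hR]
    nlinarith [mul_nonneg hξ hR, mul_nonneg (mul_nonneg hξ hξ) hR]
  refine opNorm_le (by positivity) fun v => ?_
  set N := ‖(WithLp.toLp 2 v : EuclideanSpace ℝ n)‖ with hN
  rcases (norm_nonneg (WithLp.toLp 2 v : EuclideanSpace ℝ n)).eq_or_lt with h0 | h0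
  · have : (WithLp.toLp 2 v : EuclideanSpace ℝ n) = 0 := norm_eq_zero.1 h0.symm
    have hv : v = 0 := by simpa using this
    rw [hv]
    simp
    positivity
  · have hs : ∑ i, (N⁻¹ • v) i * (N⁻¹ • v) i = 1 := by
      rw [← norm_toLp_sq, WithLp.toLp_smul, norm_smul, norm_inv, norm_norm, ← hN,
        inv_mul_cancel₀ h0.ne', one_pow]
    have := hunit _ hs
    rw [Matrix.mulVec_smul, WithLp.toLp_smul, norm_smul, norm_inv, norm_norm, ← hN,
      inv_mul_le_iff₀ h0] at this
    linarith

theorem normEst_pos {ξ : ℝ} (hξ : 0 ≤ ξ) (q : ℕ) (E : Matrix n n ℝ) : 0 < normEst ξ q E :=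
  mul_pos (by linarith) (newtonSqrt_bounds (rayleigh_nonneg q E) q).1

theorem opNorm_le_normEst {ξ : ℝ} {q : ℕ} (hξ : 0 ≤ ξ) (hq : Fintype.card n ≤ q * ξ) (hq0 : 0 < q)
    (E : Matrix n n ℝ) : opNorm E ≤ normEst ξ q E :=
  (opNorm_le_rayleigh hξ hq hq0 E).trans
    (mul_le_mul_of_nonneg_left (newtonSqrt_bounds (rayleigh_nonneg q E) q).2.1 (by linarith))

/-- The initial error 1 + r is at most 1 + b², and 2^q ≥ q already makes the halved error at most ξ.
The same q thus serves for the power method and for Newton's method. -/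
theorem newtonSqrt_le {ξ b : ℝ} {q : ℕ} (hξ : 0 ≤ ξ) (hq : 1 + b ^ 2 ≤ q * ξ) {E : Matrix n n ℝ}
    (hE : opNorm E ≤ b) : newtonSqrt q (rayleigh q E) ≤ √(rayleigh q E) + ξ := by
  refine (newtonSqrt_bounds (rayleigh_nonneg q E) q).2.2.trans (add_le_add_right ?_ _)
  have h2 : (q : ℝ) ≤ 2 ^ q := by exact_mod_cast (Nat.lt_two_pow_self (n := q)).le
  rw [div_le_iff₀ (by positivity)]
  have := rayleigh_le q E
  have h3 : opNorm E ^ 2 ≤ b ^ 2 := pow_le_pow_left₀ (opNorm_nonneg E) hE 2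
  nlinarith

theorem normEst_le {ξ b : ℝ} {q : ℕ} (hξ : 0 ≤ ξ) (hξ1 : ξ ≤ 1) (hb : 1 ≤ b)
    (hq : 1 + b ^ 2 ≤ q * ξ) {E : Matrix n n ℝ}
    (hE : opNorm E ≤ b) : normEst ξ q E ≤ opNorm E + 3 * ξ * b := by
  have h1 := newtonSqrt_le hξ hq hE
  have h2 : √(rayleigh q E) ≤ opNorm E := by
    rw [Real.sqrt_le_left (opNorm_nonneg E)]
    exact rayleigh_le q E
  have h3 : normEst ξ q E ≤ (1 + ξ) * (opNorm E + ξ) :=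
    mul_le_mul_of_nonneg_left (by linarith) (by linarith)
  nlinarith [mul_le_mul_of_nonneg_left hE hξ, mul_le_mul_of_nonneg_left hb hξ,
    mul_le_mul_of_nonneg_left hξ1 hξ]

/-- With Q = (EᵀE)^q the pairing is ⟨EQ, NQ⟩ divided by ‖Q‖² times an upper bound of ‖E‖, while ⟨EQ,
NQ⟩ ≤ ‖E‖ ‖N‖ ‖Q‖². This is why the norm has to be overestimated. -/
theorem frob_dualMat_le {ξ : ℝ} {q : ℕ} (hξ : 0 ≤ ξ) (hq : Fintype.card n ≤ q * ξ) (hq0 : 0 < q)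
    (E N : Matrix n n ℝ) : frob (dualMat ξ q E) N ≤ opNorm N := by
  rw [dualMat, frob_smul_left]
  have h1 : frob (E * powIter E (1 : Matrix n n ℝ) q * (powIter E (1 : Matrix n n ℝ) q)ᵀ) N =
      frob (E * powIter E (1 : Matrix n n ℝ) q) (N * powIter E (1 : Matrix n n ℝ) q) := by
    simp only [frob_eq_trace, Matrix.transpose_mul, Matrix.transpose_transpose]
    rw [Matrix.mul_assoc, Matrix.trace_mul_comm, Matrix.mul_assoc]
  rw [h1, powNorm_two_mul]
  have h2 := frob_mulVec_le E N (powIter E (1 : Matrix n n ℝ) q)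
  have h3 := opNorm_le_normEst hξ hq hq0 E
  have h4 := normEst_pos hξ q E
  have h5 := frob_self_nonneg (powIter E (1 : Matrix n n ℝ) q)
  rw [inv_mul_eq_div]
  refine div_le_of_le_mul₀ (by positivity) (opNorm_nonneg N) (h2.trans ?_)
  nlinarith [mul_le_mul_of_nonneg_right h3 (mul_nonneg (opNorm_nonneg N) h5)]

/-- Pair the matrix with itself: f ≤ ‖W‖ ≤ √f forces f ≤ 1. -/
theorem frob_dualMat_self_le {ξ : ℝ} {q : ℕ} (hξ : 0 ≤ ξ) (hq : Fintype.card n ≤ q * ξ)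
    (hq0 : 0 < q) (E : Matrix n n ℝ) : frob (dualMat ξ q E) (dualMat ξ q E) ≤ 1 := by
  have h := (frob_dualMat_le hξ hq hq0 E (dualMat ξ q E)).trans (opNorm_le_sqrt_frob _)
  set f := frob (dualMat ξ q E) (dualMat ξ q E)
  have h0 : 0 ≤ f := frob_self_nonneg _
  by_contra hc
  push Not at hc
  have : √f < f := by
    rw [Real.sqrt_lt' (by linarith)]
    nlinarith
  linarith

/-- The pairing with E is the Rayleigh quotient over the norm estimate, and both are accurate: the
quotient up to the factor of the power method, the estimate up to that factor and Newton's error ξ.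
-/
theorem le_frob_dualMat {ξ b : ℝ} {q : ℕ} (hξ : 0 ≤ ξ) (hb : 1 ≤ b)
    (hc : Fintype.card n ≤ q * ξ) (hq : 1 + b ^ 2 ≤ q * ξ) (hq0 : 0 < q) {E : Matrix n n ℝ}
    (hE : opNorm E ≤ b) : opNorm E - 3 * ξ * b ≤ frob (dualMat ξ q E) E := by
  by_cases hE0 : E = 0
  · have : opNorm E = 0 := by rw [hE0]; simp [opNorm]
    rw [this, hE0]
    have : frob (dualMat ξ q (0 : Matrix n n ℝ)) 0 = 0 := by simp [frob]
    rw [this]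
    have : 0 ≤ 3 * ξ * b := by positivity
    linarith
  have h1 : frob (E * powIter E (1 : Matrix n n ℝ) q * (powIter E (1 : Matrix n n ℝ) q)ᵀ) E =
      frob (E * powIter E (1 : Matrix n n ℝ) q) (E * powIter E (1 : Matrix n n ℝ) q) := by
    simp only [frob_eq_trace, Matrix.transpose_mul, Matrix.transpose_transpose]
    rw [Matrix.mul_assoc, Matrix.trace_mul_comm, Matrix.mul_assoc]
  rw [dualMat, frob_smul_left, h1, ← powNorm_two_mul_add_one]
  have hp := powNorm_pos hE0 (2 * q)
  have e1 : (normEst ξ q E * powNorm E (1 : Matrix n n ℝ) (2 * q))⁻¹ * powNorm E (1 : Matrix n n ℝ) (2 * q + 1) =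
      rayleigh q E / normEst ξ q E := by
    rw [rayleigh]
    field_simp
  rw [e1, le_div_iff₀ (normEst_pos hξ q E)]
  have h2 := newtonSqrt_le hξ hq hE
  have h3 : √(rayleigh q E) ≤ opNorm E := by
    rw [Real.sqrt_le_left (opNorm_nonneg E)]
    exact rayleigh_le q E
  have h4 := opNorm_le_rayleigh hξ hc hq0 E
  have h5 := Real.sq_sqrt (rayleigh_nonneg q E)
  have h6 := newtonSqrt_bounds (rayleigh_nonneg q E) q
  have h7 := Real.sqrt_nonneg (rayleigh q E)
  rw [normEst]
  set s := √(rayleigh q E)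
  set l := newtonSqrt q (rayleigh q E)
  set e := opNorm E
  rw [← h5]
  -- The right-hand side is the square s², so a nonpositive left factor is trivial. Otherwise l is
  -- replaced by s + ξ, and the claim becomes (s - ξ)(s + ξ) ≤ s².
  by_cases hneg : e - 3 * ξ * b ≤ 0
  · have : (e - 3 * ξ * b) * ((1 + ξ) * l) ≤ 0 :=
      mul_nonpos_of_nonpos_of_nonneg hneg (mul_nonneg (by linarith) h6.1.le)
    nlinarith
  push Not at hneg
  have h8 : (e - 3 * ξ * b) * ((1 + ξ) * l) ≤ (e - 3 * ξ * b) * ((1 + ξ) * (s + ξ)) := by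
    gcongr
  refine h8.trans ?_
  have h9 : (e - 3 * ξ * b) * (1 + ξ) ≤ s - ξ := by
    have a1 : ξ * e ≤ ξ * b := mul_le_mul_of_nonneg_left hE hξ
    have a2 : ξ * s ≤ ξ * e := mul_le_mul_of_nonneg_left h3 hξ
    have a3 : ξ ≤ ξ * b := by nlinarith
    have a4 : 0 ≤ ξ * (ξ * b) := by positivity
    nlinarith
  nlinarith [mul_le_mul_of_nonneg_right h9 (by linarith : 0 ≤ s + ξ)]

end Dual

/-! ### Linear maps on tensor squares -/

section Residual

variable {d : ℕ}

/-- The error matrix of the linear map `R` on tensor squares, at the point `x`. -/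
def residual (R : Matrix (Fin d × Fin d) (Fin d × Fin d) ℝ) (x : EuclideanSpace ℝ (Fin d)) :
    Matrix (Fin d) (Fin d) ℝ :=
  asMatrix (R *ᵥ tensorSq x) - Matrix.vecMulVec x x

/-- The rank-one matrix `vec(W) (x^{⊗2})ᵀ`. -/
def rankOne (W : Matrix (Fin d) (Fin d) ℝ) (x : EuclideanSpace ℝ (Fin d)) :
    Matrix (Fin d × Fin d) (Fin d × Fin d) ℝ :=
  Matrix.of fun p r => W p.1 p.2 * tensorSq x r

theorem spectralError_eq {k : ℕ} (A : Matrix (Fin k) (Fin d × Fin d) ℝ)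
    (B : Matrix (Fin d × Fin d) (Fin k) ℝ) (x : EuclideanSpace ℝ (Fin d)) :
    spectralError A B x = opNorm (residual (B * A) x) := by
  rw [spectralError, residual, Matrix.mulVec_mulVec]

theorem sum_tensorSq_mul (x y : EuclideanSpace ℝ (Fin d)) :
    ∑ p, tensorSq x p * tensorSq y p = (∑ i, x i * y i) ^ 2 := by
  rw [Fintype.sum_prod_type, sq, Finset.sum_mul_sum]
  exact Finset.sum_congr rfl fun i _ => Finset.sum_congr rfl fun j _ => by
    simp only [tensorSq]; ring

theorem norm_sq_eq_sum (x : EuclideanSpace ℝ (Fin d)) : ‖x‖ ^ 2 = ∑ i, x i * x i :=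
  norm_toLp_sq x.ofLp

theorem sum_tensorSq_self {x : EuclideanSpace ℝ (Fin d)} (hx : ‖x‖ = 1) :
    ∑ p, tensorSq x p * tensorSq x p = 1 := by
  rw [sum_tensorSq_mul, ← norm_sq_eq_sum, hx]
  norm_num

theorem frob_asMatrix (z w : Fin d × Fin d → ℝ) :
    frob (asMatrix z) (asMatrix w) = ∑ p, z p * w p := by
  rw [Fintype.sum_prod_type]
  rfl

theorem vecMulVec_eq_asMatrix (x : EuclideanSpace ℝ (Fin d)) :
    Matrix.vecMulVec x x = asMatrix (tensorSq x) := rfl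

/-- The chain rule: `rankOne W x` represents the functional R ↦ ⟨W, M(R x^{⊗2})⟩, so it is a
subgradient of the loss in R when W is one of the operator norm at the error matrix. -/
theorem frob_rankOne (W : Matrix (Fin d) (Fin d) ℝ) (x : EuclideanSpace ℝ (Fin d))
    (R : Matrix (Fin d × Fin d) (Fin d × Fin d) ℝ) :
    frob (rankOne W x) R = frob W (asMatrix (R *ᵥ tensorSq x)) := by
  have : frob (rankOne W x) R = ∑ p : Fin d × Fin d, W p.1 p.2 * (R *ᵥ tensorSq x) p := by
    simp only [frob, rankOne, Matrix.of_apply, Matrix.mulVec, dotProduct, Finset.mul_sum]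
    exact Finset.sum_congr rfl fun p _ => Finset.sum_congr rfl fun r _ => by ring
  rw [this, Fintype.sum_prod_type]
  rfl

/-- Tensor squares have inner product ⟨x, y⟩². Thus errors can be evaluated from inner products of
examples and d × d matrices, without forming a d² × d² matrix. -/
theorem rankOne_mulVec (W : Matrix (Fin d) (Fin d) ℝ) (x y : EuclideanSpace ℝ (Fin d)) :
    asMatrix (rankOne W x *ᵥ tensorSq y) = (∑ i, x i * y i) ^ 2 • W := by
  ext i j
  rw [← sum_tensorSq_mul]
  simp only [asMatrix, Matrix.of_apply, rankOne, Matrix.mulVec, dotProduct, Matrix.smul_apply,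
    smul_eq_mul, Finset.sum_mul]
  exact Finset.sum_congr rfl fun r _ => by ring

theorem frob_rankOne_self {x : EuclideanSpace ℝ (Fin d)} (hx : ‖x‖ = 1)
    (W : Matrix (Fin d) (Fin d) ℝ) : frob (rankOne W x) (rankOne W x) = frob W W := by
  rw [frob_rankOne, rankOne_mulVec, ← norm_sq_eq_sum, hx]
  norm_num

theorem opNorm_residual_le {x : EuclideanSpace ℝ (Fin d)} (hx : ‖x‖ = 1)
    (R : Matrix (Fin d × Fin d) (Fin d × Fin d) ℝ) :
    opNorm (residual R x) ≤ √(frob R R) + 1 := by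
  refine (opNorm_sub_le _ _).trans (add_le_add ?_ ?_)
  · refine (opNorm_le_sqrt_frob _).trans (Real.sqrt_le_sqrt ?_)
    rw [frob_asMatrix]
    refine (sum_mulVec_sq_le_frob R _).trans (le_of_eq ?_)
    rw [sum_tensorSq_self hx, mul_one]
  · refine (opNorm_le_sqrt_frob _).trans ?_
    rw [vecMulVec_eq_asMatrix, frob_asMatrix, sum_tensorSq_self hx, Real.sqrt_one]

theorem residual_sub (R R' : Matrix (Fin d × Fin d) (Fin d × Fin d) ℝ)
    (x : EuclideanSpace ℝ (Fin d)) :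
    asMatrix ((R - R') *ᵥ tensorSq x) = residual R x - residual R' x := by
  rw [residual, residual, sub_sub_sub_cancel_right, Matrix.sub_mulVec]
  rfl

theorem opNorm_residual_zero {x : EuclideanSpace ℝ (Fin d)} (hx : ‖x‖ = 1) :
    opNorm (residual 0 x) ≤ 1 := by
  have h := opNorm_residual_le hx 0
  have : frob (0 : Matrix (Fin d × Fin d) (Fin d × Fin d) ℝ) 0 = 0 := by simp [frob]
  simpa [this] using h

end Residual

/-! ### Stochastic subgradient descent with restarts -/

/-- Parameters: step length, precision and number of iterations of the approximate subgradients,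
and code length. -/
structure Params where
  step : ℝ
  prec : ℝ
  iters : ℕ
  len : ℕ

/-- The conditions on the parameters that make the approximate subgradients accurate, when `b`
bounds the error matrices. -/
structure Params.Valid (P : Params) (d : ℕ) (b : ℝ) : Prop where
  step_pos : 0 < P.step
  prec_nonneg : 0 ≤ P.prec
  prec_le : P.prec ≤ 1
  card_le : (d : ℝ) ≤ P.iters * P.prec
  sq_le : 1 + b ^ 2 ≤ P.iters * P.prec
  bound : 1 + P.step * P.len ≤ b

theorem Params.Valid.one_le {P : Params} {d : ℕ} {b : ℝ} (h : P.Valid d b) : 1 ≤ b := by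
  have := h.bound
  have : 0 ≤ P.step * P.len := mul_nonneg h.step_pos.le (Nat.cast_nonneg _)
  linarith

theorem Params.Valid.iters_pos {P : Params} {d : ℕ} {b : ℝ} (h : P.Valid d b) : 0 < P.iters := by
  rcases Nat.eq_zero_or_pos P.iters with h0 | h0
  · have := h.sq_le
    rw [h0, Nat.cast_zero, zero_mul] at this
    nlinarith [sq_nonneg b]
  · exact h0

section Descent

variable {d : ℕ} (P : Params) (xs : ℕ → EuclideanSpace ℝ (Fin d))

/-- The iterates of subgradient descent, restarted at the multiples of `P.len + 1`. -/
noncomputable def iterate : ℕ → Matrix (Fin d × Fin d) (Fin d × Fin d) ℝ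
  | 0 => 0
  | p + 1 =>
    -- The step on the last example of a block is discarded, so blocks of `P.len + 1` examples
    -- produce sums of at most `P.len` rank-one terms.
    if P.len + 1 ∣ p + 1 then 0
    else iterate p -
      P.step • rankOne (dualMat P.prec P.iters (residual (iterate p) (xs p))) (xs p)

/-- The approximate subgradient of the operator norm used in step `p`. -/
noncomputable def weight (p : ℕ) : Matrix (Fin d) (Fin d) ℝ :=
  dualMat P.prec P.iters (residual (iterate P xs p) (xs p))

/-- The last restart up to time `p`. -/
def blockStart (T p : ℕ) : ℕ := (T + 1) * (p / (T + 1))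

theorem blockStart_le (T p : ℕ) : blockStart T p ≤ p := Nat.mul_div_le _ _

theorem lt_blockStart_add (T p : ℕ) : p < blockStart T p + (T + 1) := by
  have := Nat.lt_mul_div_succ p (Nat.succ_pos T)
  rw [blockStart]
  calc p < (T + 1) * (p / (T + 1) + 1) := this
    _ = _ := by ring

theorem blockStart_succ_of_dvd {T p : ℕ} (h : T + 1 ∣ p + 1) : blockStart T (p + 1) = p + 1 :=
  Nat.mul_div_cancel' h

theorem blockStart_succ_of_not_dvd {T p : ℕ} (h : ¬ T + 1 ∣ p + 1) :
    blockStart T (p + 1) = blockStart T p := by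
  rw [blockStart, Nat.succ_div_of_not_dvd h, blockStart]

/-- The program has no integer division: it stores the start of the block and detects the restart by
this comparison. -/
theorem dvd_succ_iff (T p : ℕ) : T + 1 ∣ p + 1 ↔ blockStart T p + T < p + 1 := by
  constructor
  · intro h
    by_contra hc
    obtain ⟨a, ha⟩ := h
    have h1 := lt_blockStart_add T p
    have h2 := blockStart_le T p
    rw [blockStart] at *
    set c := p / (T + 1)
    have h3 : a < c + 1 := by
      by_contra hh
      push Not at hh
      have := Nat.mul_le_mul_left (T + 1) hh
      rw [← ha] at this
      nlinarith
    have h4 : c < a := by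
      by_contra hh
      push Not at hh
      have := Nat.mul_le_mul_left (T + 1) hh
      omega
    omega
  · intro h
    have h1 := lt_blockStart_add T p
    have : p + 1 = (T + 1) * (p / (T + 1) + 1) := by
      rw [blockStart] at *
      ring_nf at *
      omega
    exact ⟨_, this⟩

theorem iterate_succ_of_dvd {p : ℕ} (h : P.len + 1 ∣ p + 1) : iterate P xs (p + 1) = 0 := by
  rw [iterate, if_pos h]

theorem iterate_succ_of_not_dvd {p : ℕ} (h : ¬ P.len + 1 ∣ p + 1) :
    iterate P xs (p + 1) = iterate P xs p - P.step • rankOne (weight P xs p) (xs p) := by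
  rw [iterate, if_neg h, weight]

theorem iterate_mul (c : ℕ) : iterate P xs ((P.len + 1) * c) = 0 := by
  rcases c with _ | c
  · rfl
  · exact iterate_succ_of_dvd P xs ⟨c + 1, rfl⟩

/-- The source of the code length: each summand has rank one, and a block contributes at most
`P.len` of them. -/
theorem iterate_eq_sum (p : ℕ) : iterate P xs p =
    -(P.step • ∑ s ∈ Finset.Ico (blockStart P.len p) p, rankOne (weight P xs s) (xs s)) := by
  induction p with
  | zero => simp [iterate]
  | succ p ih =>
    by_cases h : P.len + 1 ∣ p + 1
    · rw [iterate_succ_of_dvd P xs h, blockStart_succ_of_dvd h]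
      simp
    · rw [iterate_succ_of_not_dvd P xs h, blockStart_succ_of_not_dvd h,
        Finset.sum_Ico_succ_top (blockStart_le _ _), ih, smul_add]
      abel

theorem residual_iterate_apply (p : ℕ) (x : EuclideanSpace ℝ (Fin d)) (i j : Fin d) :
    residual (iterate P xs p) x i j = -(x i * x j) - P.step *
      ∑ s ∈ Finset.Ico (blockStart P.len p) p, (∑ l, xs s l * x l) ^ 2 * weight P xs s i j := by
  have h : asMatrix (iterate P xs p *ᵥ tensorSq x) = -(P.step •
      ∑ s ∈ Finset.Ico (blockStart P.len p) p, asMatrix (rankOne (weight P xs s) (xs s) *ᵥ tensorSq x)) := by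
    ext i j
    rw [iterate_eq_sum]
    simp [asMatrix, Matrix.neg_mulVec, Matrix.smul_mulVec, Matrix.sum_mulVec, Matrix.sum_apply]
  rw [residual, h]
  simp only [rankOne_mulVec, Matrix.sub_apply, Matrix.neg_apply, Matrix.smul_apply,
    Matrix.sum_apply, smul_eq_mul, Matrix.vecMulVec_apply]
  ring

/-- An iterate has no memory beyond the last restart. All independence statements below rest on
this. -/
theorem iterate_congr {xs ys : ℕ → EuclideanSpace ℝ (Fin d)} (p : ℕ)
    (h : ∀ s, blockStart P.len p ≤ s → s < p → xs s = ys s) : iterate P xs p = iterate P ys p := by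
  induction p with
  | zero => rfl
  | succ p ih =>
    by_cases hd : P.len + 1 ∣ p + 1
    · rw [iterate_succ_of_dvd P _ hd, iterate_succ_of_dvd P _ hd]
    · rw [blockStart_succ_of_not_dvd hd] at h
      rw [iterate_succ_of_not_dvd P _ hd, iterate_succ_of_not_dvd P _ hd, weight, weight,
        ih fun s hs hp => h s hs (by omega), h p (blockStart_le _ _) (by omega)]

variable {P xs} {b : ℝ}

theorem frob_weight_self_le (hP : P.Valid d b) (p : ℕ) :
    frob (weight P xs p) (weight P xs p) ≤ 1 :=
  frob_dualMat_self_le hP.prec_nonneg (by simpa using hP.card_le) hP.iters_pos _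

theorem sqrt_frob_iterate_le (hP : P.Valid d b) (p : ℕ) (hx : ∀ s, s < p → ‖xs s‖ = 1) :
    √(frob (iterate P xs p) (iterate P xs p)) ≤ P.step * (p - blockStart P.len p : ℕ) := by
  induction p with
  | zero => simp [iterate, frob]
  | succ p ih =>
    by_cases hd : P.len + 1 ∣ p + 1
    · rw [iterate_succ_of_dvd P _ hd, blockStart_succ_of_dvd hd]
      simp [frob]
    · rw [iterate_succ_of_not_dvd P _ hd, blockStart_succ_of_not_dvd hd, sub_eq_add_neg]
      refine (sqrt_frob_add_le _ _).trans ?_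
      have h1 : frob (-(P.step • rankOne (weight P xs p) (xs p)))
          (-(P.step • rankOne (weight P xs p) (xs p))) ≤ P.step ^ 2 := by
        rw [← neg_smul, frob_smul_left, frob_smul_right, frob_rankOne_self (hx p (by omega))]
        nlinarith [frob_weight_self_le (xs := xs) hP p, sq_nonneg P.step]
      have h2 := Real.sqrt_le_sqrt h1
      rw [Real.sqrt_sq hP.step_pos.le] at h2
      have h3 := ih fun s hs => hx s (by omega)
      rw [Nat.sub_add_comm (blockStart_le _ _)]
      push_cast
      linarith

theorem opNorm_residual_iterate_le (hP : P.Valid d b) (p : ℕ) (hx : ∀ s, s < p → ‖xs s‖ = 1)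
    {x : EuclideanSpace ℝ (Fin d)} (h : ‖x‖ = 1) : opNorm (residual (iterate P xs p) x) ≤ b := by
  refine (opNorm_residual_le h _).trans (le_trans ?_ hP.bound)
  have h1 := sqrt_frob_iterate_le hP p hx
  have h2 : ((p - blockStart P.len p : ℕ) : ℝ) ≤ P.len := by
    have := lt_blockStart_add P.len p
    exact_mod_cast (by omega : p - blockStart P.len p ≤ P.len)
  have := mul_le_mul_of_nonneg_left h2 hP.step_pos.le
  linarith

/-- Expand ‖D - step • G‖². The linear term ⟨G, D⟩ is the pairing of the weight with the difference
of the two error matrices; it is at least the difference of their norms minus the subgradient error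
3 · prec · b. The quadratic term is at most step². -/
theorem descent_step (hP : P.Valid d b) (p : ℕ) (hx : ∀ s, s ≤ p → ‖xs s‖ = 1)
    (R : Matrix (Fin d × Fin d) (Fin d × Fin d) ℝ) :
    let R' := iterate P xs p - P.step • rankOne (weight P xs p) (xs p)
    2 * P.step * (opNorm (residual (iterate P xs p) (xs p)) - opNorm (residual R (xs p))) +
      frob (R' - R) (R' - R) ≤ frob (iterate P xs p - R) (iterate P xs p - R) +
        (2 * P.step * (3 * P.prec * b) + P.step ^ 2) := by
  intro R'
  set G := rankOne (weight P xs p) (xs p) with hG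
  set D := iterate P xs p - R with hD
  have e : R' - R = D - P.step • G := by
    simp only [R', D]
    abel
  have hb := opNorm_residual_iterate_le hP p (fun s hs => hx s hs.le) (hx p le_rfl)
  have h1 : frob G D = frob (weight P xs p) (residual (iterate P xs p) (xs p)) -
      frob (weight P xs p) (residual R (xs p)) := by
    rw [hG, hD, frob_rankOne, residual_sub, frob_sub_right]
  have h2 := le_frob_dualMat hP.prec_nonneg hP.one_le (by simpa using hP.card_le) hP.sq_le
    hP.iters_pos hb
  have h3 := frob_dualMat_le hP.prec_nonneg (by simpa using hP.card_le) hP.iters_pos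
    (residual (iterate P xs p) (xs p)) (residual R (xs p))
  have h4 : frob G G ≤ 1 := by
    rw [hG, frob_rankOne_self (hx p le_rfl)]
    exact frob_weight_self_le hP p
  have h5 : ∀ A B : Matrix (Fin d × Fin d) (Fin d × Fin d) ℝ, frob (A - P.step • B) (A - P.step • B) =
      frob A A - 2 * P.step * frob B A + P.step ^ 2 * frob B B := by
    intro A B
    rw [frob_sub_left, frob_sub_right, frob_sub_right, frob_smul_left, frob_smul_left,
      frob_smul_right, frob_smul_right, frob_comm A B]
    ring
  rw [e, h5, h1]
  rw [← weight] at h2 h3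
  have hs := hP.step_pos
  nlinarith [mul_le_mul_of_nonneg_left h4 (sq_nonneg P.step),
    mul_le_mul_of_nonneg_left h2 hs.le, mul_le_mul_of_nonneg_left h3 hs.le]

/-- The potential is the squared distance to R; it starts at ‖R‖², since a block starts at 0, and
the steps telescope. -/
theorem regret_bound (hP : P.Valid d b) (c : ℕ)
    (hx : ∀ s, s < (P.len + 1) * (c + 1) → ‖xs s‖ = 1)
    (R : Matrix (Fin d × Fin d) (Fin d × Fin d) ℝ) :
    ∑ p ∈ Finset.range (P.len + 1), opNorm (residual (iterate P xs ((P.len + 1) * c + p))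
        (xs ((P.len + 1) * c + p))) ≤
      ∑ p ∈ Finset.range (P.len + 1), opNorm (residual R (xs ((P.len + 1) * c + p))) +
        (frob R R / (2 * P.step) + (P.len + 1) * (3 * P.prec * b + P.step / 2)) := by
  set a := (P.len + 1) * c with ha
  have hlt : (P.len + 1) * (c + 1) = a + (P.len + 1) := by rw [ha]; ring
  rw [hlt] at hx
  set κ := 2 * P.step * (3 * P.prec * b) + P.step ^ 2 with hκ
  have key : ∀ n, n ≤ P.len → 2 * P.step * (∑ p ∈ Finset.range n,
      (opNorm (residual (iterate P xs (a + p)) (xs (a + p))) - opNorm (residual R (xs (a + p))))) +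
      frob (iterate P xs (a + n) - R) (iterate P xs (a + n) - R) ≤ frob R R + n * κ := by
    intro n
    induction n with
    | zero =>
      intro _
      rw [add_zero, ha, iterate_mul, zero_sub]
      simp [frob]
    | succ n ih =>
      intro hn
      have h1 := ih (by omega)
      have h2 := descent_step hP (a + n) (fun s hs => hx s (by omega)) R
      have hnd : ¬ P.len + 1 ∣ a + n + 1 := by
        rw [ha, add_assoc, Nat.dvd_add_right ⟨c, rfl⟩]
        intro h
        have := Nat.le_of_dvd (by omega) h
        omega
      rw [← add_assoc, iterate_succ_of_not_dvd P xs hnd, Finset.sum_range_succ, mul_add]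
      push_cast
      simp only at h2
      linarith
  have h1 := key P.len le_rfl
  -- The last example of the block counts for the regret, but the next iterate is a restart. Here
  -- `descent_step` is applied to the discarded update, whose distance to R is dropped.
  have h2 := descent_step hP (a + P.len) (fun s hs => hx s (by omega)) R
  simp only at h2
  have h3 := frob_self_nonneg (iterate P xs (a + P.len) -
    P.step • rankOne (weight P xs (a + P.len)) (xs (a + P.len)) - R)
  have h4 : 2 * P.step * (∑ p ∈ Finset.range (P.len + 1),
      (opNorm (residual (iterate P xs (a + p)) (xs (a + p))) - opNorm (residual R (xs (a + p)))))
      ≤ frob R R + (P.len + 1) * κ := by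
    rw [Finset.sum_range_succ, mul_add]
    linarith
  have hs := hP.step_pos
  rw [Finset.sum_sub_distrib] at h4
  have h5 : frob R R / (2 * P.step) + (P.len + 1) * (3 * P.prec * b + P.step / 2) =
      (frob R R + (P.len + 1) * κ) / (2 * P.step) := by
    rw [hκ]
    field_simp
  rw [h5, ← sub_le_iff_le_add', le_div_iff₀ (by positivity)]
  linarith

end Descent

/-! ### The Frobenius norm of a matrix of low rank -/

theorem frob_eq_sum_norm {n : Type*} [Fintype n] [DecidableEq n] (M : Matrix n n ℝ) :
    frob M M = ∑ j, ‖Matrix.toEuclideanCLM (n := n) (𝕜 := ℝ) M (EuclideanSpace.single j 1)‖ ^ 2 := by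
  rw [frob, Finset.sum_comm]
  refine Finset.sum_congr rfl fun j _ => ?_
  rw [EuclideanSpace.norm_sq_eq]
  refine Finset.sum_congr rfl fun i _ => ?_
  simp [Matrix.ofLp_toEuclideanCLM, sq]

/-- With an orthonormal basis (e_i) of the range, the squared Frobenius norm is the sum of ‖M*
e_i‖², one term of size at most ‖M‖² for each dimension of the range. -/
theorem frob_mul_self_le {n : Type*} [Fintype n] [DecidableEq n] {k : ℕ}
    (A : Matrix (Fin k) n ℝ) (B : Matrix n (Fin k) ℝ) :
    frob (B * A) (B * A) ≤ (min k (Fintype.card n) : ℕ) * opNorm (B * A) ^ 2 := by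
  set M := B * A with hM
  set L := Matrix.toEuclideanCLM (n := n) (𝕜 := ℝ) M with hL
  let S := LinearMap.range (L : EuclideanSpace ℝ n →ₗ[ℝ] EuclideanSpace ℝ n)
  let e := stdOrthonormalBasis ℝ S
  have hrank : Module.finrank ℝ S ≤ min k (Fintype.card n) := by
    have h1 : Module.finrank ℝ S = M.rank := by
      rw [Matrix.rank_eq_finrank_range_toLin M (EuclideanSpace.basisFun n ℝ).toBasis
        (EuclideanSpace.basisFun n ℝ).toBasis]
      congr 2
    rw [h1]
    refine le_min ?_ (Matrix.rank_le_card_width M)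
    have := (Matrix.rank_mul_le_right B A).trans (Matrix.rank_le_card_height A)
    simpa using this
  have h1 : ∀ v : EuclideanSpace ℝ n, ‖L v‖ ^ 2 =
      ∑ i, (inner ℝ (L.adjoint (e i : EuclideanSpace ℝ n)) v) ^ 2 := by
    intro v
    have hv : L v ∈ S := ⟨v, rfl⟩
    have := e.sum_sq_norm_inner_right ⟨L v, hv⟩
    rw [Submodule.coe_norm] at this
    simp only at this
    rw [← this]
    refine Finset.sum_congr rfl fun i _ => ?_
    rw [ContinuousLinearMap.adjoint_inner_left, Submodule.coe_inner, Real.norm_eq_abs, sq_abs]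
  rw [frob_eq_sum_norm]
  simp_rw [← hL, h1]
  rw [Finset.sum_comm]
  have h2 : ∀ i, ∑ j, (inner ℝ (L.adjoint (e i : EuclideanSpace ℝ n))
      (EuclideanSpace.single j (1 : ℝ))) ^ 2 ≤ opNorm M ^ 2 := by
    intro i
    have h3 : ∑ j, (inner ℝ (L.adjoint (e i : EuclideanSpace ℝ n))
        (EuclideanSpace.single j (1 : ℝ))) ^ 2 = ‖L.adjoint (e i : EuclideanSpace ℝ n)‖ ^ 2 := by
      rw [EuclideanSpace.norm_sq_eq]
      refine Finset.sum_congr rfl fun j _ => ?_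
      rw [EuclideanSpace.inner_single_right]
      simp
    rw [h3]
    refine pow_le_pow_left₀ (norm_nonneg _) ?_ 2
    refine (L.adjoint.le_opNorm _).trans ?_
    have h4 : ‖(e i : EuclideanSpace ℝ n)‖ = 1 := by
      rw [← Submodule.coe_norm]
      exact e.orthonormal.1 i
    rw [h4, mul_one, LinearIsometryEquiv.norm_map]
    rfl
  refine (Finset.sum_le_sum fun i _ => h2 i).trans ?_
  rw [Finset.sum_const, Finset.card_univ, Fintype.card_fin, nsmul_eq_mul]
  exact mul_le_mul_of_nonneg_right (by exact_mod_cast hrank) (sq_nonneg _)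

/-! ### Reconstruction from the spectral error -/

/-- With e the norm of the perturbation, |⟨x, v⟩| ≥ ‖Mv‖ - e = ‖M‖ - e ≥ ‖Mx‖ - e ≥ 1 - 2e. Only the
maximality of v is used, so ties among singular vectors do not matter. -/
theorem abs_inner_ge_of_topRightSingularVector {d : ℕ} {M : Matrix (Fin d) (Fin d) ℝ}
    {x v : EuclideanSpace ℝ (Fin d)} (hx : ‖x‖ = 1) (hv : IsTopRightSingularVector M v) :
    1 - 2 * opNorm (M - Matrix.vecMulVec x x) ≤ |inner ℝ x v| := by
  set L := Matrix.toEuclideanCLM (n := Fin d) (𝕜 := ℝ) M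
  set e := opNorm (M - Matrix.vecMulVec x x) with he
  have happ : ∀ w : EuclideanSpace ℝ (Fin d), ‖L w - (inner ℝ x w) • x‖ ≤ e * ‖w‖ := by
    intro w
    have h1 := (Matrix.toEuclideanCLM (n := Fin d) (𝕜 := ℝ) (M - Matrix.vecMulVec x x)).le_opNorm w
    have h2 : Matrix.toEuclideanCLM (n := Fin d) (𝕜 := ℝ) (M - Matrix.vecMulVec x x) w =
        L w - (inner ℝ x w : ℝ) • x := by
      rw [map_sub, sub_apply]
      congr 1
      ext i
      simp only [Matrix.ofLp_toEuclideanCLM, Matrix.mulVec, dotProduct, Matrix.vecMulVec_apply,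
        PiLp.smul_apply, smul_eq_mul, PiLp.inner_apply, Finset.sum_mul]
      exact Finset.sum_congr rfl fun j _ => by simp; ring
    rwa [h2] at h1
  have h1 := happ v
  have h2 := happ x
  rw [hv.1, mul_one] at h1
  rw [hx, mul_one, real_inner_self_eq_norm_sq, hx, one_pow, one_smul] at h2
  have h3 : ‖L x‖ ≤ opNorm M := by
    have := L.le_opNorm x
    rwa [hx, mul_one] at this
  have h4 : 1 ≤ ‖L x‖ + e := by
    have := norm_sub_norm_le x (L x)
    rw [norm_sub_rev, hx] at this
    linarith
  have h5 : ‖L v‖ ≤ |inner ℝ x v| + e := by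
    have := norm_sub_norm_le (L v) ((inner ℝ x v : ℝ) • x)
    rw [norm_smul, hx, mul_one, Real.norm_eq_abs] at this
    linarith
  rw [hv.2] at h5
  linarith

/-- For unit vectors ‖v ∓ x‖² = 2 ∓ 2⟨x, v⟩; the sign is chosen to agree with that of ⟨x, v⟩. -/
theorem min_norm_sq_le {d : ℕ} {M : Matrix (Fin d) (Fin d) ℝ}
    {x v : EuclideanSpace ℝ (Fin d)} (hx : ‖x‖ = 1) (hv : IsTopRightSingularVector M v) :
    min (‖v - x‖ ^ 2) (‖v + x‖ ^ 2) ≤ 4 * opNorm (M - Matrix.vecMulVec x x) := by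
  have h := abs_inner_ge_of_topRightSingularVector hx hv
  have h1 := norm_sub_sq_real v x
  have h2 := norm_add_sq_real v x
  rw [hv.1, hx, real_inner_comm] at h1 h2
  rcases abs_cases (inner ℝ x v : ℝ) with ⟨ha, _⟩ | ⟨ha, _⟩
  · exact (min_le_left _ _).trans (by linarith)
  · exact (min_le_right _ _).trans (by linarith)

/-! ### Measurability -/

section Measurability

instance matrixMeasurableSpace {m n : Type*} : MeasurableSpace (Matrix m n ℝ) :=
  inferInstanceAs (MeasurableSpace (m → n → ℝ))

instance matrixBorelSpace {m n : Type*} [Fintype m] [Fintype n] : BorelSpace (Matrix m n ℝ) :=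
  inferInstanceAs (BorelSpace (m → n → ℝ))

variable {Ω : Type*} [MeasurableSpace Ω] {ι κ μ : Type*} [Fintype ι] [Fintype κ] [Fintype μ]

theorem measurable_matrix {f : Ω → Matrix ι κ ℝ} (h : ∀ i j, Measurable fun ω => f ω i j) :
    Measurable f :=
  measurable_pi_lambda _ fun i => measurable_pi_lambda _ fun j => h i j

theorem measurable_entry {f : Ω → Matrix ι κ ℝ} (h : Measurable f) (i : ι) (j : κ) :
    Measurable fun ω => f ω i j :=
  (measurable_pi_apply j).comp ((measurable_pi_apply i).comp h)

theorem measurable_mul {f : Ω → Matrix ι κ ℝ} {g : Ω → Matrix κ μ ℝ} (hf : Measurable f)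
    (hg : Measurable g) : Measurable fun ω => f ω * g ω := by
  refine measurable_matrix fun i j => ?_
  simp only [Matrix.mul_apply]
  exact Finset.measurable_sum _ fun l _ => (measurable_entry hf i l).mul (measurable_entry hg l j)

theorem measurable_transpose {f : Ω → Matrix ι κ ℝ} (hf : Measurable f) :
    Measurable fun ω => (f ω)ᵀ :=
  measurable_matrix fun i j => measurable_entry hf j i

theorem measurable_frob {f g : Ω → Matrix ι κ ℝ} (hf : Measurable f) (hg : Measurable g) :
    Measurable fun ω => frob (f ω) (g ω) :=
  Finset.measurable_sum _ fun i _ => Finset.measurable_sum _ fun j _ =>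
    (measurable_entry hf i j).mul (measurable_entry hg i j)

theorem measurable_smul_matrix {c : Ω → ℝ} {f : Ω → Matrix ι κ ℝ} (hc : Measurable c)
    (hf : Measurable f) : Measurable fun ω => c ω • f ω :=
  measurable_matrix fun i j => hc.mul (measurable_entry hf i j)

theorem measurable_sub_matrix {f g : Ω → Matrix ι κ ℝ} (hf : Measurable f) (hg : Measurable g) :
    Measurable fun ω => f ω - g ω :=
  measurable_matrix fun i j => (measurable_entry hf i j).sub (measurable_entry hg i j)

theorem measurable_opNorm [DecidableEq ι] {f : Ω → Matrix ι ι ℝ} (hf : Measurable f) :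
    Measurable fun ω => opNorm (f ω) := by
  have h : Continuous fun M : Matrix ι ι ℝ => opNorm M := by
    let L : Matrix ι ι ℝ →ₗ[ℝ] (EuclideanSpace ℝ ι →L[ℝ] EuclideanSpace ℝ ι) :=
      (Matrix.toEuclideanCLM (n := ι) (𝕜 := ℝ)).toAlgEquiv.toLinearMap
    exact (LinearMap.continuous_of_finiteDimensional L).norm
  exact h.measurable.comp hf

variable [DecidableEq ι]

theorem measurable_powIter {f : Ω → Matrix ι ι ℝ} (hf : Measurable f) (q : ℕ) :
    Measurable fun ω => powIter (f ω) (1 : Matrix ι ι ℝ) q := by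
  induction q with
  | zero => exact measurable_const
  | succ q ih =>
    simp only [powIter_succ]
    exact measurable_mul (measurable_transpose hf) (measurable_mul hf ih)

theorem measurable_powNorm {f : Ω → Matrix ι ι ℝ} (hf : Measurable f) (n : ℕ) :
    Measurable fun ω => powNorm (f ω) (1 : Matrix ι ι ℝ) n := by
  obtain ⟨j, rfl | rfl⟩ := Nat.even_or_odd' n
  · simp only [powNorm_two_mul]
    exact measurable_frob (measurable_powIter hf j) (measurable_powIter hf j)
  · simp only [powNorm_two_mul_add_one]
    exact measurable_frob (measurable_mul hf (measurable_powIter hf j))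
      (measurable_mul hf (measurable_powIter hf j))

theorem measurable_newtonSqrt {r : Ω → ℝ} (hr : Measurable r) (q : ℕ) :
    Measurable fun ω => newtonSqrt q (r ω) := by
  induction q with
  | zero => exact measurable_const.add hr
  | succ q ih =>
    have : ∀ ω, newtonSqrt (q + 1) (r ω) =
        (newtonSqrt q (r ω) + r ω / newtonSqrt q (r ω)) / 2 :=
      fun ω => Function.iterate_succ_apply' _ _ _
    simp only [this]
    exact (ih.add (hr.div ih)).div_const 2

theorem measurable_normEst {f : Ω → Matrix ι ι ℝ} (hf : Measurable f) (ξ : ℝ) (q : ℕ) :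
    Measurable fun ω => normEst ξ q (f ω) :=
  (measurable_newtonSqrt ((measurable_powNorm hf _).div (measurable_powNorm hf _)) q).const_mul _

theorem measurable_dualMat {f : Ω → Matrix ι ι ℝ} (hf : Measurable f) (ξ : ℝ) (q : ℕ) :
    Measurable fun ω => dualMat ξ q (f ω) :=
  measurable_smul_matrix ((measurable_normEst hf ξ q).mul (measurable_powNorm hf _)).inv
    (measurable_mul (measurable_mul hf (measurable_powIter hf q))
      (measurable_transpose (measurable_powIter hf q)))

variable {d : ℕ}

theorem measurable_coord {x : Ω → EuclideanSpace ℝ (Fin d)} (hx : Measurable x) (i : Fin d) :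
    Measurable fun ω => x ω i :=
  (EuclideanSpace.proj (𝕜 := ℝ) i).continuous.measurable.comp hx

theorem measurable_tensorSq {x : Ω → EuclideanSpace ℝ (Fin d)} (hx : Measurable x)
    (p : Fin d × Fin d) : Measurable fun ω => tensorSq (x ω) p :=
  (measurable_coord hx _).mul (measurable_coord hx _)

theorem measurable_residual {R : Ω → Matrix (Fin d × Fin d) (Fin d × Fin d) ℝ}
    {x : Ω → EuclideanSpace ℝ (Fin d)} (hR : Measurable R) (hx : Measurable x) :
    Measurable fun ω => residual (R ω) (x ω) := by
  refine measurable_sub_matrix (measurable_matrix fun i j => ?_) (measurable_matrix fun i j => ?_)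
  · exact Finset.measurable_sum _ fun r _ => (measurable_entry hR _ r).mul (measurable_tensorSq hx r)
  · exact (measurable_coord hx i).mul (measurable_coord hx j)

theorem measurable_rankOne {W : Ω → Matrix (Fin d) (Fin d) ℝ}
    {x : Ω → EuclideanSpace ℝ (Fin d)} (hW : Measurable W) (hx : Measurable x) :
    Measurable fun ω => rankOne (W ω) (x ω) :=
  measurable_matrix fun p r => (measurable_entry hW _ _).mul (measurable_tensorSq hx r)

theorem measurable_iterate (P : Params) {xs : Ω → ℕ → EuclideanSpace ℝ (Fin d)}
    (hx : Measurable xs) (p : ℕ) : Measurable fun ω => iterate P (xs ω) p := by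
  have hp : ∀ p, Measurable fun ω => xs ω p := fun p => (measurable_pi_apply p).comp hx
  induction p with
  | zero => exact measurable_const
  | succ p ih =>
    simp only [iterate]
    split
    · exact measurable_const
    · exact measurable_sub_matrix ih (measurable_smul_matrix measurable_const
        (measurable_rankOne (measurable_dualMat (measurable_residual ih (hp p)) _ _) (hp p)))

end Measurability

/-! ### Expected losses -/

section Loss

variable {d : ℕ}

/-- The expected spectral error of a linear map on tensor squares. -/
noncomputable def risk (D : Measure (EuclideanSpace ℝ (Fin d)))
    (R : Matrix (Fin d × Fin d) (Fin d × Fin d) ℝ) : ENNReal :=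
  ∫⁻ x, ENNReal.ofReal (opNorm (residual R x)) ∂D

theorem spectralLoss_eq {k : ℕ} (D : Measure (EuclideanSpace ℝ (Fin d)))
    (A : Matrix (Fin k) (Fin d × Fin d) ℝ) (B : Matrix (Fin d × Fin d) (Fin k) ℝ) :
    spectralLoss D A B = risk D (B * A) := by
  simp only [spectralLoss, risk, spectralError_eq]

theorem measurable_loss : Measurable fun z : Matrix (Fin d × Fin d) (Fin d × Fin d) ℝ ×
    EuclideanSpace ℝ (Fin d) => ENNReal.ofReal (opNorm (residual z.1 z.2)) :=
  (measurable_opNorm (measurable_residual measurable_fst measurable_snd)).ennreal_ofReal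

theorem measurable_risk (D : Measure (EuclideanSpace ℝ (Fin d))) [SFinite D] :
    Measurable (risk D) :=
  measurable_loss.lintegral_prod_right'

theorem risk_zero_le (D : Measure (EuclideanSpace ℝ (Fin d))) [IsProbabilityMeasure D]
    (hD : ∀ᵐ x ∂D, ‖x‖ = 1) : risk D 0 ≤ 1 := by
  calc risk D 0 ≤ ∫⁻ _, 1 ∂D := by
        refine lintegral_mono_ae (hD.mono fun x hx => ?_)
        exact ENNReal.ofReal_le_one.2 (opNorm_residual_zero hx)
    _ = 1 := by simp

theorem spectralError_nonneg {k : ℕ} (A : Matrix (Fin k) (Fin d × Fin d) ℝ)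
    (B : Matrix (Fin d × Fin d) (Fin k) ℝ) (x : EuclideanSpace ℝ (Fin d)) :
    0 ≤ spectralError A B x := opNorm_nonneg _

theorem reconstructionLoss_le {k : ℕ} {D : Measure (EuclideanSpace ℝ (Fin d))}
    (hD : ∀ᵐ x ∂D, ‖x‖ = 1) {A : Matrix (Fin k) (Fin d × Fin d) ℝ}
    {B : Matrix (Fin d × Fin d) (Fin k) ℝ}
    {f : (EuclideanSpace ℝ (Fin d) → (Fin k → ℝ)) × ((Fin k → ℝ) → EuclideanSpace ℝ (Fin d))}
    (hf : f ∈ spectralAutoencoder A B) :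
    reconstructionLoss D f ≤ 4 * spectralLoss D A B := by
  rw [reconstructionLoss, spectralLoss, ← lintegral_const_mul' _ _ (by norm_num)]
  refine lintegral_mono_ae (hD.mono fun x hx => ?_)
  have h := min_norm_sq_le hx (hf.2 (f.1 x))
  rw [hf.1 x] at h ⊢
  rw [show (4 : ENNReal) = ENNReal.ofReal 4 by norm_num, ← ENNReal.ofReal_mul (by norm_num)]
  exact ENNReal.ofReal_le_ofReal h

end Loss

open ProbabilityTheory

/-! ### Functions of disjoint sets of coordinates -/

section Product

variable {m : ℕ} {E : Type*} [MeasurableSpace E] (D : Measure E) [IsProbabilityMeasure D]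

/-- Each function factors measurably through the restriction to its own coordinates, and
restrictions to disjoint sets are independent. -/
theorem indepFun_of_disjoint [Inhabited E] {β γ : Type*} [MeasurableSpace β] [MeasurableSpace γ]
    {S T : Finset (Fin m)} (hST : Disjoint S T) {f : (Fin m → E) → β} {g : (Fin m → E) → γ}
    (hf : Measurable f) (hg : Measurable g)
    (hfS : ∀ X Y, (∀ i ∈ S, X i = Y i) → f X = f Y)
    (hgT : ∀ X Y, (∀ i ∈ T, X i = Y i) → g X = g Y) :
    IndepFun f g (Measure.pi fun _ : Fin m => D) := by
  have h1 : iIndepFun (fun i (X : Fin m → E) => X i) (Measure.pi fun _ : Fin m => D) :=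
    iIndepFun_pi (X := fun _ => id) fun i => aemeasurable_id
  have h2 := h1.indepFun_finset S T hST fun i => measurable_pi_apply i
  -- The missing coordinates are filled with a default value, which does not affect a function that
  -- ignores them.
  let ext : ∀ U : Finset (Fin m), (U → E) → (Fin m → E) :=
    fun U y i => if h : i ∈ U then y ⟨i, h⟩ else default
  have hext : ∀ U, Measurable (ext U) := by
    intro U
    refine measurable_pi_lambda _ fun i => ?_
    by_cases h : i ∈ U
    · simp only [ext, dif_pos h]
      exact measurable_pi_apply _
    · simp only [ext, dif_neg h]
      exact measurable_const
  have h3 := h2.comp (hf.comp (hext S)) (hg.comp (hext T))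
  have ef : (f ∘ ext S) ∘ (fun (X : Fin m → E) (i : S) => X i) = f := by
    funext X
    exact hfS _ _ fun i hi => by simp [ext, hi]
  have eg : (g ∘ ext T) ∘ (fun (X : Fin m → E) (i : T) => X i) = g := by
    funext X
    exact hgT _ _ fun i hi => by simp [ext, hi]
  rw [← ef, ← eg]
  exact h3

theorem measure_inter_of_disjoint [Inhabited E] {S T : Finset (Fin m)} (hST : Disjoint S T)
    {A B : Set (Fin m → E)} (hA : MeasurableSet A) (hB : MeasurableSet B)
    (hAS : ∀ X Y, (∀ i ∈ S, X i = Y i) → (X ∈ A ↔ Y ∈ A))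
    (hBT : ∀ X Y, (∀ i ∈ T, X i = Y i) → (X ∈ B ↔ Y ∈ B)) :
    Measure.pi (fun _ : Fin m => D) (A ∩ B) =
      Measure.pi (fun _ : Fin m => D) A * Measure.pi (fun _ : Fin m => D) B := by
  have h := indepFun_of_disjoint D hST (f := fun X => X ∈ A) (g := fun X => X ∈ B)
    (measurable_mem.2 hA) (measurable_mem.2 hB)
    (fun X Y hXY => propext (hAS X Y hXY)) (fun X Y hXY => propext (hBT X Y hXY))
  have h2 := h.measure_inter_preimage_eq_mul {True} {True} trivial trivial
  have e : ∀ C : Set (Fin m → E), (fun X => X ∈ C) ⁻¹' {True} = C := fun C => by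
    ext X
    simp
  rwa [e, e] at h2

end Product

/-- Fubini for the product law: an independent Z may be analysed with Y frozen. This is what allows
a random iterate in a concentration bound; G carries the almost sure information about Y. -/
theorem measure_pair_le {Ω β γ : Type*} [MeasurableSpace Ω] [MeasurableSpace β]
    [MeasurableSpace γ] {μ : Measure Ω} [IsProbabilityMeasure μ] {Y : Ω → β} {Z : Ω → γ}
    (hYZ : IndepFun Y Z μ) (hY : Measurable Y) (hZ : Measurable Z) {B : Set (β × γ)}
    (hB : MeasurableSet B) {G : Set β} (hG : MeasurableSet G) (hYG : ∀ᵐ ω ∂μ, Y ω ∈ G)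
    {c : ENNReal} (h : ∀ y ∈ G, μ {ω | (y, Z ω) ∈ B} ≤ c) : μ {ω | (Y ω, Z ω) ∈ B} ≤ c := by
  have h1 := (indepFun_iff_map_prod_eq_prod_map_map hY.aemeasurable hZ.aemeasurable).1 hYZ
  have h2 : μ {ω | (Y ω, Z ω) ∈ B} = μ.map (fun ω => (Y ω, Z ω)) B :=
    (Measure.map_apply (hY.prodMk hZ) hB).symm
  have : IsProbabilityMeasure (μ.map Y) := Measure.isProbabilityMeasure_map hY.aemeasurable
  have : IsProbabilityMeasure (μ.map Z) := Measure.isProbabilityMeasure_map hZ.aemeasurable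
  rw [h2, h1, Measure.prod_apply hB]
  have h3 : ∀ᵐ y ∂(μ.map Y), y ∈ G := (ae_map_iff hY.aemeasurable hG).2 hYG
  calc _ ≤ ∫⁻ _, c ∂(μ.map Y) := by
        refine lintegral_mono_ae (h3.mono fun y hy => ?_)
        rw [Measure.map_apply hZ (measurable_prodMk_left hB)]
        exact h y hy
    _ = c := by simp

theorem lintegral_pair_eq {Ω β γ : Type*} [MeasurableSpace Ω] [MeasurableSpace β]
    [MeasurableSpace γ] {μ : Measure Ω} [IsProbabilityMeasure μ] {Y : Ω → β} {Z : Ω → γ}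
    (hYZ : IndepFun Y Z μ) (hY : Measurable Y) (hZ : Measurable Z) {F : β × γ → ENNReal}
    (hF : Measurable F) :
    ∫⁻ ω, F (Y ω, Z ω) ∂μ = ∫⁻ ω, ∫⁻ z, F (Y ω, z) ∂(μ.map Z) ∂μ := by
  have h1 := (indepFun_iff_map_prod_eq_prod_map_map hY.aemeasurable hZ.aemeasurable).1 hYZ
  have : IsProbabilityMeasure (μ.map Z) := Measure.isProbabilityMeasure_map hZ.aemeasurable
  have : IsProbabilityMeasure (μ.map Y) := Measure.isProbabilityMeasure_map hY.aemeasurable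
  rw [← lintegral_map hF (hY.prodMk hZ), h1, lintegral_prod _ hF.aemeasurable,
    lintegral_map hF.lintegral_prod_right' hY]

/-! ### The random iterates -/

section Random

variable {d m : ℕ}

/-- A sample, extended by zeros. -/
noncomputable def extend (X : Fin m → EuclideanSpace ℝ (Fin d)) : ℕ → EuclideanSpace ℝ (Fin d) :=
  fun i => if h : i < m then X ⟨i, h⟩ else 0

theorem extend_of_lt (X : Fin m → EuclideanSpace ℝ (Fin d)) {i : ℕ} (h : i < m) :
    extend X i = X ⟨i, h⟩ := dif_pos h

theorem measurable_extend : Measurable (extend : (Fin m → EuclideanSpace ℝ (Fin d)) → _) := by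
  refine measurable_pi_lambda _ fun i => ?_
  by_cases h : i < m
  · simp only [extend, dif_pos h]
    exact measurable_pi_apply _
  · simp only [extend, dif_neg h]
    exact measurable_const

theorem extend_congr {X Y : Fin m → EuclideanSpace ℝ (Fin d)} {s : ℕ}
    (h : ∀ hs : s < m, X ⟨s, hs⟩ = Y ⟨s, hs⟩) : extend X s = extend Y s := by
  by_cases hs : s < m
  · rw [extend_of_lt X hs, extend_of_lt Y hs, h hs]
  · simp only [extend, dif_neg hs]

/-- The examples with indices in `[a, b)`. -/
def window (m a b : ℕ) : Finset (Fin m) := Finset.univ.filter fun i => a ≤ i.1 ∧ i.1 < b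

theorem mem_window {a b : ℕ} {i : Fin m} : i ∈ window m a b ↔ a ≤ i.1 ∧ i.1 < b := by
  simp [window]

theorem disjoint_window {a b c e : ℕ} (h : b ≤ c) : Disjoint (window m a b) (window m c e) := by
  rw [Finset.disjoint_left]
  intro i h1 h2
  rw [mem_window] at h1 h2
  omega

variable (P : Params) (D : Measure (EuclideanSpace ℝ (Fin d))) [IsProbabilityMeasure D]

theorem measurable_iterate_extend (p : ℕ) :
    Measurable fun X : Fin m → EuclideanSpace ℝ (Fin d) => iterate P (extend X) p :=
  measurable_iterate P measurable_extend p

theorem iterate_extend_congr {a p : ℕ} (ha : a ≤ blockStart P.len p)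
    {X Y : Fin m → EuclideanSpace ℝ (Fin d)} (h : ∀ i ∈ window m a p, X i = Y i) :
    iterate P (extend X) p = iterate P (extend Y) p :=
  iterate_congr P p fun s h1 h2 => extend_congr fun hs =>
    h ⟨s, hs⟩ (mem_window.2 ⟨ha.trans h1, h2⟩)

theorem ae_unit (hD : ∀ᵐ x ∂D, ‖x‖ = 1) :
    ∀ᵐ X ∂(Measure.pi fun _ : Fin m => D), ∀ i, ‖X i‖ = 1 := by
  rw [ae_all_iff]
  intro i
  exact (measurePreserving_eval (fun _ : Fin m => D) i).quasiMeasurePreserving.ae hD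

theorem map_eval (i : Fin m) :
    (Measure.pi fun _ : Fin m => D).map (fun X => X i) = D :=
  (measurePreserving_eval (fun _ : Fin m => D) i).map_eq

/-- The iterate p has seen only the examples before p, so the loss at the example p has the risk of
the iterate as its mean. This turns regret into risk. -/
theorem lintegral_fresh {p : ℕ} (hp : p < m) :
    ∫⁻ X, ENNReal.ofReal (opNorm (residual (iterate P (extend X) p) (extend X p)))
      ∂(Measure.pi fun _ : Fin m => D) =
    ∫⁻ X, risk D (iterate P (extend X) p) ∂(Measure.pi fun _ : Fin m => D) := by
  have hind : IndepFun (fun X : Fin m → EuclideanSpace ℝ (Fin d) => iterate P (extend X) p)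
      (fun X => X ⟨p, hp⟩) (Measure.pi fun _ : Fin m => D) :=
    indepFun_of_disjoint D (disjoint_window (a := 0) (e := p + 1) le_rfl)
      (measurable_iterate_extend P p) (measurable_pi_apply _)
      (fun X Y h => iterate_extend_congr P (Nat.zero_le _) h)
      (fun X Y h => h _ (mem_window.2 ⟨le_rfl, Nat.lt_succ_self _⟩))
  have h := lintegral_pair_eq hind (measurable_iterate_extend P p) (measurable_pi_apply _)
    measurable_loss
  rw [map_eval] at h
  simp only [extend_of_lt _ hp]
  exact h

theorem lintegral_eval {p : ℕ} (hp : p < m) (R : Matrix (Fin d × Fin d) (Fin d × Fin d) ℝ) :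
    ∫⁻ X, ENNReal.ofReal (opNorm (residual R (extend X p))) ∂(Measure.pi fun _ : Fin m => D) =
      risk D R := by
  simp only [extend_of_lt _ hp]
  rw [risk]
  conv_rhs => rw [← map_eval D (⟨p, hp⟩ : Fin m)]
  rw [lintegral_map _ (measurable_pi_apply _)]
  exact (measurable_opNorm (measurable_residual measurable_const measurable_id)).ennreal_ofReal

/-- The least expected spectral error of a linear map of squared Frobenius norm at most `r`. -/
noncomputable def optRisk (r : ℝ) : ENNReal :=
  ⨅ (R : Matrix (Fin d × Fin d) (Fin d × Fin d) ℝ) (_ : frob R R ≤ r), risk D R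

theorem optRisk_le_one (hD : ∀ᵐ x ∂D, ‖x‖ = 1) {r : ℝ} (hr : 0 ≤ r) : optRisk D r ≤ 1 :=
  (iInf₂_le 0 (by simpa [frob] using hr)).trans (risk_zero_le D hD)

variable {P} {b : ℝ}

/-- The mean of the regret bound over the sample: the left side becomes the sum of the risks of the
iterates, and the right side that of a fixed competitor. -/
theorem lintegral_block_le (hP : P.Valid d b) (hD : ∀ᵐ x ∂D, ‖x‖ = 1) {r e : ℝ}
    (he : r / (2 * P.step) + (P.len + 1) * (3 * P.prec * b + P.step / 2) ≤ (P.len + 1) * e)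
    {c : ℕ} (hc : (P.len + 1) * (c + 1) ≤ m) :
    ∫⁻ X, ∑ p ∈ Finset.range (P.len + 1), risk D (iterate P (extend X) ((P.len + 1) * c + p))
      ∂(Measure.pi fun _ : Fin m => D) ≤
    (P.len + 1 : ℕ) * (optRisk D r + ENNReal.ofReal e) := by
  set μ := Measure.pi fun _ : Fin m => D
  have hlt : (P.len + 1) * (c + 1) = (P.len + 1) * c + (P.len + 1) := by ring
  have hpm : ∀ p ∈ Finset.range (P.len + 1), (P.len + 1) * c + p < m := by
    intro p hp
    have := Finset.mem_range.1 hp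
    omega
  have key : ∀ R : Matrix (Fin d × Fin d) (Fin d × Fin d) ℝ, frob R R ≤ r →
      ∫⁻ X, ∑ p ∈ Finset.range (P.len + 1), risk D (iterate P (extend X) ((P.len + 1) * c + p)) ∂μ
        ≤ (P.len + 1 : ℕ) * (risk D R + ENNReal.ofReal e) := by
    intro R hR
    have hmeas : ∀ p, Measurable fun X : Fin m → EuclideanSpace ℝ (Fin d) =>
        ENNReal.ofReal (opNorm (residual R (extend X p))) := fun p =>
      (measurable_opNorm (measurable_residual measurable_const
        ((measurable_pi_apply p).comp measurable_extend))).ennreal_ofReal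
    have hmeas' : ∀ p, Measurable fun X : Fin m → EuclideanSpace ℝ (Fin d) =>
        ENNReal.ofReal (opNorm (residual (iterate P (extend X) p) (extend X p))) := fun p =>
      (measurable_opNorm (measurable_residual (measurable_iterate_extend P p)
        ((measurable_pi_apply p).comp measurable_extend))).ennreal_ofReal
    have hmr : ∀ p, Measurable fun X : Fin m → EuclideanSpace ℝ (Fin d) =>
        risk D (iterate P (extend X) p) := fun p =>
      (measurable_risk D).comp (measurable_iterate_extend P p)
    rw [lintegral_finsetSum _ fun p _ => hmr _,
      ← Finset.sum_congr rfl fun p hp => lintegral_fresh P D (hpm p hp),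
      ← lintegral_finsetSum _ fun p _ => hmeas' _]
    calc _ ≤ ∫⁻ X, (∑ p ∈ Finset.range (P.len + 1),
            ENNReal.ofReal (opNorm (residual R (extend X ((P.len + 1) * c + p)))) +
            ENNReal.ofReal ((P.len + 1) * e)) ∂μ := by
          refine lintegral_mono_ae ((ae_unit D hD).mono fun X hX => ?_)
          rw [← ENNReal.ofReal_sum_of_nonneg fun _ _ => opNorm_nonneg _,
            ← ENNReal.ofReal_sum_of_nonneg fun _ _ => opNorm_nonneg _,
            ]
          have h1 := regret_bound (xs := extend X) hP c (fun s hs => by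
            rw [extend_of_lt X (by omega : s < m)]
            exact hX _) R
          have h2 : frob R R / (2 * P.step) ≤ r / (2 * P.step) :=
            div_le_div_of_nonneg_right hR (by linarith [hP.step_pos])
          rw [← ENNReal.ofReal_add (Finset.sum_nonneg fun _ _ => opNorm_nonneg _)]
          · exact ENNReal.ofReal_le_ofReal (by linarith)
          · have h3 := hP.step_pos
            have h4 := frob_self_nonneg R
            have h5 : 0 ≤ P.prec * b := mul_nonneg hP.prec_nonneg (by linarith [hP.one_le])
            refine le_trans ?_ he
            have : 0 ≤ r := h4.trans hR
            have : 0 ≤ 3 * P.prec * b + P.step / 2 := by linarith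
            positivity
      _ = _ := by
          rw [lintegral_add_right _ measurable_const, lintegral_finsetSum _ fun p _ => hmeas _,
            Finset.sum_congr rfl fun p hp => lintegral_eval D (hpm p hp) R]
          simp only [Finset.sum_const, Finset.card_range, lintegral_const, measure_univ, mul_one,
            nsmul_eq_mul]
          rw [mul_add, ENNReal.ofReal_mul (by positivity)]
          congr 2
          rw [← Nat.cast_succ, ENNReal.ofReal_natCast]
  -- The bound for every competitor is rearranged into a lower bound of its risk, which passes to
  -- the infimum; no minimizer is needed.
  have h0 : ((P.len + 1 : ℕ) : ENNReal) ≠ 0 := by simp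
  have ht : ((P.len + 1 : ℕ) : ENNReal) ≠ ⊤ := ENNReal.natCast_ne_top _
  rw [← ENNReal.div_le_iff' h0 ht, ← tsub_le_iff_right]
  refine le_iInf₂ fun R hR => ?_
  rw [tsub_le_iff_right, ENNReal.div_le_iff' h0 ht]
  exact key R hR

/-- All iterates in the block `c` are bad. -/
def badBlock (P : Params) (D : Measure (EuclideanSpace ℝ (Fin d))) (m : ℕ) (a : ENNReal) (c : ℕ) :
    Set (Fin m → EuclideanSpace ℝ (Fin d)) :=
  {X | ∀ p ∈ Finset.range (P.len + 1), a ≤ risk D (iterate P (extend X) ((P.len + 1) * c + p))}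

theorem measurableSet_badBlock (a : ENNReal) (c : ℕ) :
    MeasurableSet (badBlock P D m a c) := by
  have : badBlock P D m a c = ⋂ p ∈ Finset.range (P.len + 1),
      {X | a ≤ risk D (iterate P (extend X) ((P.len + 1) * c + p))} := by
    ext X
    simp [badBlock]
  rw [this]
  exact Finset.measurableSet_biInter _ fun p _ =>
    measurableSet_le measurable_const ((measurable_risk D).comp (measurable_iterate_extend P _))

/-- Markov's inequality bounds the probability by (l + e)/(l + e'), where l is the optimum. This
increases with l, and l ≤ 1 because the zero matrix has risk at most one. -/
theorem measure_badBlock_le (hP : P.Valid d b) (hD : ∀ᵐ x ∂D, ‖x‖ = 1) {r e e' : ℝ}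
    (hr : 0 ≤ r) (he0 : 0 ≤ e) (hee : e < e')
    (he : r / (2 * P.step) + (P.len + 1) * (3 * P.prec * b + P.step / 2) ≤ (P.len + 1) * e)
    {c : ℕ} (hc : (P.len + 1) * (c + 1) ≤ m) :
    Measure.pi (fun _ : Fin m => D) (badBlock P D m (optRisk D r + ENNReal.ofReal e') c) ≤
      ENNReal.ofReal ((1 + e) / (1 + e')) := by
  set μ := Measure.pi fun _ : Fin m => D
  set a := optRisk D r + ENNReal.ofReal e' with ha
  have h1 := mul_meas_ge_le_lintegral (μ := μ) (f := fun X =>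
    ∑ p ∈ Finset.range (P.len + 1), risk D (iterate P (extend X) ((P.len + 1) * c + p)))
    (Finset.measurable_sum _ fun p _ => (measurable_risk D).comp (measurable_iterate_extend P _))
    ((P.len + 1 : ℕ) * a)
  have h2 := h1.trans (lintegral_block_le D hP hD he hc)
  have hsub : badBlock P D m a c ⊆ {X | (P.len + 1 : ℕ) * a ≤
      ∑ p ∈ Finset.range (P.len + 1), risk D (iterate P (extend X) ((P.len + 1) * c + p))} := by
    intro X hX
    have := Finset.card_nsmul_le_sum (Finset.range (P.len + 1)) _ a hX
    simpa using this
  have h3 : (P.len + 1 : ℕ) * a * μ (badBlock P D m a c) ≤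
      (P.len + 1 : ℕ) * (optRisk D r + ENNReal.ofReal e) :=
    (mul_le_mul_right (measure_mono hsub) _).trans h2
  have h0 : ((P.len + 1 : ℕ) : ENNReal) ≠ 0 := by simp
  have ht : ((P.len + 1 : ℕ) : ENNReal) ≠ ⊤ := ENNReal.natCast_ne_top _
  rw [mul_assoc, ENNReal.mul_le_mul_iff_right h0 ht] at h3
  have hL := optRisk_le_one D hD hr
  have hLt : optRisk D r ≠ ⊤ := ne_top_of_le_ne_top ENNReal.one_ne_top hL
  set l := (optRisk D r).toReal with hl
  have hlo : optRisk D r = ENNReal.ofReal l := (ENNReal.ofReal_toReal hLt).symm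
  have hl0 : 0 ≤ l := ENNReal.toReal_nonneg
  have hl1 : l ≤ 1 := by
    have := ENNReal.toReal_mono ENNReal.one_ne_top hL
    simpa using this
  set x := (μ (badBlock P D m a c)).toReal with hx
  have hxo : μ (badBlock P D m a c) = ENNReal.ofReal x :=
    (ENNReal.ofReal_toReal (measure_ne_top _ _)).symm
  have hx0 : 0 ≤ x := ENNReal.toReal_nonneg
  have ha' : a = ENNReal.ofReal (l + e') := by
    rw [ha, hlo, ENNReal.ofReal_add hl0 (by linarith)]
  rw [hxo, hlo, ha', ← ENNReal.ofReal_mul (by linarith), ← ENNReal.ofReal_add hl0 he0,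
    ENNReal.ofReal_le_ofReal_iff (by linarith)] at h3
  rw [hxo]
  refine ENNReal.ofReal_le_ofReal ?_
  rw [le_div_iff₀ (by linarith)]
  have hx1 : x ≤ 1 := by
    have : μ (badBlock P D m a c) ≤ 1 := prob_le_one
    have := ENNReal.toReal_mono ENNReal.one_ne_top this
    simpa using this
  -- To x(l + e') ≤ l + e add x(1 - l) ≤ 1 - l, valid since x ≤ 1 and l ≤ 1.
  nlinarith

/-- Thanks to the restarts, the event of a block depends only on the examples of that block, so the
probabilities multiply. -/
theorem measure_badBlocks_le {a q : ENNReal}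
    (hq : ∀ c, (P.len + 1) * (c + 1) ≤ m →
      Measure.pi (fun _ : Fin m => D) (badBlock P D m a c) ≤ q)
    {N : ℕ} (hN : (P.len + 1) * N ≤ m) :
    Measure.pi (fun _ : Fin m => D) {X | ∀ c < N, X ∈ badBlock P D m a c} ≤ q ^ N := by
  induction N with
  | zero => simp
  | succ N ih =>
    have hset : {X | ∀ c < N + 1, X ∈ badBlock P D m a c} =
        {X | ∀ c < N, X ∈ badBlock P D m a c} ∩ badBlock P D m a N := by
      ext X
      simp only [Nat.lt_succ_iff_lt_or_eq, Set.mem_ofPred_eq, Set.mem_inter_iff]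
      exact ⟨fun h => ⟨fun c hc => h c (Or.inl hc), h N (Or.inr rfl)⟩, fun h c hc =>
        hc.elim (h.1 c) fun e => e ▸ h.2⟩
    have hmeas : MeasurableSet {X | ∀ c < N, X ∈ badBlock P D m a c} := by
      have : {X | ∀ c < N, X ∈ badBlock P D m a c} =
          ⋂ c ∈ Finset.range N, badBlock P D m a c := by
        ext X
        simp
      rw [this]
      exact Finset.measurableSet_biInter _ fun c _ => measurableSet_badBlock D a c
    have hblock : ∀ c u v (X Y : Fin m → EuclideanSpace ℝ (Fin d)), u ≤ (P.len + 1) * c →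
        (P.len + 1) * (c + 1) ≤ v → (∀ i ∈ window m u v, X i = Y i) →
        (X ∈ badBlock P D m a c → Y ∈ badBlock P D m a c) := by
      intro c u v X Y hu hv h hX p hp
      have hp' := Finset.mem_range.1 hp
      have hb : u ≤ blockStart P.len ((P.len + 1) * c + p) := by
        rw [blockStart, Nat.mul_add_div (Nat.succ_pos _), Nat.div_eq_of_lt hp', add_zero]
        exact hu
      have hXY := iterate_extend_congr P hb (X := X) (Y := Y) fun i hi => h i (by
        rw [mem_window] at hi ⊢
        rw [mul_add, mul_one] at hv
        omega)
      rw [← hXY]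
      exact hX p hp
    rw [hset, measure_inter_of_disjoint D
      (disjoint_window (m := m) (a := 0) (e := (P.len + 1) * (N + 1)) (le_refl ((P.len + 1) * N)))
      hmeas (measurableSet_badBlock D a N), pow_succ]
    · exact mul_le_mul' (ih (le_trans (Nat.mul_le_mul_left _ (Nat.le_succ N)) hN)) (hq N hN)
    · intro X Y h
      constructor
      · exact fun hX c hc => hblock c 0 _ X Y (Nat.zero_le _) (Nat.mul_le_mul_left _ hc) h (hX c hc)
      · exact fun hX c hc => hblock c 0 _ Y X (Nat.zero_le _) (Nat.mul_le_mul_left _ hc)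
          (fun i hi => (h i hi).symm) (hX c hc)
    · intro X Y h
      exact ⟨hblock N _ _ X Y le_rfl le_rfl h,
        hblock N _ _ Y X le_rfl le_rfl fun i hi => (h i hi).symm⟩

end Random

/-! ### Selection on a hold-out sample -/

section Selection

variable {d m : ℕ}

theorem sum_window {h : ℕ} (g : ℕ → ℝ) :
    ∑ i ∈ window m h m, g i.1 = ∑ v ∈ Finset.Ico h m, g v := by
  refine Finset.sum_bij (fun i _ => i.1) ?_ ?_ ?_ ?_
  · intro i hi
    rw [mem_window] at hi
    exact Finset.mem_Ico.2 hi
  · intro i _ j _ hij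
    exact Fin.ext hij
  · intro v hv
    have hv' := Finset.mem_Ico.1 hv
    exact ⟨⟨v, hv'.2⟩, mem_window.2 hv', rfl⟩
  · intro i _
    rfl

theorem card_window (h : ℕ) : ((window m h m).card : ℝ) = (m - h : ℕ) := by
  have := sum_window (m := m) (h := h) fun _ => 1
  simpa using this

variable (D : Measure (EuclideanSpace ℝ (Fin d))) [IsProbabilityMeasure D]

theorem measure_le_sum_le {Z : EuclideanSpace ℝ (Fin d) → ℝ} (hZ : Measurable Z) {c : NNReal}
    (hc : HasSubgaussianMGF Z c D) (S : Finset (Fin m)) {ε : ℝ} (hε : 0 ≤ ε) :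
    Measure.pi (fun _ : Fin m => D) {X | ε ≤ ∑ i ∈ S, Z (X i)} ≤
      ENNReal.ofReal (Real.exp (-ε ^ 2 / (2 * (S.card * c)))) := by
  have hind : iIndepFun (fun i (X : Fin m → EuclideanSpace ℝ (Fin d)) => Z (X i))
      (Measure.pi fun _ : Fin m => D) := iIndepFun_pi fun _ => hZ.aemeasurable
  have hsub : ∀ i ∈ S, HasSubgaussianMGF
      (fun X : Fin m → EuclideanSpace ℝ (Fin d) => Z (X i)) c (Measure.pi fun _ : Fin m => D) := by
    intro i _
    refine HasSubgaussianMGF.of_map (Y := fun X : Fin m → EuclideanSpace ℝ (Fin d) => X i)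
      (measurable_pi_apply i).aemeasurable ?_
    rw [map_eval]
    exact hc
  have h := HasSubgaussianMGF.measure_sum_ge_le_of_iIndepFun hind hsub hε
  rw [← ofReal_measureReal]
  refine ENNReal.ofReal_le_ofReal (h.trans (le_of_eq ?_))
  simp

/-- Hoeffding's inequality for each sign, combined by a union bound. -/
theorem hoeffding_sum {l : EuclideanSpace ℝ (Fin d) → ℝ} (hl : Measurable l) {b : ℝ} (hb : 0 < b)
    (hlb : ∀ᵐ x ∂D, l x ∈ Set.Icc 0 b) (S : Finset (Fin m)) {a : ℝ} (ha : 0 ≤ a) :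
    Measure.pi (fun _ : Fin m => D)
      {X | S.card * a ≤ |∑ i ∈ S, (l (X i) - ∫ x, l x ∂D)|} ≤
      ENNReal.ofReal (2 * Real.exp (-(2 * S.card * a ^ 2 / b ^ 2))) := by
  have hsg := hasSubgaussianMGF_of_mem_Icc hl.aemeasurable hlb
  have hm : Measurable fun x => l x - ∫ x, l x ∂D := hl.sub measurable_const
  have hSa : 0 ≤ S.card * a := by positivity
  have h1 := measure_le_sum_le D hm hsg S hSa
  have h2 := measure_le_sum_le D hm.neg hsg.neg S hSa
  have e : -(S.card * a) ^ 2 / (2 * (S.card * ((‖b - 0‖₊ / 2) ^ 2 : NNReal))) =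
      -(2 * S.card * a ^ 2 / b ^ 2) := by
    have : ((‖b - 0‖₊ : NNReal) : ℝ) = b := by simp [abs_of_pos hb]
    push_cast
    rw [sub_zero] at this ⊢
    rw [Real.norm_eq_abs, abs_of_pos hb]
    rcases S.card.eq_zero_or_pos with h0 | h0
    · simp [h0]
    · have : (0 : ℝ) < S.card := by exact_mod_cast h0
      field_simp
  rw [e] at h1 h2
  have hsub : {X : Fin m → EuclideanSpace ℝ (Fin d) |
      S.card * a ≤ |∑ i ∈ S, (l (X i) - ∫ x, l x ∂D)|} ⊆
      {X | S.card * a ≤ ∑ i ∈ S, (l (X i) - ∫ x, l x ∂D)} ∪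
      {X | S.card * a ≤ ∑ i ∈ S, (-fun x => l x - ∫ x, l x ∂D) (X i)} := by
    intro X hX
    rcases le_abs.1 (Set.mem_ofPred.1 hX) with h | h
    · exact Or.inl h
    · refine Or.inr ?_
      simp only [Set.mem_ofPred_eq, Pi.neg_apply, Finset.sum_neg_distrib]
      exact h
  rw [two_mul, ENNReal.ofReal_add (Real.exp_nonneg _) (Real.exp_nonneg _)]
  exact (measure_mono hsub).trans ((measure_union_le _ _).trans (add_le_add h1 h2))

theorem risk_toReal_eq (R : Matrix (Fin d × Fin d) (Fin d × Fin d) ℝ) :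
    (risk D R).toReal = ∫ x, opNorm (residual R x) ∂D := by
  rw [risk, integral_eq_lintegral_of_nonneg_ae (Filter.Eventually.of_forall fun _ => opNorm_nonneg _)]
  exact (measurable_opNorm (measurable_residual measurable_const measurable_id)).aestronglyMeasurable

theorem risk_ne_top (hD : ∀ᵐ x ∂D, ‖x‖ = 1) (R : Matrix (Fin d × Fin d) (Fin d × Fin d) ℝ) :
    risk D R ≠ ⊤ := by
  refine ne_top_of_le_ne_top (b := ENNReal.ofReal (√(frob R R) + 1)) ENNReal.ofReal_ne_top ?_
  calc risk D R ≤ ∫⁻ _, ENNReal.ofReal (√(frob R R) + 1) ∂D :=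
        lintegral_mono_ae (hD.mono fun x hx => ENNReal.ofReal_le_ofReal (opNorm_residual_le hx R))
    _ = _ := by simp

/-- The deviation of the hold-out error of `R` from its mean. -/
noncomputable def deviation (h : ℕ) (R : Matrix (Fin d × Fin d) (Fin d × Fin d) ℝ)
    (X : Fin m → EuclideanSpace ℝ (Fin d)) : ℝ :=
  ∑ i ∈ window m h m, (opNorm (residual R (X i)) - (risk D R).toReal)

variable {P : Params} {b : ℝ}

/-- The iterate depends on examples before h only. It can be frozen, and Hoeffding's inequality then
applies to the held-out examples. -/
theorem measure_deviation_le (hP : P.Valid d b) (hD : ∀ᵐ x ∂D, ‖x‖ = 1) {h p : ℕ} (hh : h ≤ m) (hp : p ≤ h)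
    {a : ℝ} (ha : 0 ≤ a) :
    Measure.pi (fun _ : Fin m => D)
      {X | (m - h : ℕ) * a ≤ |deviation D h (iterate P (extend X) p) X|} ≤
      ENNReal.ofReal (2 * Real.exp (-(2 * (m - h : ℕ) * a ^ 2 / b ^ 2))) := by
  -- On this ball the losses at unit vectors lie in [0, b]; the iterates lie in it almost surely, by
  -- the bound on their step count.
  let G : Set (Matrix (Fin d × Fin d) (Fin d × Fin d) ℝ) := {R | √(frob R R) ≤ b - 1}
  have hG : MeasurableSet G :=
    measurableSet_le (measurable_frob measurable_id measurable_id).sqrt measurable_const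
  let Y : (Fin m → EuclideanSpace ℝ (Fin d)) → Matrix (Fin d × Fin d) (Fin d × Fin d) ℝ :=
    fun X => iterate P (extend X) p
  let Z : (Fin m → EuclideanSpace ℝ (Fin d)) → (window m h m → EuclideanSpace ℝ (Fin d)) :=
    fun X i => X i
  have hY : Measurable Y := measurable_iterate_extend P p
  have hZ : Measurable Z := measurable_pi_lambda _ fun i => measurable_pi_apply _
  have hYZ : IndepFun Y Z (Measure.pi fun _ : Fin m => D) :=
    indepFun_of_disjoint D (disjoint_window (a := 0) (e := m) hp) hY hZ
      (fun X X' hX => iterate_extend_congr P (Nat.zero_le _) hX)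
      (fun X X' hX => funext fun i => hX i.1 i.2)
  let B : Set (Matrix (Fin d × Fin d) (Fin d × Fin d) ℝ ×
      (window m h m → EuclideanSpace ℝ (Fin d))) :=
    {z | (m - h : ℕ) * a ≤ |∑ i, (opNorm (residual z.1 (z.2 i)) - (risk D z.1).toReal)|}
  have hB : MeasurableSet B := by
    refine measurableSet_le measurable_const (Measurable.abs ?_)
    refine Finset.measurable_sum _ fun i _ => Measurable.sub ?_ ?_
    · exact measurable_opNorm (measurable_residual measurable_fst
        ((measurable_pi_apply i).comp measurable_snd))
    · exact ((measurable_risk D).comp measurable_fst).ennreal_toReal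
  have hdev : ∀ R X, deviation D h R X = ∑ i : window m h m,
      (opNorm (residual R (Z X i)) - (risk D R).toReal) := fun R X =>
    (Finset.sum_coe_sort (window m h m)
      fun i => opNorm (residual R (X i)) - (risk D R).toReal).symm
  have hset : {X | (m - h : ℕ) * a ≤ |deviation D h (iterate P (extend X) p) X|} =
      {X | (Y X, Z X) ∈ B} := by
    ext X
    simp only [Set.mem_ofPred_eq, hdev, B]
    rfl
  rw [hset]
  refine measure_pair_le hYZ hY hZ hB hG ((ae_unit D hD).mono fun X hX => ?_) fun R hR => ?_
  · have h1 := sqrt_frob_iterate_le hP p (xs := extend X) fun s hs => by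
      rw [extend_of_lt X (by omega : s < m)]
      exact hX _
    have h2 : ((p - blockStart P.len p : ℕ) : ℝ) ≤ P.len := by
      have := lt_blockStart_add P.len p
      exact_mod_cast (by omega : p - blockStart P.len p ≤ P.len)
    have h3 := mul_le_mul_of_nonneg_left h2 hP.step_pos.le
    have h4 := hP.bound
    change √(frob (iterate P (extend X) p) (iterate P (extend X) p)) ≤ b - 1
    linarith
  · have hset2 : {X | (R, Z X) ∈ B} = {X : Fin m → EuclideanSpace ℝ (Fin d) |
        (window m h m).card * a ≤
          |∑ i ∈ window m h m, (opNorm (residual R (X i)) - ∫ x, opNorm (residual R x) ∂D)|} := by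
      ext X
      rw [card_window, ← risk_toReal_eq]
      change _ ↔ (m - h : ℕ) * a ≤ |deviation D h R X|
      rw [hdev]
      rfl
    rw [hset2, ← card_window]
    refine hoeffding_sum D (measurable_opNorm (measurable_residual measurable_const measurable_id))
      (by linarith [hP.one_le]) (hD.mono fun x hx => ⟨opNorm_nonneg _, ?_⟩) _ ha
    have h1 := opNorm_residual_le hx R
    have h2 : √(frob R R) ≤ b - 1 := hR
    change opNorm (residual R x) ≤ b
    linarith

/-- A union bound over three failures: an example off the sphere (probability zero), N blocks that
are all bad, and a large hold-out deviation of one of the h iterates. -/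
theorem measure_selection_le (hP : P.Valid d b) (hD : ∀ᵐ x ∂D, ‖x‖ = 1) {r e e' a : ℝ}
    (hr : 0 ≤ r) (he0 : 0 ≤ e) (hee : e < e') (ha : 0 ≤ a)
    (he : r / (2 * P.step) + (P.len + 1) * (3 * P.prec * b + P.step / 2) ≤ (P.len + 1) * e)
    {h N : ℕ} (hh : h ≤ m) (hN : (P.len + 1) * N ≤ h) :
    Measure.pi (fun _ : Fin m => D) {X | ¬ ((∀ i, ‖X i‖ = 1) ∧
      (∃ p < h, risk D (iterate P (extend X) p) < optRisk D r + ENNReal.ofReal e') ∧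
      ∀ p < h, |deviation D h (iterate P (extend X) p) X| < (m - h : ℕ) * a)} ≤
    ENNReal.ofReal (((1 + e) / (1 + e')) ^ N +
      h * (2 * Real.exp (-(2 * (m - h : ℕ) * a ^ 2 / b ^ 2)))) := by
  set μ := Measure.pi fun _ : Fin m => D
  set A := optRisk D r + ENNReal.ofReal e'
  have hsub : {X : Fin m → EuclideanSpace ℝ (Fin d) | ¬ ((∀ i, ‖X i‖ = 1) ∧
      (∃ p < h, risk D (iterate P (extend X) p) < A) ∧
      ∀ p < h, |deviation D h (iterate P (extend X) p) X| < (m - h : ℕ) * a)} ⊆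
      ({X | ¬ ∀ i, ‖X i‖ = 1} ∪ {X | ∀ c < N, X ∈ badBlock P D m A c}) ∪
      ⋃ p ∈ Finset.range h, {X | (m - h : ℕ) * a ≤ |deviation D h (iterate P (extend X) p) X|} := by
    intro X hX
    by_contra hc
    simp only [Set.mem_union, Set.mem_ofPred_eq, Set.mem_iUnion, Finset.mem_range, not_or,
      not_exists, not_not, not_le, exists_prop, not_and] at hc
    obtain ⟨⟨h1, h2⟩, h3⟩ := hc
    refine hX ⟨h1, ?_, h3⟩
    push Not at h2
    obtain ⟨c, hcN, hcb⟩ := h2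
    simp only [badBlock, Set.mem_ofPred_eq, not_forall, not_le] at hcb
    obtain ⟨p, hp, hpr⟩ := hcb
    refine ⟨_, ?_, hpr⟩
    have := Finset.mem_range.1 hp
    have h4 : (P.len + 1) * (c + 1) ≤ (P.len + 1) * N := Nat.mul_le_mul_left _ hcN
    rw [mul_add, mul_one] at h4
    omega
  have hq : 0 ≤ (1 + e) / (1 + e') := div_nonneg (by linarith) (by linarith)
  refine (measure_mono hsub).trans ((measure_union_le _ _).trans ?_)
  rw [ENNReal.ofReal_add (pow_nonneg hq _) (by positivity)]
  refine add_le_add ?_ ?_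
  · refine (measure_union_le _ _).trans ?_
    have h0 : μ {X | ¬ ∀ i, ‖X i‖ = 1} = 0 := ae_unit D hD
    rw [h0, zero_add, ENNReal.ofReal_pow hq]
    exact measure_badBlocks_le D (fun c hc => measure_badBlock_le D hP hD hr he0 hee he hc)
      (hN.trans hh)
  · refine (measure_biUnion_finset_le _ _).trans ?_
    refine (Finset.sum_le_card_nsmul _ _ _ fun p hp =>
      measure_deviation_le D hP hD hh (Finset.mem_range.1 hp).le ha).trans (le_of_eq ?_)
    rw [Finset.card_range, nsmul_eq_mul, ENNReal.ofReal_mul (p := (h : ℝ)) (by positivity),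
      ENNReal.ofReal_natCast]

/-- The hold-out error estimate of the iterate `p`. -/
noncomputable def holdoutScore (P : Params) (h m : ℕ) (xs : ℕ → EuclideanSpace ℝ (Fin d)) (p : ℕ) :
    ℝ :=
  ∑ v ∈ Finset.Ico h m, normEst P.prec P.iters (residual (iterate P xs p) (xs v))

/-- Compare the selected iterate with a good one through the scores. Passing between risk and
hold-out mean costs a on each side. Overestimation of norms costs 3 · prec · b only for the good
iterate, as the scores never underestimate. -/
theorem risk_le_of_selected (hP : P.Valid d b) (hD : ∀ᵐ x ∂D, ‖x‖ = 1) {e' a : ℝ} {A : ENNReal}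
    (he' : 0 ≤ e') (ha : 0 ≤ a) {h p₀ : ℕ} (hh : h < m) {X : Fin m → EuclideanSpace ℝ (Fin d)}
    (h1 : ∀ i, ‖X i‖ = 1)
    (h2 : ∃ p < h, risk D (iterate P (extend X) p) < A + ENNReal.ofReal e')
    (h3 : ∀ p < h, |deviation D h (iterate P (extend X) p) X| < (m - h : ℕ) * a)
    (hp₀ : p₀ < h)
    (hmin : ∀ p < h, holdoutScore P h m (extend X) p₀ ≤ holdoutScore P h m (extend X) p) :
    risk D (iterate P (extend X) p₀) ≤
      A + ENNReal.ofReal (e' + (2 * a + 3 * P.prec * b)) := by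
  obtain ⟨p, hp, hpr⟩ := h2
  set V : ℝ := ((m - h : ℕ) : ℝ) with hV
  have hV0 : 0 < V := by
    rw [hV]
    exact_mod_cast Nat.sub_pos_of_lt hh
  have hunit : ∀ v, v < m → ‖extend X v‖ = 1 := fun v hv => by
    rw [extend_of_lt X hv]
    exact h1 _
  have hdev : ∀ p, deviation D h (iterate P (extend X) p) X =
      ∑ v ∈ Finset.Ico h m, opNorm (residual (iterate P (extend X) p) (extend X v)) -
        V * (risk D (iterate P (extend X) p)).toReal := by
    intro p
    have e1 : ∀ i ∈ window m h m, opNorm (residual (iterate P (extend X) p) (X i)) -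
        (risk D (iterate P (extend X) p)).toReal =
        (fun v => opNorm (residual (iterate P (extend X) p) (extend X v)) -
        (risk D (iterate P (extend X) p)).toReal) i.1 := by
      intro i _
      simp only [extend_of_lt X i.2]
    rw [deviation, Finset.sum_congr rfl e1, sum_window (h := h) fun v =>
      opNorm (residual (iterate P (extend X) p) (extend X v)) -
        (risk D (iterate P (extend X) p)).toReal, Finset.sum_sub_distrib]
    simp [hV]
  have hlow : ∑ v ∈ Finset.Ico h m, opNorm (residual (iterate P (extend X) p₀) (extend X v)) ≤
      holdoutScore P h m (extend X) p₀ :=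
    Finset.sum_le_sum fun v _ =>
      opNorm_le_normEst hP.prec_nonneg (by simpa using hP.card_le) hP.iters_pos _
  have hup : holdoutScore P h m (extend X) p ≤
      ∑ v ∈ Finset.Ico h m, opNorm (residual (iterate P (extend X) p) (extend X v)) +
        V * (3 * P.prec * b) := by
    have e1 : V * (3 * P.prec * b) = ∑ v ∈ Finset.Ico h m, 3 * P.prec * b := by simp [hV]
    rw [e1, ← Finset.sum_add_distrib]
    refine Finset.sum_le_sum fun v hv => ?_
    have hvm := (Finset.mem_Ico.1 hv).2
    exact normEst_le hP.prec_nonneg hP.prec_le hP.one_le hP.sq_le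
      (opNorm_residual_iterate_le hP p (fun s hs => hunit s (by omega)) (hunit v hvm))
  have d0 := abs_lt.1 (h3 p₀ hp₀)
  have d1 := abs_lt.1 (h3 p hp)
  rw [hdev] at d0 d1
  have hm := hmin p hp
  have key : V * (risk D (iterate P (extend X) p₀)).toReal ≤
      V * ((risk D (iterate P (extend X) p)).toReal + (2 * a + 3 * P.prec * b)) := by
    have : V * ((risk D (iterate P (extend X) p)).toReal + (2 * a + 3 * P.prec * b)) =
      V * (risk D (iterate P (extend X) p)).toReal + 2 * (V * a) + V * (3 * P.prec * b) := by ring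
    rw [this]
    linarith [d0.1, d1.2]
  have key2 := le_of_mul_le_mul_left key hV0
  have hnn : 0 ≤ 2 * a + 3 * P.prec * b := by
    have := mul_nonneg hP.prec_nonneg (by linarith [hP.one_le] : 0 ≤ b)
    linarith
  calc risk D (iterate P (extend X) p₀)
      = ENNReal.ofReal (risk D (iterate P (extend X) p₀)).toReal :=
        (ENNReal.ofReal_toReal (risk_ne_top D hD _)).symm
    _ ≤ ENNReal.ofReal ((risk D (iterate P (extend X) p)).toReal + (2 * a + 3 * P.prec * b)) :=
        ENNReal.ofReal_le_ofReal key2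
    _ = risk D (iterate P (extend X) p) + ENNReal.ofReal (2 * a + 3 * P.prec * b) := by
        rw [ENNReal.ofReal_add ENNReal.toReal_nonneg hnn, ENNReal.ofReal_toReal (risk_ne_top D hD _)]
    _ ≤ A + ENNReal.ofReal e' + ENNReal.ofReal (2 * a + 3 * P.prec * b) := by gcongr
    _ = _ := by rw [add_assoc, ← ENNReal.ofReal_add he' hnn]

end Selection

open RealRAM

/-! ### A program logic for real RAM programs -/

/-- Started in `M`, the program halts within `T` steps in a memory that satisfies `Q`. -/
def Terminates (P : Program) (M : Mem) (T : ℕ) (Q : Mem → Prop) : Prop :=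
  ∃ (M' : Mem) (t : ℕ), Runs P M M' t ∧ t ≤ T ∧ Q M'

/-- The memories agree outside the registers `N` and the arrays `R`. -/
structure AgreeOff (N R : List ℕ) (M M' : Mem) : Prop where
  nat : ∀ i, i ∉ N → M'.nat i = M.nat i
  real : ∀ a, a ∉ R → M'.real a = M.real a

theorem AgreeOff.refl (N R : List ℕ) (M : Mem) : AgreeOff N R M M :=
  ⟨fun _ _ => rfl, fun _ _ => rfl⟩

theorem AgreeOff.trans {N R : List ℕ} {M₁ M₂ M₃ : Mem} (h : AgreeOff N R M₁ M₂)
    (h' : AgreeOff N R M₂ M₃) : AgreeOff N R M₁ M₃ :=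
  ⟨fun i hi => (h'.nat i hi).trans (h.nat i hi), fun a ha => (h'.real a ha).trans (h.real a ha)⟩

theorem AgreeOff.mono {N R N' R' : List ℕ} {M M' : Mem} (h : AgreeOff N R M M')
    (hN : N ⊆ N') (hR : R ⊆ R') : AgreeOff N' R' M M' :=
  ⟨fun i hi => h.nat i fun h' => hi (hN h'), fun a ha => h.real a fun h' => ha (hR h')⟩

@[simp] theorem setNat_nat_self (M : Mem) (i v : ℕ) : (M.setNat i v).nat i = v := by
  simp [Mem.setNat]

@[simp] theorem setNat_nat_of_ne (M : Mem) {i j : ℕ} (v : ℕ) (h : j ≠ i) :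
    (M.setNat i v).nat j = M.nat j := by
  simp [Mem.setNat, h]

@[simp] theorem setNat_real (M : Mem) (i v : ℕ) : (M.setNat i v).real = M.real := rfl

@[simp] theorem setReal_nat (M : Mem) (a : ℕ) (idx : List ℕ) (v : ℝ) :
    (M.setReal a idx v).nat = M.nat := rfl

@[simp] theorem setReal_real_self (M : Mem) (a : ℕ) (idx : List ℕ) (v : ℝ) :
    (M.setReal a idx v).real a idx = v := by
  simp [Mem.setReal]

@[simp] theorem setReal_real_of_ne (M : Mem) {a a' : ℕ} (idx : List ℕ) (v : ℝ) (h : a' ≠ a) :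
    (M.setReal a idx v).real a' = M.real a' := by
  simp [Mem.setReal, h]

theorem setReal_real_of_idx_ne (M : Mem) (a : ℕ) {idx idx' : List ℕ} (v : ℝ) (h : idx' ≠ idx) :
    (M.setReal a idx v).real a idx' = M.real a idx' := by
  simp [Mem.setReal, h]

theorem agreeOff_setNat {N R : List ℕ} (M : Mem) {i : ℕ} (v : ℕ) (h : i ∈ N) :
    AgreeOff N R M (M.setNat i v) :=
  ⟨fun j hj => setNat_nat_of_ne M v fun e => hj (e ▸ h), fun _ _ => rfl⟩

theorem agreeOff_setReal {N R : List ℕ} (M : Mem) {a : ℕ} (idx : List ℕ) (v : ℝ) (h : a ∈ R) :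
    AgreeOff N R M (M.setReal a idx v) :=
  ⟨fun _ _ => rfl, fun b hb => setReal_real_of_ne M idx v fun e => hb (e ▸ h)⟩

theorem Terminates.mono {P : Program} {M : Mem} {T T' : ℕ} {Q Q' : Mem → Prop}
    (h : Terminates P M T Q) (hT : T ≤ T') (hQ : ∀ M', Q M' → Q' M') : Terminates P M T' Q' := by
  obtain ⟨M', t, h1, h2, h3⟩ := h
  exact ⟨M', t, h1, h2.trans hT, hQ M' h3⟩

theorem terminates_setNat {i : ℕ} {e : NExp} {M : Mem} {T : ℕ} {Q : Mem → Prop}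
    (hT : e.cost + 1 ≤ T) (h : Q (M.setNat i (e.eval M))) : Terminates (.setNat i e) M T Q :=
  ⟨_, _, Runs.setNat i e M, hT, h⟩

theorem terminates_setReal {a : ℕ} {idx : List NExp} {e : RExp} {M : Mem} {T : ℕ}
    {Q : Mem → Prop} (hT : e.cost + addrCost idx + 1 ≤ T)
    (h : Q (M.setReal a (idx.map (NExp.eval M)) (e.eval M))) :
    Terminates (.setReal a idx e) M T Q :=
  ⟨_, _, Runs.setReal a idx e M, hT, h⟩

theorem terminates_seq {P P' : Program} {M : Mem} {s t T : ℕ} {Q : Mem → Prop}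
    (h : Terminates P M s fun M' => Terminates P' M' t Q) (hT : s + t ≤ T) :
    Terminates (.seq P P') M T Q := by
  obtain ⟨M₁, t₁, r₁, h₁, M₂, t₂, r₂, h₂, hQ⟩ := h
  exact ⟨M₂, t₁ + t₂, Runs.seq r₁ r₂, by omega, hQ⟩

theorem terminates_branch {b : Test} {P P' : Program} {M : Mem} {s T : ℕ} {Q : Mem → Prop}
    (h : b.holds M → Terminates P M s Q) (h' : ¬ b.holds M → Terminates P' M s Q)
    (hT : b.cost + s + 1 ≤ T) : Terminates (.branch b P P') M T Q := by
  by_cases hb : b.holds M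
  · obtain ⟨M₁, t₁, r₁, h₁, hQ⟩ := h hb
    exact ⟨M₁, _, Runs.branchTrue hb r₁, by omega, hQ⟩
  · obtain ⟨M₁, t₁, r₁, h₁, hQ⟩ := h' hb
    exact ⟨M₁, _, Runs.branchFalse hb r₁, by omega, hQ⟩

/-- The loop `for i in lo..hi`. -/
def forLoop (i : ℕ) (lo hi : NExp) (body : Program) : Program :=
  .seq (.setNat i lo)
    (.loop (.natLT (.reg i) hi) (.seq body (.setNat i (.add (.reg i) (.const 1)))))

/-- The invariant `I n` is stated after the counter has received the value n. Besides body and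
bound, an iteration costs 7: two for the rest of the test, one for the loop, four for the increment.
-/
theorem terminates_forLoop {I : ℕ → Mem → Prop} {i : ℕ} {lo hi : NExp} {body : Program} {M : Mem}
    {a b c T : ℕ} {Q : Mem → Prop} (hab : a ≤ b) (hlo : lo.eval M = a) (h0 : I a (M.setNat i a))
    (hi_nat : ∀ n M, I n M → M.nat i = n) (hhi : ∀ n M, I n M → hi.eval M = b)
    (hstep : ∀ n M, a ≤ n → n < b → I n M →
      Terminates body M c fun M' => M'.nat i = n ∧ I (n + 1) (M'.setNat i (n + 1)))
    (hend : ∀ M, I b M → Q M)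
    (hT : lo.cost + (b - a) * (c + hi.cost + 7) + hi.cost + 4 ≤ T) :
    Terminates (forLoop i lo hi body) M T Q := by
  have hcost : (Test.natLT (.reg i) hi).cost = hi.cost + 2 := by
    simp only [Test.cost, NExp.cost]
    omega
  have hloop : ∀ k n M, n + k = b → a ≤ n → I n M →
      Terminates (.loop (.natLT (.reg i) hi) (.seq body (.setNat i (.add (.reg i) (.const 1))))) M
        (k * (c + hi.cost + 7) + hi.cost + 3) (I b) := by
    intro k
    induction k with
    | zero =>
      intro n M hn _ hI
      have : n = b := by omega
      subst this
      refine ⟨M, _, Runs.loopStop ?_, ?_, hI⟩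
      · simp only [Test.holds, NExp.eval, hi_nat n M hI, hhi n M hI, lt_irrefl, not_false_iff]
      · rw [hcost]
        omega
    | succ k ih =>
      intro n M hn han hI
      obtain ⟨M₁, t₁, r₁, h₁, hn₁, hI₁⟩ := hstep n M han (by omega) hI
      obtain ⟨M₂, t₂, r₂, h₂, hI₂⟩ := ih (n + 1) _ (by omega) (by omega) hI₁
      have rs : Runs (.setNat i (.add (.reg i) (.const 1))) M₁ (M₁.setNat i (n + 1)) 4 := by
        have := Runs.setNat i (.add (.reg i) (.const 1)) M₁
        simpa only [NExp.eval, hn₁, NExp.cost] using this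
      refine ⟨M₂, _, Runs.loopStep ?_ (Runs.seq r₁ rs) r₂, ?_, hI₂⟩
      · simp only [Test.holds, NExp.eval, hi_nat n M hI, hhi n M hI]
        omega
      · rw [hcost, Nat.succ_mul]
        omega
  obtain ⟨M₂, t₂, r₂, h₂, hI₂⟩ := hloop (b - a) a (M.setNat i a) (by omega) le_rfl h0
  refine ⟨M₂, _, Runs.seq (Runs.setNat i lo M) (hlo.symm ▸ r₂), ?_, hend _ hI₂⟩
  omega

/-- The loop that increments `i`, starting from zero, as long as `b` holds. -/
def counter (i : ℕ) (b : Test) : Program :=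
  .seq (.setNat i (.const 0)) (.loop b (.setNat i (.add (.reg i) (.const 1))))

/-- The search for the least n violating the test. It replaces floors and ceilings, which the
machine lacks, at a cost linear in the result. -/
theorem terminates_counter {i : ℕ} {b : Test} {M : Mem} {p : ℕ → Prop} {K T : ℕ}
    {Q : Mem → Prop} (hb : ∀ n, b.holds (M.setNat i n) ↔ p n) (hK : ¬ p K) (hlt : ∀ j < K, p j)
    (hQ : Q (M.setNat i K)) (hT : (K + 1) * (b.cost + 5) ≤ T) : Terminates (counter i b) M T Q := by
  have hset : ∀ u v, (M.setNat i u).setNat i v = M.setNat i v := fun u v => by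
    simp [Mem.setNat]
  have hloop : ∀ k n, n + k = K → Runs (.loop b (.setNat i (.add (.reg i) (.const 1))))
      (M.setNat i n) (M.setNat i K) (k * (b.cost + 5) + b.cost + 1) := by
    intro k
    induction k with
    | zero =>
      intro n hn
      obtain rfl : n = K := hn
      have := Runs.loopStop (b := b) (P := .setNat i (.add (.reg i) (.const 1)))
        (M := M.setNat i n) ((hb n).not.2 hK)
      simpa using this
    | succ k ih =>
      intro n hn
      have rs : Runs (.setNat i (.add (.reg i) (.const 1))) (M.setNat i n)
          (M.setNat i (n + 1)) 4 := by
        have := Runs.setNat i (.add (.reg i) (.const 1)) (M.setNat i n)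
        simpa only [NExp.eval, setNat_nat_self, NExp.cost, hset] using this
      have := Runs.loopStep ((hb n).2 (hlt n (by omega))) rs (ih (n + 1) (by omega))
      convert this using 1
      ring
  refine ⟨_, _, Runs.seq (Runs.setNat i (.const 0) M) (hloop K 0 (by omega)), ?_, hQ⟩
  simp only [NExp.cost]
  rw [Nat.succ_mul] at hT
  omega

/-- For all `i` and `j` in the given ranges (kept in the registers `9` and `10`), the sum over `l`
(in the register `11`) of `e` is accumulated in the array `16`, and then `e'` is stored in the
array `c` at the address `idx`. -/
def fill (c : ℕ) (idx : List NExp) (l₁ h₁ l₂ h₂ l h : NExp) (e e' : RExp) : Program :=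
  forLoop 9 l₁ h₁ (forLoop 10 l₂ h₂
    (.seq (.setReal 16 [] (.const 0))
      (.seq (forLoop 11 l h (.setReal 16 [] (.add (.cell 16 []) e))) (.setReal c idx e'))))

def fillCost (idx : List NExp) (l₁ h₁ l₂ h₂ l h : NExp) (e e' : RExp) : ℕ :=
  l.cost + 2 * h.cost + e.cost + e'.cost + addrCost idx + l₂.cost + 2 * h₂.cost +
    l₁.cost + 2 * h₁.cost + 41

/-- `H` asks that all expressions have the expected values in any memory that differs from M only in
the scratch cells and in the target array; so the sources must not be the target. Injectivity of the
addresses keeps finished entries intact. Three nested loops of length at most Z account for Z³. -/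
theorem terminates_fill {M : Mem} {c : ℕ} {idx : List NExp} {l₁ h₁ l₂ h₂ l h : NExp}
    {e e' : RExp} {a₁ b₁ a₂ b₂ a b : ℕ} {addr : ℕ → ℕ → List ℕ} {f : ℕ → ℕ → ℕ → ℝ}
    {g : ℕ → ℕ → ℝ → ℝ} {Z : ℕ} (hc : c ≠ 16)
    (H : ∀ M', AgreeOff [9, 10, 11] [c, 16] M M' →
      (l₁.eval M' = a₁ ∧ h₁.eval M' = b₁ ∧ l₂.eval M' = a₂ ∧ h₂.eval M' = b₂ ∧ l.eval M' = a ∧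
      h.eval M' = b) ∧ idx.map (NExp.eval M') = addr (M'.nat 9) (M'.nat 10) ∧
      e.eval M' = f (M'.nat 9) (M'.nat 10) (M'.nat 11) ∧
      e'.eval M' = g (M'.nat 9) (M'.nat 10) (M'.real 16 []))
    (hinj : ∀ i j i' j', addr i j = addr i' j' → i = i' ∧ j = j')
    (hab₁ : a₁ ≤ b₁) (hab₂ : a₂ ≤ b₂) (hab : a ≤ b)
    (hZ₁ : b₁ ≤ Z) (hZ₂ : b₂ ≤ Z) (hZ₃ : b ≤ Z) (hZ : 1 ≤ Z) :
    Terminates (fill c idx l₁ h₁ l₂ h₂ l h e e') M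
      (fillCost idx l₁ h₁ l₂ h₂ l h e e' * Z ^ 3) fun M' =>
      AgreeOff [9, 10, 11] [c, 16] M M' ∧
      (∀ i j, a₁ ≤ i → i < b₁ → a₂ ≤ j → j < b₂ →
        M'.real c (addr i j) = g i j (∑ t ∈ Finset.Ico a b, f i j t)) ∧
      ∀ ad, (∀ i j, ad ≠ addr i j) → M'.real c ad = M.real c ad := by
  -- the invariant of the two outer loops: the rows before `i`, and the entries `j < n` of row `i`
  let I : ℕ → ℕ → Mem → Prop := fun i n M' =>
    AgreeOff [9, 10, 11] [c, 16] M M' ∧ M'.nat 9 = i ∧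
    (∀ i' j, a₁ ≤ i' → i' < b₁ → a₂ ≤ j → j < b₂ → (i' < i ∨ i' = i ∧ j < n) →
      M'.real c (addr i' j) = g i' j (∑ t ∈ Finset.Ico a b, f i' j t)) ∧
    ∀ ad, (∀ i j, ad ≠ addr i j) → M'.real c ad = M.real c ad
  have hinner : ∀ i n M', I i n M' → M'.nat 10 = n →
      Terminates (.seq (.setReal 16 [] (.const 0))
        (.seq (forLoop 11 l h (.setReal 16 [] (.add (.cell 16 []) e))) (.setReal c idx e'))) M'
      (Z * (l.cost + 2 * h.cost + e.cost + e'.cost + addrCost idx + 19))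
      fun M'' => M''.nat 10 = n ∧ I i (n + 1) M'' := by
    intro i n M' hI h10
    refine terminates_seq (s := 3) (t := Z * (l.cost + 2 * h.cost + e.cost + e'.cost +
      addrCost idx + 16)) (terminates_setReal (by simp [RExp.cost, addrCost]) ?_) (by nlinarith)
    refine terminates_seq (s := Z * (l.cost + 2 * h.cost + e.cost + 15))
      (t := e'.cost + addrCost idx + 1) ?_ (by nlinarith)
    set M₁ := M'.setReal 16 (List.map (NExp.eval M') []) ((RExp.const 0).eval M') with hM₁
    have hA₁ : AgreeOff [9, 10, 11] [c, 16] M M₁ :=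
      hI.1.trans (agreeOff_setReal _ _ _ (by simp))
    have hnat₁ : M₁.nat = M'.nat := rfl
    have h16 : M₁.real 16 [] = 0 := by simp [hM₁, RExp.eval]
    have hc₁ : M₁.real c = M'.real c := setReal_real_of_ne _ _ _ hc
    refine terminates_forLoop (a := a) (b := b) (c := e.cost + 4) (I := fun k N =>
      AgreeOff [11] [16] M₁ N ∧ N.nat 11 = k ∧ N.real 16 [] = ∑ t ∈ Finset.Ico a k, f i n t)
      hab (H _ hA₁).1.2.2.2.2.1 ⟨agreeOff_setNat _ _ (by simp), by simp, by simp [h16]⟩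
      (fun k N hN => hN.2.1) (fun k N hN => (H _ (hA₁.trans (hN.1.mono (by simp) (by simp)))).1.2.2.2.2.2)
      ?_ ?_ ?_
    · rintro k N hak hkb ⟨hN, hk, hs⟩
      refine terminates_setReal (by simp [RExp.cost, addrCost]; omega) ⟨hk, ?_⟩
      have hHN := H _ (hA₁.trans (hN.mono (by simp) (by simp)))
      have n9 : N.nat 9 = i := by rw [hN.nat 9 (by simp), hnat₁]; exact hI.2.1
      have n10 : N.nat 10 = n := by rw [hN.nat 10 (by simp), hnat₁]; exact h10
      refine ⟨(hN.trans (agreeOff_setReal _ _ _ (by simp))).trans (agreeOff_setNat _ _ (by simp)),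
        by simp, ?_⟩
      rw [setNat_real]
      simp only [List.map_nil, setReal_real_self, RExp.eval]
      rw [hs, hHN.2.2.1, n9, n10, hk, Finset.sum_Ico_succ_top hak]
    · rintro N ⟨hN, hk, hs⟩
      refine terminates_setReal le_rfl ?_
      have hA₂ := hA₁.trans (hN.mono (by simp) (by simp) : AgreeOff [9, 10, 11] [c, 16] M₁ N)
      have hHN := H _ hA₂
      have n9 : N.nat 9 = i := by rw [hN.nat 9 (by simp), hnat₁]; exact hI.2.1
      have n10 : N.nat 10 = n := by rw [hN.nat 10 (by simp), hnat₁]; exact h10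
      have hcN : N.real c = M'.real c := by rw [hN.real c (by simpa using hc), hc₁]
      rw [hHN.2.1, hHN.2.2.2, n9, n10, hs]
      refine ⟨n10, hA₂.trans (agreeOff_setReal _ _ _ (by simp)), n9, ?_, ?_⟩
      · intro i' j h1 h2 h3 h4 h5
        by_cases he : addr i' j = addr i n
        · obtain ⟨rfl, rfl⟩ := hinj _ _ _ _ he
          rw [setReal_real_self]
        · rw [setReal_real_of_idx_ne _ _ _ he, hcN]
          refine hI.2.2.1 i' j h1 h2 h3 h4 (h5.imp_right fun h6 => ⟨h6.1, ?_⟩)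
          refine lt_of_le_of_ne (Nat.lt_succ_iff.1 h6.2) fun h7 => he ?_
          rw [h6.1, h7]
      · intro ad had
        rw [setReal_real_of_idx_ne _ _ _ (had i n), hcN]
        exact hI.2.2.2 ad had
    · have : (b - a) * (e.cost + 4 + h.cost + 7) ≤ Z * (e.cost + 4 + h.cost + 7) :=
        Nat.mul_le_mul_right _ (by omega)
      nlinarith [Nat.mul_le_mul_right (l.cost + h.cost + 4) hZ]
  have hmiddle : ∀ i M', I i a₂ M' →
      Terminates (forLoop 10 l₂ h₂ (.seq (.setReal 16 [] (.const 0))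
        (.seq (forLoop 11 l h (.setReal 16 [] (.add (.cell 16 []) e))) (.setReal c idx e')))) M'
      (Z ^ 2 * (l.cost + 2 * h.cost + e.cost + e'.cost + addrCost idx + l₂.cost + 2 * h₂.cost + 30))
      fun M'' => M''.nat 9 = i ∧ I (i + 1) a₂ (M''.setNat 9 (i + 1)) := by
    intro i M' hI
    refine terminates_forLoop (a := a₂) (b := b₂)
      (c := Z * (l.cost + 2 * h.cost + e.cost + e'.cost + addrCost idx + 19))
      (I := fun n N => N.nat 10 = n ∧ I i n N) hab₂ (H _ hI.1).1.2.2.1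
      ⟨by simp, hI.1.trans (agreeOff_setNat _ _ (by simp)), by simpa using hI.2.1, hI.2.2⟩
      (fun n N hN => hN.1) (fun n N hN => (H _ hN.2.1).1.2.2.2.1) ?_ ?_ ?_
    · rintro n N - - ⟨hn, hN⟩
      refine (hinner i n N hN hn).mono le_rfl fun N' hN' => ⟨hN'.1, by simp, ?_⟩
      obtain ⟨h1, h2, h3, h4⟩ := hN'
      exact ⟨h2.trans (agreeOff_setNat _ _ (by simp)), by simpa using h3, h4⟩
    · rintro N ⟨hn, hN⟩
      refine ⟨hN.2.1, hN.1.trans (agreeOff_setNat _ _ (by simp)), by simp, ?_, hN.2.2.2⟩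
      intro i' j h1 h2 h3 h4 h5
      refine hN.2.2.1 i' j h1 h2 h3 h4 ?_
      omega
    · set A := l.cost + 2 * h.cost + e.cost + e'.cost + addrCost idx
      have h1 : (b₂ - a₂) * (Z * (A + 19) + h₂.cost + 7) ≤ Z * (Z * (A + 19) + h₂.cost + 7) :=
        Nat.mul_le_mul_right _ (by omega)
      have h2 : Z ≤ Z ^ 2 := by nlinarith
      have h3 : Z * (Z * (A + 19) + h₂.cost + 7) = Z ^ 2 * (A + 19) + Z * (h₂.cost + 7) := by ring
      have h4 := Nat.mul_le_mul_right (h₂.cost + 7) h2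
      have h5 := Nat.mul_le_mul_right (l₂.cost + h₂.cost + 4) (hZ.trans h2)
      nlinarith
  refine terminates_forLoop (a := a₁) (b := b₁) (c := Z ^ 2 * (l.cost + 2 * h.cost + e.cost +
      e'.cost + addrCost idx + l₂.cost + 2 * h₂.cost + 30))
    (I := fun n N => I n a₂ N) hab₁ (H _ (AgreeOff.refl _ _ M)).1.1
    ⟨agreeOff_setNat _ _ (by simp), by simp, ?_, fun _ _ => rfl⟩
    (fun n N hN => hN.2.1) (fun n N hN => (H _ hN.1).1.2.1)
    (fun n N _ _ hN => hmiddle n N hN) ?_ ?_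
  · intro i' j h1 h2 h3 h4 h5
    omega
  · intro N hN
    exact ⟨hN.1, fun i j h1 h2 h3 h4 => hN.2.2.1 i j h1 h2 h3 h4 (Or.inl h2), hN.2.2.2⟩
  · rw [fillCost]
    set A := l.cost + 2 * h.cost + e.cost + e'.cost + addrCost idx + l₂.cost + 2 * h₂.cost
    have h1 : (b₁ - a₁) * (Z ^ 2 * (A + 30) + h₁.cost + 7) ≤
        Z * (Z ^ 2 * (A + 30) + h₁.cost + 7) := Nat.mul_le_mul_right _ (by omega)
    have h2 : Z ≤ Z ^ 3 := Nat.le_self_pow (by norm_num) Z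
    have h3 : Z * (Z ^ 2 * (A + 30) + h₁.cost + 7) = Z ^ 3 * (A + 30) + Z * (h₁.cost + 7) := by ring
    have h4 := Nat.mul_le_mul_right (h₁.cost + 7) h2
    have h5 := Nat.mul_le_mul_right (l₁.cost + h₁.cost + 4) (hZ.trans h2)
    nlinarith

/-! ### The program: error matrices and approximate subgradients -/

/-- Computes the error matrix (array `9`) of the current iterate at the example in register `8`. -/
def residProg : Program :=
  -- The array 19 receives the inner products of the current example with the examples of the block
  -- so far; the second pass evaluates the formula of `residual_iterate_apply`.
  .seq (fill 19 [.reg 9, .reg 10] (.reg 7) (.reg 6) (.const 0) (.const 1) (.const 0) (.reg 0)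
      (.mul (.cell 4 [.reg 9, .reg 11]) (.cell 4 [.reg 8, .reg 11])) (.cell 16 []))
    (fill 9 [.reg 9, .reg 10] (.const 0) (.reg 0) (.const 0) (.reg 0) (.reg 7) (.reg 6)
      (.mul (.mul (.cell 19 [.reg 11, .const 0]) (.cell 19 [.reg 11, .const 0]))
        (.cell 15 [.reg 11, .reg 9, .reg 10]))
      (.sub (.sub (.const 0) (.mul (.cell 4 [.reg 8, .reg 9]) (.cell 4 [.reg 8, .reg 10])))
        -- The array 5 holds the target accuracy β, and the step length is β / 4.
        (.mul (.div (.cell 5 []) (.const 4)) (.cell 16 []))))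

/-- Stores the product of the arrays `9` and `10` in the array `11`. -/
def applyProg : Program :=
  fill 11 [.reg 9, .reg 10] (.const 0) (.reg 0) (.const 0) (.reg 0) (.const 0) (.reg 0)
    (.mul (.cell 9 [.reg 9, .reg 11]) (.cell 10 [.reg 11, .reg 10])) (.cell 16 [])

/-- Stores the product of the transpose of the array `9` and the array `11` in the array `10`. -/
def applyTransposeProg : Program :=
  fill 10 [.reg 9, .reg 10] (.const 0) (.reg 0) (.const 0) (.reg 0) (.const 0) (.reg 0)
    (.mul (.cell 9 [.reg 11, .reg 9]) (.cell 11 [.reg 11, .reg 10])) (.cell 16 [])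

/-- Stores the identity matrix in the array `10`. -/
def identityProg : Program :=
  fill 10 [.reg 9, .reg 10] (.const 0) (.reg 0) (.const 0) (.reg 0) (.const 0) (.const 0)
    -- Division by zero returns zero, so 1 - (i - j)/(i - j) is 1 on the diagonal and 0 off it.
    (.const 0) (.sub (.const 1) (.div (.sub (.cast (.reg 9)) (.cast (.reg 10)))
      (.sub (.cast (.reg 9)) (.cast (.reg 10)))))

/-- The power method. -/
def powerProg : Program :=
  .seq identityProg
    -- The final multiplication leaves Q = (EᵀE)^q in the array 10 and EQ in the array 11, as needed
    -- for the Rayleigh quotient and for EQQᵀ.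
    (.seq (forLoop 12 (.const 0) (.reg 5) (.seq applyProg applyTransposeProg)) applyProg)

/-- Stores the squared Frobenius norm of the array `a` in the cell `[0, 0]` of the array `c`. -/
def frobProg (a c : ℕ) : Program :=
  .seq (fill 20 [.reg 9, .reg 10] (.const 0) (.reg 0) (.const 0) (.const 1) (.const 0) (.reg 0)
      (.mul (.cell a [.reg 9, .reg 11]) (.cell a [.reg 9, .reg 11])) (.cell 16 []))
    (fill c [.reg 9, .reg 10] (.const 0) (.const 1) (.const 0) (.const 1) (.const 0) (.reg 0)
      (.cell 20 [.reg 11, .const 0]) (.cell 16 []))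

/-- Computes the norm estimate (array `14`) by Newton's method. -/
def newtonProg : Program :=
  .seq (.setReal 21 [] (.div (.cell 13 [.const 0, .const 0]) (.cell 12 [.const 0, .const 0])))
    (.seq (.setReal 14 [] (.add (.const 1) (.cell 21 [])))
      (.seq (forLoop 12 (.const 0) (.reg 5) (.setReal 14 []
          (.div (.add (.cell 14 []) (.div (.cell 21 []) (.cell 14 []))) (.const 2))))
        (.setReal 14 [] (.mul (.add (.const 1) (.cell 8 [])) (.cell 14 [])))))

/-- Stores the approximate subgradient as the matrix number `p` (register `6`) of the array `15`. -/
def weightProg : Program :=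
  fill 15 [.reg 6, .reg 9, .reg 10] (.const 0) (.reg 0) (.const 0) (.reg 0) (.const 0) (.reg 0)
    (.mul (.cell 11 [.reg 9, .reg 11]) (.cell 10 [.reg 10, .reg 11]))
    (.div (.cell 16 []) (.mul (.cell 14 []) (.cell 12 [.const 0, .const 0])))

/-- Norm estimate and approximate subgradient for the current iterate at the example in
register `8`. -/
def evalProg : Program :=
  .seq residProg (.seq powerProg (.seq (frobProg 10 12) (.seq (frobProg 11 13)
    (.seq newtonProg weightProg))))

/-- The array `a` holds the matrix `A`. -/
def HasMat {d : ℕ} (M : Mem) (a : ℕ) (A : Matrix (Fin d) (Fin d) ℝ) : Prop :=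
  ∀ i j : Fin d, M.real a [i, j] = A i j

theorem HasMat.of_agree {d : ℕ} {N R : List ℕ} {M M' : Mem} {a : ℕ} {A : Matrix (Fin d) (Fin d) ℝ}
    (h : HasMat M a A) (hA : AgreeOff N R M M') (ha : a ∉ R) : HasMat M' a A := fun i j => by
  rw [hA.real a ha]
  exact h i j

/-- The part of the memory that the main loop does not change. -/
structure Env (P : Params) {d : ℕ} (m h : ℕ) (xs : ℕ → EuclideanSpace ℝ (Fin d)) (M : Mem) :
    Prop where
  dim : M.nat 0 = d
  size : M.nat 2 = m
  len : M.nat 3 = P.len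
  half : M.nat 4 = h
  iters : M.nat 5 = P.iters
  sample : ∀ (i : ℕ) (j : Fin d), M.real 4 [i, j] = xs i j
  step : M.real 5 [] / 4 = P.step
  prec : M.real 8 [] = P.prec

theorem Env.of_agree {P : Params} {d m h : ℕ} {xs : ℕ → EuclideanSpace ℝ (Fin d)} {M M' : Mem}
    {N R : List ℕ} (hE : Env P m h xs M) (hA : AgreeOff N R M M')
    (hN : ∀ i ∈ [0, 2, 3, 4, 5], i ∉ N) (hR : ∀ a ∈ [4, 5, 8], a ∉ R) : Env P m h xs M' where
  dim := by rw [hA.nat 0 (hN _ (by simp))]; exact hE.dim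
  size := by rw [hA.nat 2 (hN _ (by simp))]; exact hE.size
  len := by rw [hA.nat 3 (hN _ (by simp))]; exact hE.len
  half := by rw [hA.nat 4 (hN _ (by simp))]; exact hE.half
  iters := by rw [hA.nat 5 (hN _ (by simp))]; exact hE.iters
  sample := by rw [hA.real 4 (hR _ (by simp))]; exact hE.sample
  step := by rw [hA.real 5 (hR _ (by simp))]; exact hE.step
  prec := by rw [hA.real 8 (hR _ (by simp))]; exact hE.prec

theorem pair_inj : ∀ i j i' j' : ℕ, [i, j] = [i', j'] → i = i' ∧ j = j' := by
  intro i j i' j' h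
  simpa using h

/-! ### Correctness and cost of the numerical subroutines. -/

section Eval

variable {d : ℕ} {Z : ℕ} {M : Mem}

theorem sum_Ico_fin (f : ℕ → ℝ) : ∑ l ∈ Finset.Ico 0 d, f l = ∑ l : Fin d, f l := by
  rw [Nat.Ico_zero_eq_range, Finset.sum_range]

theorem terminates_residProg {P : Params} {m h : ℕ} {xs : ℕ → EuclideanSpace ℝ (Fin d)} {p v : ℕ}
    (hE : Env P m h xs M) (h6 : M.nat 6 = p) (h7 : M.nat 7 = blockStart P.len p)
    (h8 : M.nat 8 = v)
    (hW : ∀ s, blockStart P.len p ≤ s → s < p → ∀ i j : Fin d,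
      M.real 15 [s, i, j] = weight P xs s i j) (hdZ : d ≤ Z) (hpZ : p ≤ Z) (hZ : 1 ≤ Z) :
    Terminates residProg M (400 * Z ^ 3) fun M' => AgreeOff [9, 10, 11] [9, 16, 19] M M' ∧
      HasMat M' 9 (residual (iterate P xs p) (xs v)) := by
  set a := blockStart P.len p
  refine terminates_seq (s := 200 * Z ^ 3) (t := 200 * Z ^ 3) ?_ (by omega)
  refine (terminates_fill (a₁ := a) (b₁ := p) (a₂ := 0) (b₂ := 1) (a := 0) (b := d) (Z := Z)
    (addr := fun i j => [i, j]) (f := fun i _ l => M.real 4 [i, l] * M.real 4 [v, l])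
    (g := fun _ _ z => z) (by norm_num) (fun M' hA => ?_) pair_inj (blockStart_le _ _) (by omega)
    (by omega) hpZ hZ hdZ hZ).mono (Nat.mul_le_mul_right _ (by decide)) ?_
  · simp [NExp.eval, RExp.eval, hA.nat 0, hA.nat 6, hA.nat 7, hA.nat 8, hA.real 4, hE.dim, h6,
      h7, h8, a]
  rintro M₁ ⟨hA₁, hG, -⟩
  refine (terminates_fill (a₁ := 0) (b₁ := d) (a₂ := 0) (b₂ := d) (a := a) (b := p) (Z := Z)
    (addr := fun i j => [i, j])
    (f := fun i j l => M₁.real 19 [l, 0] * M₁.real 19 [l, 0] * M.real 15 [l, i, j])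
    (g := fun i j z => 0 - M.real 4 [v, i] * M.real 4 [v, j] - M.real 5 [] / 4 * z)
    (by norm_num) (fun M' hA => ?_) pair_inj (by omega) (by omega) (blockStart_le _ _)
    hdZ hdZ hpZ hZ).mono (Nat.mul_le_mul_right _ (by decide)) ?_
  · simp [NExp.eval, RExp.eval, hA.nat 0, hA.nat 6, hA.nat 7, hA.nat 8, hA.real 4, hA.real 5,
      hA.real 15, hA.real 19, hA₁.nat 0, hA₁.nat 6, hA₁.nat 7, hA₁.nat 8, hA₁.real 4, hA₁.real 5,
      hA₁.real 15, hE.dim, h6, h7, h8, a]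
  rintro M₂ ⟨hA₂, hR, -⟩
  refine ⟨(hA₁.mono (by simp) (by simp)).trans (hA₂.mono (by simp) (by simp)), fun i j => ?_⟩
  rw [hR i j (Nat.zero_le _) i.2 (Nat.zero_le _) j.2, residual_iterate_apply, hE.sample, hE.sample,
    hE.step, zero_sub]
  congr 2
  refine Finset.sum_congr rfl fun s hs => ?_
  have hs' := Finset.mem_Ico.1 hs
  rw [hG s 0 hs'.1 hs'.2 le_rfl one_pos, hW s hs'.1 hs'.2, sum_Ico_fin, sq]
  simp only [hE.sample]

variable {E Q : Matrix (Fin d) (Fin d) ℝ}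

theorem terminates_applyProg (h0 : M.nat 0 = d) (hE : HasMat M 9 E) (hQ : HasMat M 10 Q)
    (hdZ : d ≤ Z) (hZ : 1 ≤ Z) :
    Terminates applyProg M (200 * Z ^ 3) fun M' => AgreeOff [9, 10, 11] [11, 16] M M' ∧
      HasMat M' 11 (E * Q) := by
  refine (terminates_fill (a₁ := 0) (b₁ := d) (a₂ := 0) (b₂ := d) (a := 0) (b := d) (Z := Z)
    (addr := fun i j => [i, j]) (f := fun i j l => M.real 9 [i, l] * M.real 10 [l, j])
    (g := fun _ _ z => z) (by norm_num) (fun M' hA => ?_) pair_inj (by omega) (by omega)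
    (by omega) hdZ hdZ hdZ hZ).mono (Nat.mul_le_mul_right _ (by decide)) ?_
  · simp [NExp.eval, RExp.eval, hA.nat 0, hA.real 9, hA.real 10, h0]
  rintro M₁ ⟨hA₁, hG, -⟩
  refine ⟨hA₁, fun i j => ?_⟩
  rw [hG i j (Nat.zero_le _) i.2 (Nat.zero_le _) j.2, sum_Ico_fin, Matrix.mul_apply]
  exact Finset.sum_congr rfl fun l _ => by rw [hE, hQ]

theorem terminates_applyTransposeProg (h0 : M.nat 0 = d) (hE : HasMat M 9 E)
    (hQ : HasMat M 11 Q) (hdZ : d ≤ Z) (hZ : 1 ≤ Z) :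
    Terminates applyTransposeProg M (200 * Z ^ 3) fun M' => AgreeOff [9, 10, 11] [10, 16] M M' ∧
      HasMat M' 10 (Eᵀ * Q) := by
  refine (terminates_fill (a₁ := 0) (b₁ := d) (a₂ := 0) (b₂ := d) (a := 0) (b := d) (Z := Z)
    (addr := fun i j => [i, j]) (f := fun i j l => M.real 9 [l, i] * M.real 11 [l, j])
    (g := fun _ _ z => z) (by norm_num) (fun M' hA => ?_) pair_inj (by omega) (by omega)
    (by omega) hdZ hdZ hdZ hZ).mono (Nat.mul_le_mul_right _ (by decide)) ?_
  · simp [NExp.eval, RExp.eval, hA.nat 0, hA.real 9, hA.real 11, h0]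
  rintro M₁ ⟨hA₁, hG, -⟩
  refine ⟨hA₁, fun i j => ?_⟩
  rw [hG i j (Nat.zero_le _) i.2 (Nat.zero_le _) j.2, sum_Ico_fin, Matrix.mul_apply]
  exact Finset.sum_congr rfl fun l _ => by rw [hE, hQ, Matrix.transpose_apply]

theorem terminates_identityProg (h0 : M.nat 0 = d) (hdZ : d ≤ Z) (hZ : 1 ≤ Z) :
    Terminates identityProg M (200 * Z ^ 3) fun M' => AgreeOff [9, 10, 11] [10, 16] M M' ∧
      HasMat M' 10 (1 : Matrix (Fin d) (Fin d) ℝ) := by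
  refine (terminates_fill (a₁ := 0) (b₁ := d) (a₂ := 0) (b₂ := d) (a := 0) (b := 0) (Z := Z)
    (addr := fun i j => [i, j]) (f := fun i j l => 0)
    (g := fun i j _ => 1 - ((i : ℝ) - j) / ((i : ℝ) - j)) (by norm_num) (fun M' hA => ?_)
    pair_inj (by omega) (by omega)
    (by omega) hdZ hdZ (by omega) hZ).mono (Nat.mul_le_mul_right _ (by decide)) ?_
  · simp [NExp.eval, RExp.eval, hA.nat 0, h0]
  rintro M₁ ⟨hA₁, hG, -⟩
  refine ⟨hA₁, fun i j => ?_⟩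
  rw [hG i j (Nat.zero_le _) i.2 (Nat.zero_le _) j.2, Matrix.one_apply]
  by_cases h : i = j
  · simp [h]
  · have h1 : ((i : ℕ) : ℝ) - (j : ℕ) ≠ 0 := by
      rw [sub_ne_zero]
      exact_mod_cast fun e => h (Fin.ext e)
    rw [div_self h1, if_neg h, sub_self]

theorem terminates_powerProg {q : ℕ} (h0 : M.nat 0 = d) (h5 : M.nat 5 = q) (hE : HasMat M 9 E)
    (hdZ : d ≤ Z) (hqZ : q ≤ Z) (hZ : 1 ≤ Z) :
    Terminates powerProg M (1000 * Z ^ 4) fun M' =>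
      AgreeOff [9, 10, 11, 12] [10, 11, 16] M M' ∧ HasMat M' 10 (powIter E (1 : Matrix _ _ ℝ) q) ∧
        HasMat M' 11 (E * powIter E (1 : Matrix _ _ ℝ) q) := by
  have hZ3 : 1 ≤ Z ^ 3 := Nat.one_le_pow _ _ hZ
  have hZ34 : Z ^ 3 ≤ Z ^ 4 := Nat.pow_le_pow_right hZ (by norm_num)
  refine terminates_seq (s := 200 * Z ^ 3) (t := 700 * Z ^ 4) ?_ (by omega)
  refine (terminates_identityProg h0 hdZ hZ).mono le_rfl ?_
  rintro M₁ ⟨hA₁, hQ₁⟩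
  refine terminates_seq (s := 420 * Z ^ 4) (t := 200 * Z ^ 3) ?_ (by omega)
  refine terminates_forLoop (a := 0) (b := q) (c := 400 * Z ^ 3) (I := fun n N =>
    AgreeOff [9, 10, 11, 12] [10, 11, 16] M N ∧ N.nat 12 = n ∧
      HasMat N 10 (powIter E (1 : Matrix _ _ ℝ) n)) (by omega) rfl ?_ (fun n N hN => hN.2.1)
    (fun n N hN => by simp [NExp.eval, hN.1.nat 5, h5]) ?_ ?_ ?_
  · exact ⟨(hA₁.mono (by simp) (by simp)).trans (agreeOff_setNat _ _ (by simp)), by simp, hQ₁⟩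
  · rintro n N - - ⟨hA, hn, hQ⟩
    have hN0 : N.nat 0 = d := by rw [hA.nat 0 (by simp), h0]
    refine terminates_seq (s := 200 * Z ^ 3) (t := 200 * Z ^ 3) ?_ (by omega)
    refine (terminates_applyProg hN0 (hE.of_agree hA (by simp)) hQ hdZ hZ).mono le_rfl ?_
    rintro N₁ ⟨hB₁, hY⟩
    have hA' := hA.trans (hB₁.mono (by simp) (by simp))
    refine (terminates_applyTransposeProg (by rw [hA'.nat 0 (by simp), h0])
      (hE.of_agree hA' (by simp)) hY hdZ hZ).mono le_rfl ?_
    rintro N₂ ⟨hB₂, hQ₂⟩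
    refine ⟨by rw [hB₂.nat 12 (by simp), hB₁.nat 12 (by simp), hn],
      (hA'.trans (hB₂.mono (by simp) (by simp))).trans (agreeOff_setNat _ _ (by simp)), by simp, ?_⟩
    rw [powIter_succ]
    exact hQ₂
  · rintro N ⟨hA, hn, hQ⟩
    refine (terminates_applyProg (by rw [hA.nat 0 (by simp), h0]) (hE.of_agree hA (by simp)) hQ
      hdZ hZ).mono le_rfl ?_
    rintro N₁ ⟨hB₁, hY⟩
    exact ⟨hA.trans (hB₁.mono (by simp) (by simp)), hQ.of_agree hB₁ (by simp), hY⟩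
  · simp only [NExp.cost]
    have h1 : (q - 0) * (400 * Z ^ 3 + 1 + 7) ≤ Z * (400 * Z ^ 3 + 1 + 7) :=
      Nat.mul_le_mul_right _ (by omega)
    have h2 : Z * (400 * Z ^ 3 + 1 + 7) = 400 * Z ^ 4 + 8 * Z := by ring
    have h3 : Z ≤ Z ^ 4 := Nat.le_self_pow (by norm_num) Z
    omega

theorem terminates_frobProg {a c : ℕ} (h0 : M.nat 0 = d) (hE : HasMat M a E)
    (ha : a ≠ 16 ∧ a ≠ 20) (hc : c ≠ 16 ∧ c ≠ 20) (hdZ : d ≤ Z) (hZ : 1 ≤ Z) :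
    Terminates (frobProg a c) M (400 * Z ^ 3) fun M' =>
      AgreeOff [9, 10, 11] [c, 16, 20] M M' ∧ M'.real c [0, 0] = frob E E := by
  refine terminates_seq (s := 200 * Z ^ 3) (t := 200 * Z ^ 3) ?_ (by omega)
  refine (terminates_fill (a₁ := 0) (b₁ := d) (a₂ := 0) (b₂ := 1) (a := 0) (b := d) (Z := Z)
    (addr := fun i j => [i, j]) (f := fun i _ l => M.real a [i, l] * M.real a [i, l])
    (g := fun _ _ z => z) (by norm_num) (fun M' hA => ?_) pair_inj (by omega) (by omega)
    (by omega) hdZ hZ hdZ hZ).mono (Nat.mul_le_mul_right _ ?_) ?_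
  · simp [NExp.eval, RExp.eval, hA.nat 0, hA.real a, ha, h0]
  · simp [fillCost, NExp.cost, RExp.cost, addrCost]
  rintro M₁ ⟨hA₁, hG, -⟩
  refine (terminates_fill (a₁ := 0) (b₁ := 1) (a₂ := 0) (b₂ := 1) (a := 0) (b := d) (Z := Z)
    (addr := fun i j => [i, j]) (f := fun _ _ l => M₁.real 20 [l, 0])
    (g := fun _ _ z => z) hc.1 (fun M' hA => ?_) pair_inj (by omega) (by omega)
    (by omega) hZ hZ hdZ hZ).mono (Nat.mul_le_mul_right _ ?_) ?_
  · simp [NExp.eval, RExp.eval, hA.nat 0, hA.real 20, hc.2.symm, hA₁.nat 0, h0]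
  · simp [fillCost, NExp.cost, RExp.cost, addrCost]
  rintro M₂ ⟨hA₂, hR, -⟩
  refine ⟨(hA₁.mono (by simp) (by simp)).trans (hA₂.mono (by simp) (by simp)), ?_⟩
  rw [hR 0 0 le_rfl one_pos le_rfl one_pos, sum_Ico_fin, frob]
  refine Finset.sum_congr rfl fun i _ => ?_
  rw [hG i 0 (Nat.zero_le _) i.2 le_rfl one_pos, sum_Ico_fin]
  exact Finset.sum_congr rfl fun j _ => by rw [hE]

theorem terminates_newtonProg {q : ℕ} {t u ξ : ℝ} (h5 : M.nat 5 = q) (h12 : M.real 12 [0, 0] = t)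
    (h13 : M.real 13 [0, 0] = u) (h8 : M.real 8 [] = ξ) (hqZ : q ≤ Z) (hZ : 1 ≤ Z) :
    Terminates newtonProg M (100 * Z) fun M' =>
      AgreeOff [12] [14, 21] M M' ∧ M'.real 14 [] = (1 + ξ) * newtonSqrt q (u / t) := by
  refine terminates_seq (s := 10) (t := 90 * Z)
    (terminates_setReal (by simp [RExp.cost, addrCost, NExp.cost]) ?_) (by omega)
  set M₁ := M.setReal 21 (List.map (NExp.eval M) [])
    ((RExp.div (.cell 13 [.const 0, .const 0]) (.cell 12 [.const 0, .const 0])).eval M) with hM₁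
  have hA₁ : AgreeOff [12] [14, 21] M M₁ := agreeOff_setReal _ _ _ (by simp)
  have h21 : M₁.real 21 [] = u / t := by simp [hM₁, RExp.eval, NExp.eval, h12, h13]
  refine terminates_seq (s := 10) (t := 80 * Z)
    (terminates_setReal (by simp [RExp.cost, addrCost]) ?_) (by omega)
  set M₂ := M₁.setReal 14 (List.map (NExp.eval M₁) [])
    ((RExp.add (.const 1) (.cell 21 [])).eval M₁) with hM₂
  have hA₂ : AgreeOff [12] [14, 21] M M₂ := hA₁.trans (agreeOff_setReal _ _ _ (by simp))
  have h21' : M₂.real 21 [] = u / t := by simp [hM₂, h21]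
  have h14 : M₂.real 14 [] = newtonSqrt 0 (u / t) := by
    simp [hM₂, RExp.eval, h21, newtonSqrt]
  refine terminates_seq (s := 40 * Z) (t := 10) ?_ (by omega)
  refine terminates_forLoop (a := 0) (b := q) (c := 12) (I := fun n N =>
    AgreeOff [12] [14, 21] M N ∧ N.nat 12 = n ∧ N.real 21 [] = u / t ∧
      N.real 14 [] = newtonSqrt n (u / t)) (by omega) rfl
    ⟨hA₂.trans (agreeOff_setNat _ _ (by simp)), by simp, h21', h14⟩ (fun n N hN => hN.2.1)
    (fun n N hN => by simp [NExp.eval, hN.1.nat 5, h5]) ?_ ?_ ?_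
  · rintro n N - - ⟨hA, hn, h21, h14⟩
    refine terminates_setReal (by simp [RExp.cost, addrCost]) ⟨hn,
      (hA.trans (agreeOff_setReal _ _ _ (by simp))).trans (agreeOff_setNat _ _ (by simp)),
      by simp, by simp [h21], ?_⟩
    have : newtonSqrt (n + 1) (u / t) =
        (newtonSqrt n (u / t) + u / t / newtonSqrt n (u / t)) / 2 :=
      Function.iterate_succ_apply' _ _ _
    rw [this]
    simp [RExp.eval, h14, h21]
  · rintro N ⟨hA, hn, h21, h14⟩
    refine terminates_setReal (by simp [RExp.cost, addrCost])
      ⟨hA.trans (agreeOff_setReal _ _ _ (by simp)), ?_⟩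
    simp [RExp.eval, h14, hA.real 8, h8]
  · simp only [NExp.cost]
    have h1 : (q - 0) * (12 + 1 + 7) ≤ Z * (12 + 1 + 7) := Nat.mul_le_mul_right _ (by omega)
    omega

theorem terminates_weightProg {p : ℕ} {t l : ℝ} {Y : Matrix (Fin d) (Fin d) ℝ} (h0 : M.nat 0 = d)
    (h6 : M.nat 6 = p) (hY : HasMat M 11 Y) (hQ : HasMat M 10 Q) (h14 : M.real 14 [] = l)
    (h12 : M.real 12 [0, 0] = t) (hdZ : d ≤ Z) (hZ : 1 ≤ Z) :
    Terminates weightProg M (200 * Z ^ 3) fun M' =>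
      AgreeOff [9, 10, 11] [15, 16] M M' ∧
      (∀ i j : Fin d, M'.real 15 [p, i, j] = ((l * t)⁻¹ • (Y * Qᵀ)) i j) ∧
      ∀ s i j, s ≠ p → M'.real 15 [s, i, j] = M.real 15 [s, i, j] := by
  refine (terminates_fill (a₁ := 0) (b₁ := d) (a₂ := 0) (b₂ := d) (a := 0) (b := d) (Z := Z)
    (addr := fun i j => [p, i, j]) (f := fun i j l => M.real 11 [i, l] * M.real 10 [j, l])
    (g := fun _ _ z => z / (l * t)) (by norm_num) (fun M' hA => ?_)
    (fun i j i' j' h => by simpa using h) (by omega) (by omega)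
    (by omega) hdZ hdZ hdZ hZ).mono (Nat.mul_le_mul_right _ (by decide)) ?_
  · simp [NExp.eval, RExp.eval, hA.nat 0, hA.nat 6, hA.real 10, hA.real 11, hA.real 12,
      hA.real 14, h0, h6, h12, h14]
  rintro M₁ ⟨hA₁, hG, hS⟩
  refine ⟨hA₁, fun i j => ?_, fun s i j hs => hS _ fun i' j' h => hs ?_⟩
  · rw [hG i j (Nat.zero_le _) i.2 (Nat.zero_le _) j.2, sum_Ico_fin, Matrix.smul_apply,
      Matrix.mul_apply, smul_eq_mul, inv_mul_eq_div]
    congr 1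
    exact Finset.sum_congr rfl fun l _ => by rw [hY, hQ, Matrix.transpose_apply]
  · simp only [List.cons.injEq] at h
    exact h.1

theorem terminates_evalProg {P : Params} {m h : ℕ} {xs : ℕ → EuclideanSpace ℝ (Fin d)} {p v : ℕ}
    (hE : Env P m h xs M) (h6 : M.nat 6 = p) (h7 : M.nat 7 = blockStart P.len p)
    (h8 : M.nat 8 = v)
    (hW : ∀ s, blockStart P.len p ≤ s → s < p → ∀ i j : Fin d,
      M.real 15 [s, i, j] = weight P xs s i j) (hdZ : d ≤ Z) (hpZ : p ≤ Z) (hqZ : P.iters ≤ Z)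
    (hZ : 1 ≤ Z) :
    Terminates evalProg M (3000 * Z ^ 4) fun M' =>
      AgreeOff [9, 10, 11, 12] [9, 10, 11, 12, 13, 14, 15, 16, 19, 20, 21] M M' ∧
      M'.real 14 [] = normEst P.prec P.iters (residual (iterate P xs p) (xs v)) ∧
      (∀ i j : Fin d, M'.real 15 [p, i, j] =
        dualMat P.prec P.iters (residual (iterate P xs p) (xs v)) i j) ∧
      ∀ s i j, s ≠ p → M'.real 15 [s, i, j] = M.real 15 [s, i, j] := by
  have hZ34 : Z ^ 3 ≤ Z ^ 4 := Nat.pow_le_pow_right hZ (by norm_num)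
  have hZ14 : Z ≤ Z ^ 4 := Nat.le_self_pow (by norm_num) Z
  set E := residual (iterate P xs p) (xs v)
  refine terminates_seq (s := 400 * Z ^ 3) (t := 2600 * Z ^ 4)
    ((terminates_residProg hE h6 h7 h8 hW hdZ hpZ hZ).mono le_rfl ?_) (by omega)
  rintro M₁ ⟨hA₁, hE₁⟩
  have a₁ : AgreeOff [9, 10, 11, 12] [9, 10, 11, 12, 13, 14, 15, 16, 19, 20, 21] M M₁ :=
    hA₁.mono (by simp) (by simp)
  have hz : ∀ {N R : List ℕ} {M' : Mem}, AgreeOff N R M M' → 0 ∉ N → M'.nat 0 = d :=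
    fun hA hN => (hA.nat 0 hN).trans hE.dim
  refine terminates_seq (s := 1000 * Z ^ 4) (t := 1600 * Z ^ 4)
    ((terminates_powerProg (hz a₁ (by simp)) ((a₁.nat 5 (by simp)).trans hE.iters) hE₁ hdZ hqZ
      hZ).mono le_rfl ?_) (by omega)
  rintro M₂ ⟨hA₂, hQ₂, hY₂⟩
  have a₂ := a₁.trans (hA₂.mono (by simp) (by simp))
  refine terminates_seq (s := 400 * Z ^ 3) (t := 1200 * Z ^ 4)
    ((terminates_frobProg (hz a₂ (by simp)) hQ₂ (by norm_num) (by norm_num) hdZ hZ).mono le_rfl ?_)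
    (by omega)
  rintro M₃ ⟨hA₃, ht₃⟩
  have a₃ := a₂.trans (hA₃.mono (by simp) (by simp))
  have hQ₃ := hQ₂.of_agree hA₃ (by simp)
  have hY₃ := hY₂.of_agree hA₃ (by simp)
  refine terminates_seq (s := 400 * Z ^ 3) (t := 800 * Z ^ 4)
    ((terminates_frobProg (hz a₃ (by simp)) hY₃ (by norm_num) (by norm_num) hdZ hZ).mono le_rfl ?_)
    (by omega)
  rintro M₄ ⟨hA₄, hu₄⟩
  have a₄ := a₃.trans (hA₄.mono (by simp) (by simp))
  have ht₄ := (congrFun (hA₄.real 12 (by simp)) [0, 0]).trans ht₃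
  refine terminates_seq (s := 100 * Z) (t := 200 * Z ^ 3)
    ((terminates_newtonProg ((a₄.nat 5 (by simp)).trans hE.iters) ht₄ hu₄
      ((congrFun (a₄.real 8 (by simp)) []).trans hE.prec) hqZ hZ).mono le_rfl ?_) (by omega)
  rintro M₅ ⟨hA₅, hl₅⟩
  have a₅ := a₄.trans (hA₅.mono (by simp) (by simp))
  have hQ₅ := (hQ₃.of_agree hA₄ (by simp)).of_agree hA₅ (by simp)
  have hY₅ := (hY₃.of_agree hA₄ (by simp)).of_agree hA₅ (by simp)
  have ht₅ := (congrFun (hA₅.real 12 (by simp)) [0, 0]).trans ht₄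
  have hl : M₅.real 14 [] = normEst P.prec P.iters E := by
    rw [hl₅, normEst, rayleigh, powNorm_two_mul, powNorm_two_mul_add_one]
  refine (terminates_weightProg (hz a₅ (by simp)) ((a₅.nat 6 (by simp)).trans h6) hY₅ hQ₅ hl ht₅
    hdZ hZ).mono le_rfl ?_
  rintro M₆ ⟨hA₆, hW₆, hS₆⟩
  refine ⟨a₅.trans (hA₆.mono (by simp) (by simp)), by rw [hA₆.real 14 (by simp), hl], ?_, ?_⟩
  · intro i j
    rw [hW₆, dualMat, powNorm_two_mul]
  · intro s i j hs
    rw [hS₆ s i j hs, hA₅.real 15 (by simp), hA₄.real 15 (by simp), hA₃.real 15 (by simp),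
      hA₂.real 15 (by simp), hA₁.real 15 (by simp)]

end Eval

/-! ### The program: selection and output -/

/-- Scores the current iterate on the hold-out examples, and keeps it if it is the best so far. -/
def selectProg : Program :=
  .seq (.setReal 18 [] (.const 0))
    (.seq (forLoop 8 (.reg 4) (.reg 2)
        (.seq evalProg (.setReal 18 [] (.add (.cell 18 []) (.cell 14 [])))))
      -- The reciprocal 1 / (1 + score) turns minimization into maximization, so that the initial
      -- zero in the array 17 loses against the first iterate.
      (.seq (.setReal 18 [] (.div (.const 1) (.add (.const 1) (.cell 18 []))))
        (.branch (.realLT (.cell 17 []) (.cell 18 []))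
          (.seq (.setReal 17 [] (.cell 18 [])) (.seq (.setNat 13 (.reg 7)) (.setNat 14 (.reg 6))))
          -- The register 17 is used for nothing else: this is an empty branch.
          (.setNat 17 (.const 0)))))

/-- One step of the descent: scores the current iterate, computes the next one, and restarts at the
end of a block. -/
def stepProg : Program :=
  -- Scoring leaves in the entry p of the array 15 a subgradient for a hold-out example. Evaluating
  -- once more at the example p overwrites it with the weight of the descent step.
  .seq selectProg (.seq (.setNat 8 (.reg 6)) (.seq evalProg
    (.branch (.natLT (.add (.reg 7) (.reg 3)) (.add (.reg 6) (.const 1)))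
      (.setNat 7 (.add (.reg 6) (.const 1))) (.setNat 17 (.const 0)))))

/-- Writes the encoder and the decoder of the selected iterate. -/
def outputProg : Program :=
  .seq (counter 15 (.natLT (.add (.reg 13) (.reg 15)) (.reg 14)))
    (.seq (forLoop 12 (.const 0) (.reg 15)
      (.seq
        (fill 0 [.reg 12, .reg 9, .reg 10] (.const 0) (.reg 0) (.const 0) (.reg 0) (.const 0)
          (.const 0) (.const 0) (.mul (.cell 4 [.add (.reg 13) (.reg 12), .reg 9])
            (.cell 4 [.add (.reg 13) (.reg 12), .reg 10])))
        (fill 1 [.reg 9, .reg 10, .reg 12] (.const 0) (.reg 0) (.const 0) (.reg 0) (.const 0)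
          (.const 0) (.const 0) (.mul (.sub (.const 0) (.div (.cell 5 []) (.const 4)))
            (.cell 15 [.add (.reg 13) (.reg 12), .reg 9, .reg 10])))))
      (.setNat 0 (.reg 15)))

/-! ### Correctness and cost of the main loop and of the output. -/

section Main

variable {d : ℕ} {Z : ℕ} {M : Mem} {P : Params} {m h : ℕ} {xs : ℕ → EuclideanSpace ℝ (Fin d)}

theorem terminates_selectProg {p : ℕ} (hE : Env P m h xs M) (h6 : M.nat 6 = p)
    (h7 : M.nat 7 = blockStart P.len p)
    (hW : ∀ s, s < p → ∀ i j : Fin d, M.real 15 [s, i, j] = weight P xs s i j) (hdZ : d ≤ Z)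
    (hmZ : m ≤ Z) (hhm : h ≤ m) (hpZ : p ≤ Z) (hqZ : P.iters ≤ Z) (hZ : 1 ≤ Z) :
    Terminates selectProg M (4000 * Z ^ 5) fun M' =>
      AgreeOff [8, 9, 10, 11, 12, 13, 14, 17]
        [9, 10, 11, 12, 13, 14, 15, 16, 17, 18, 19, 20, 21] M M' ∧
      (∀ s, s < p → ∀ i j : Fin d, M'.real 15 [s, i, j] = weight P xs s i j) ∧
      if M.real 17 [] < 1 / (1 + holdoutScore P h m xs p) then
        M'.real 17 [] = 1 / (1 + holdoutScore P h m xs p) ∧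
          M'.nat 13 = blockStart P.len p ∧ M'.nat 14 = p
      else M'.real 17 [] = M.real 17 [] ∧ M'.nat 13 = M.nat 13 ∧ M'.nat 14 = M.nat 14 := by
  have hZ5 : 1 ≤ Z ^ 5 := Nat.one_le_pow _ _ hZ
  refine terminates_seq (s := 3) (t := 3900 * Z ^ 5)
    (terminates_setReal (by simp [RExp.cost, addrCost]) ?_) (by omega)
  set M₁ := M.setReal 18 (List.map (NExp.eval M) []) ((RExp.const 0).eval M) with hM₁
  have hA₁ : AgreeOff [8, 9, 10, 11, 12] [9, 10, 11, 12, 13, 14, 15, 16, 18, 19, 20, 21] M M₁ :=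
    agreeOff_setReal _ _ _ (by simp)
  refine terminates_seq (s := 3100 * Z ^ 5) (t := 100) ?_ (by omega)
  refine terminates_forLoop (a := h) (b := m) (c := 3000 * Z ^ 4 + 10) (I := fun v N =>
    AgreeOff [8, 9, 10, 11, 12] [9, 10, 11, 12, 13, 14, 15, 16, 18, 19, 20, 21] M N ∧
    N.nat 8 = v ∧ (∀ s, s < p → ∀ i j : Fin d, N.real 15 [s, i, j] = weight P xs s i j) ∧
    N.real 18 [] = ∑ v ∈ Finset.Ico h v,
      normEst P.prec P.iters (residual (iterate P xs p) (xs v))) hhm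
    (by simp [NExp.eval, hM₁, hE.half])
    ⟨hA₁.trans (agreeOff_setNat _ _ (by simp)), by simp, ?_, ?_⟩ (fun v N hN => hN.2.1)
    (fun v N hN => by simp [NExp.eval, hN.1.nat 2, hE.size]) ?_ ?_ ?_
  · simpa [hM₁] using hW
  · simp [hM₁, RExp.eval]
  · rintro v N hv - ⟨hA, h8, hWN, hS⟩
    refine terminates_seq (s := 3000 * Z ^ 4) (t := 10) ?_ (by omega)
    refine (terminates_evalProg (p := p) (v := v) (hE.of_agree hA (by decide) (by decide))
      (by rw [hA.nat 6 (by simp), h6]) (by rw [hA.nat 7 (by simp), h7]) h8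
      (fun s _ hs => hWN s hs) hdZ hpZ hqZ hZ).mono le_rfl ?_
    rintro N₁ ⟨hB, hl, -, hS₁⟩
    have hAB := hA.trans (hB.mono (by simp) (by simp))
    refine terminates_setReal (by simp [RExp.cost, addrCost])
      ⟨by simp [hB.nat 8, h8],
        (hAB.trans (agreeOff_setReal _ _ _ (by simp))).trans (agreeOff_setNat _ _ (by simp)),
        by simp, ?_, ?_⟩
    · intro s hs i j
      rw [setNat_real, setReal_real_of_ne _ _ _ (by norm_num), hS₁ s _ _ hs.ne]
      exact hWN s hs i j
    · rw [Finset.sum_Ico_succ_top hv, ← hS, ← hl]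
      simp [RExp.eval, hB.real 18]
  · rintro N ⟨hA, -, hWN, hS⟩
    refine terminates_seq (s := 20) (t := 50)
      (terminates_setReal (by simp [RExp.cost, addrCost]) ?_) (by omega)
    set N₁ := N.setReal 18 (List.map (NExp.eval N) [])
      ((RExp.div (.const 1) (.add (.const 1) (.cell 18 []))).eval N) with hN₁
    have hA₂ := hA.trans (agreeOff_setReal N (List.map (NExp.eval N) [])
      ((RExp.div (.const 1) (.add (.const 1) (.cell 18 []))).eval N)
      (by simp : 18 ∈ [9, 10, 11, 12, 13, 14, 15, 16, 18, 19, 20, 21]))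
    rw [← hN₁] at hA₂
    have h18 : N₁.real 18 [] = 1 / (1 + holdoutScore P h m xs p) := by
      simp [hN₁, RExp.eval, hS, holdoutScore]
    have h15 : N₁.real 15 = N.real 15 := setReal_real_of_ne _ _ _ (by norm_num)
    have h17 : N₁.real 17 [] = M.real 17 [] := by rw [hA₂.real 17 (by simp)]
    have hA₃ : AgreeOff [8, 9, 10, 11, 12, 13, 14, 17]
        [9, 10, 11, 12, 13, 14, 15, 16, 17, 18, 19, 20, 21] M N₁ := hA₂.mono (by simp) (by simp)
    refine terminates_branch (s := 20) (fun hb => ?_) (fun hb => ?_)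
      (by simp [Test.cost, RExp.cost, addrCost])
    · simp only [Test.holds, RExp.eval, List.map_nil, h17, h18] at hb
      simp only [if_pos hb]
      refine terminates_seq (s := 5) (t := 10)
        (terminates_setReal (by simp [RExp.cost, addrCost]) ?_) (by omega)
      refine terminates_seq (s := 5) (t := 5)
        (terminates_setNat (by simp [NExp.cost]) ?_) (by omega)
      refine terminates_setNat (by simp [NExp.cost]) ⟨?_, ?_, ?_, ?_, ?_⟩
      · exact ((hA₃.trans (agreeOff_setReal _ _ _ (by simp))).trans
          (agreeOff_setNat _ _ (by simp))).trans (agreeOff_setNat _ _ (by simp))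
      · intro s hs i j
        simp only [setNat_real]
        rw [setReal_real_of_ne _ _ _ (by norm_num), h15]
        exact hWN s hs i j
      · simp [RExp.eval, h18]
      · simp [NExp.eval, hA₃.nat 7, h7]
      · simp [NExp.eval, hA₃.nat 6, h6]
    · simp only [Test.holds, RExp.eval, List.map_nil, h17, h18] at hb
      simp only [if_neg hb]
      refine terminates_setNat (by simp [NExp.cost]) ⟨hA₃.trans (agreeOff_setNat _ _ (by simp)),
        ?_, ?_, ?_, ?_⟩
      · intro s hs i j
        rw [setNat_real, h15]
        exact hWN s hs i j
      · rw [setNat_real, h17]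
      · simp [hA₂.nat 13]
      · simp [hA₂.nat 14]
  · simp only [NExp.cost]
    have h1 : (m - h) * (3000 * Z ^ 4 + 10 + 1 + 7) ≤ Z * (3000 * Z ^ 4 + 10 + 1 + 7) :=
      Nat.mul_le_mul_right _ (by omega)
    have h2 : Z * (3000 * Z ^ 4 + 10 + 1 + 7) = 3000 * Z ^ 5 + 18 * Z := by ring
    have h3 : Z ≤ Z ^ 5 := Nat.le_self_pow (by norm_num) Z
    omega

/-- The invariant of the main loop. -/
structure MainInv (P : Params) (m h : ℕ) (xs : ℕ → EuclideanSpace ℝ (Fin d)) (p p₀ : ℕ)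
    (M : Mem) : Prop where
  env : Env P m h xs M
  time : M.nat 6 = p
  start : M.nat 7 = blockStart P.len p
  weights : ∀ s, s < p → ∀ i j : Fin d, M.real 15 [s, i, j] = weight P xs s i j
  best : M.nat 14 = p₀
  bestStart : M.nat 13 = blockStart P.len p₀
  score : (p = 0 ∧ p₀ = 0 ∧ M.real 17 [] = 0) ∨
    (p₀ < p ∧ M.real 17 [] = 1 / (1 + holdoutScore P h m xs p₀) ∧
      ∀ p' < p, 1 / (1 + holdoutScore P h m xs p') ≤ M.real 17 [])

theorem holdoutScore_nonneg (hP : 0 ≤ P.prec) (p : ℕ) : 0 ≤ holdoutScore P h m xs p :=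
  Finset.sum_nonneg fun _ _ => (normEst_pos hP _ _).le

theorem terminates_stepProg (hP : 0 ≤ P.prec) {p p₀ : ℕ} (hI : MainInv P m h xs p p₀ M)
    (hdZ : d ≤ Z) (hmZ : m ≤ Z) (hhm : h ≤ m) (hpZ : p ≤ Z) (hqZ : P.iters ≤ Z) (hZ : 1 ≤ Z) :
    Terminates stepProg M (8000 * Z ^ 5) fun M' => M'.nat 6 = p ∧
      ∃ p₁, MainInv P m h xs (p + 1) p₁ (M'.setNat 6 (p + 1)) := by
  have hZ5 : 1 ≤ Z ^ 5 := Nat.one_le_pow _ _ hZ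
  have hZ45 : Z ^ 4 ≤ Z ^ 5 := Nat.pow_le_pow_right hZ (by norm_num)
  have hpos : ∀ p, 0 < 1 / (1 + holdoutScore P h m xs p) := fun p => by
    have := holdoutScore_nonneg (h := h) (m := m) (xs := xs) hP p
    positivity
  refine terminates_seq (s := 4000 * Z ^ 5) (t := 4000 * Z ^ 5)
    ((terminates_selectProg hI.env hI.time hI.start hI.weights hdZ hmZ hhm hpZ hqZ hZ).mono
      le_rfl ?_) (by omega)
  rintro M₁ ⟨hA₁, hW₁, hsel⟩
  have key : ∃ p₁, M₁.nat 14 = p₁ ∧ M₁.nat 13 = blockStart P.len p₁ ∧ p₁ < p + 1 ∧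
      M₁.real 17 [] = 1 / (1 + holdoutScore P h m xs p₁) ∧
      ∀ p' < p + 1, 1 / (1 + holdoutScore P h m xs p') ≤ M₁.real 17 [] := by
    split_ifs at hsel with hc
    · refine ⟨p, hsel.2.2, hsel.2.1, Nat.lt_succ_self p, hsel.1, fun p' hp' => ?_⟩
      rcases Nat.lt_succ_iff_lt_or_eq.1 hp' with hlt | rfl
      · rcases hI.score with ⟨rfl, -, -⟩ | ⟨-, -, h3⟩
        · omega
        · rw [hsel.1]
          exact (h3 p' hlt).trans hc.le
      · exact hsel.1.ge
    · rcases hI.score with ⟨-, -, h0⟩ | ⟨h1, h2, h3⟩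
      -- In the first round the stored zero is below every positive reciprocal, so the iterate
      -- cannot have been rejected.
      · rw [h0] at hc
        exact absurd (hpos p) hc
      · refine ⟨p₀, hsel.2.2.trans hI.best, hsel.2.1.trans hI.bestStart, by omega,
          hsel.1.trans h2, fun p' hp' => ?_⟩
        rw [hsel.1]
        rcases Nat.lt_succ_iff_lt_or_eq.1 hp' with hlt | rfl
        · exact h3 p' hlt
        · exact not_lt.1 hc
  obtain ⟨p₁, k14, k13, klt, k17, kmax⟩ := key
  refine terminates_seq (s := 2) (t := 3900 * Z ^ 5)
    (terminates_setNat (by simp [NExp.cost]) ?_) (by omega)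
  set M₂ := M₁.setNat 8 ((NExp.reg 6).eval M₁) with hM₂
  have h6₁ : M₁.nat 6 = p := by rw [hA₁.nat 6 (by simp), hI.time]
  have hE₂ : Env P m h xs M₂ := (hI.env.of_agree hA₁ (by decide) (by decide)).of_agree
    (agreeOff_setNat (N := [8]) (R := []) _ _ (by simp)) (by decide) (by decide)
  have h6₂ : M₂.nat 6 = p := by simp [hM₂, h6₁]
  have h7₂ : M₂.nat 7 = blockStart P.len p := by simp [hM₂, hA₁.nat 7, hI.start]
  refine terminates_seq (s := 3000 * Z ^ 4) (t := 20)
    ((terminates_evalProg (p := p) (v := p) hE₂ h6₂ h7₂ (by simp [hM₂, NExp.eval, h6₁])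
      (fun s _ hs => hW₁ s hs) hdZ hpZ hqZ hZ).mono le_rfl ?_) (by omega)
  rintro M₃ ⟨hA₃, -, hWp, hWs⟩
  have h6₃ : M₃.nat 6 = p := by rw [hA₃.nat 6 (by simp), h6₂]
  have h7₃ : M₃.nat 7 = blockStart P.len p := by rw [hA₃.nat 7 (by simp), h7₂]
  have hE₃ : Env P m h xs M₃ := hE₂.of_agree hA₃ (by decide) (by decide)
  -- Both outcomes of the restart test end with one register write, to the block start or to the
  -- scratch register; they are treated together.
  have hfin : ∀ i v, (i = 7 ∧ v = blockStart P.len (p + 1)) ∨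
      (i = 17 ∧ blockStart P.len p = blockStart P.len (p + 1)) →
      (M₃.setNat i v).nat 6 = p ∧
        ∃ p₁, MainInv P m h xs (p + 1) p₁ ((M₃.setNat i v).setNat 6 (p + 1)) := by
    intro i v hiv
    have hi : i ∈ [7, 17] := by
      rcases hiv with ⟨rfl, -⟩ | ⟨rfl, -⟩ <;> simp
    have hA₄ : AgreeOff [6, 7, 17] [] M₃ ((M₃.setNat i v).setNat 6 (p + 1)) :=
      (agreeOff_setNat _ _ (List.mem_cons_of_mem _ hi)).trans (agreeOff_setNat _ _ (by simp))
    refine ⟨?_, p₁, hE₃.of_agree hA₄ (by decide) (by decide), by simp, ?_, ?_, ?_, ?_, ?_⟩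
    · rcases hiv with ⟨rfl, -⟩ | ⟨rfl, -⟩ <;> simp [h6₃]
    · rcases hiv with ⟨rfl, rfl⟩ | ⟨rfl, he⟩
      · simp
      · simp [h7₃, he]
    · intro s hs i j
      simp only [setNat_real]
      rcases Nat.lt_succ_iff_lt_or_eq.1 hs with hlt | rfl
      · rw [hWs s i j hlt.ne]
        exact hW₁ s hlt i j
      · exact hWp i j
    · rw [hA₄.nat 14 (by simp), hA₃.nat 14 (by simp)]
      simpa [hM₂] using k14
    · rw [hA₄.nat 13 (by simp), hA₃.nat 13 (by simp)]
      simpa [hM₂] using k13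
    · have : ((M₃.setNat i v).setNat 6 (p + 1)).real 17 = M₁.real 17 := by
        simp only [setNat_real]
        rw [hA₃.real 17 (by simp)]
        rfl
      rw [this]
      exact Or.inr ⟨klt, k17, kmax⟩
  have hcond : (Test.natLT (.add (.reg 7) (.reg 3)) (.add (.reg 6) (.const 1))).holds M₃ ↔
      P.len + 1 ∣ p + 1 := by
    rw [dvd_succ_iff]
    simp [Test.holds, NExp.eval, h6₃, h7₃, hE₃.len]
  refine terminates_branch (s := 5) (fun hb => ?_) (fun hb => ?_) (by simp [Test.cost, NExp.cost])
  · rw [hcond] at hb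
    refine terminates_setNat (by simp [NExp.cost]) (hfin 7 _ (Or.inl ⟨rfl, ?_⟩))
    simp [NExp.eval, h6₃, blockStart_succ_of_dvd hb]
  · rw [hcond] at hb
    exact terminates_setNat (by simp [NExp.cost])
      (hfin 17 _ (Or.inr ⟨rfl, (blockStart_succ_of_not_dvd hb).symm⟩))

theorem terminates_main (hP : 0 ≤ P.prec) (hE : Env P m h xs M) (h7 : M.nat 7 = 0)
    (h13 : M.nat 13 = 0) (h14 : M.nat 14 = 0) (h17 : M.real 17 [] = 0)
    (hdZ : d ≤ Z) (hmZ : m ≤ Z) (hhm : h ≤ m) (hqZ : P.iters ≤ Z) (hZ : 1 ≤ Z) :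
    Terminates (forLoop 6 (.const 0) (.reg 4) stepProg) M (9000 * Z ^ 6) fun M' =>
      ∃ p₀, MainInv P m h xs h p₀ M' := by
  have hb0 : blockStart P.len 0 = 0 := by simp [blockStart]
  refine terminates_forLoop (a := 0) (b := h) (c := 8000 * Z ^ 5)
    (I := fun p N => ∃ p₀, MainInv P m h xs p p₀ N) (by omega) rfl
    ⟨0, hE.of_agree (agreeOff_setNat (N := [6]) (R := []) _ _ (by simp)) (by decide) (by decide),
      by simp, by simp [h7, hb0], fun s hs => absurd hs (Nat.not_lt_zero s), by simp [h14],
      by simp [h13, hb0], Or.inl ⟨rfl, rfl, h17⟩⟩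
    (fun p N ⟨_, hN⟩ => hN.time) (fun p N ⟨_, hN⟩ => by simp [NExp.eval, hN.env.half])
    (fun p N _ hp ⟨_, hN⟩ => terminates_stepProg hP hN hdZ hmZ hhm (by omega) hqZ hZ)
    (fun N hN => hN) ?_
  simp only [NExp.cost]
  have h1 : (h - 0) * (8000 * Z ^ 5 + 1 + 7) ≤ Z * (8000 * Z ^ 5 + 1 + 7) :=
    Nat.mul_le_mul_right _ (by omega)
  have h2 : Z * (8000 * Z ^ 5 + 1 + 7) = 8000 * Z ^ 6 + 8 * Z := by ring
  have h3 : Z ≤ Z ^ 6 := Nat.le_self_pow (by norm_num) Z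
  omega

/-- The memory holds the factorization of the iterate `p₀` into a decoder and an encoder. -/
structure IsOutput (P : Params) (xs : ℕ → EuclideanSpace ℝ (Fin d)) (p₀ : ℕ) (M : Mem) :
    Prop where
  len : M.nat 0 = p₀ - blockStart P.len p₀
  enc : ∀ r, r < p₀ - blockStart P.len p₀ → ∀ i j : Fin d,
    M.real 0 [r, i, j] = xs (blockStart P.len p₀ + r) i * xs (blockStart P.len p₀ + r) j
  dec : ∀ r, r < p₀ - blockStart P.len p₀ → ∀ i j : Fin d,
    M.real 1 [i, j, r] = -P.step * weight P xs (blockStart P.len p₀ + r) i j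

theorem terminates_outputProg {p₀ : ℕ} (hE : Env P m h xs M) (h14 : M.nat 14 = p₀)
    (h13 : M.nat 13 = blockStart P.len p₀)
    (hW : ∀ s, s < p₀ → ∀ i j : Fin d, M.real 15 [s, i, j] = weight P xs s i j)
    (hdZ : d ≤ Z) (hpZ : p₀ ≤ Z) (hZ : 1 ≤ Z) :
    Terminates outputProg M (500 * Z ^ 4) (IsOutput P xs p₀) := by
  set a := blockStart P.len p₀
  have hZ4 : Z ≤ Z ^ 4 := Nat.le_self_pow (by norm_num) Z
  refine terminates_seq (s := 11 * (Z + 1)) (t := 450 * Z ^ 4) ?_ (by omega)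
  refine terminates_counter (p := fun n => a + n < p₀) (K := p₀ - a) ?_ (by omega) (by omega) ?_ ?_
  · intro n
    simp [Test.holds, NExp.eval, h13, h14]
  swap
  · simp only [Test.cost, NExp.cost]
    have : (p₀ - a + 1) * (1 + 1 + 1 + 1 + 1 + 5) ≤ (Z + 1) * (1 + 1 + 1 + 1 + 1 + 5) :=
      Nat.mul_le_mul_right _ (by omega)
    omega
  set M₁ := M.setNat 15 (p₀ - a) with hM₁
  have hA₁ : AgreeOff [9, 10, 11, 12, 15] [0, 1, 16] M M₁ := agreeOff_setNat _ _ (by simp)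
  have h15 : M₁.nat 15 = p₀ - a := by simp [hM₁]
  refine terminates_seq (s := 440 * Z ^ 4) (t := 5) ?_ (by omega)
  refine terminates_forLoop (a := 0) (b := p₀ - a) (c := 400 * Z ^ 3) (I := fun n N =>
    AgreeOff [9, 10, 11, 12] [0, 1, 16] M₁ N ∧ N.nat 12 = n ∧ ∀ r, r < n → ∀ i j : Fin d,
      N.real 0 [r, i, j] = xs (a + r) i * xs (a + r) j ∧
      N.real 1 [i, j, r] = -P.step * weight P xs (a + r) i j) (by omega) rfl
    ⟨agreeOff_setNat _ _ (by simp), by simp, fun r hr => absurd hr (Nat.not_lt_zero r)⟩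
    (fun n N hN => hN.2.1) (fun n N hN => by simp [NExp.eval, hN.1.nat 15, h15]) ?_ ?_ ?_
  · rintro n N - hn ⟨hA, h12, hN⟩
    have hE₁ : Env P m h xs N := (hE.of_agree hA₁ (by decide) (by decide)).of_agree hA
      (by decide) (by decide)
    have h13N : N.nat 13 = a := by rw [hA.nat 13 (by simp), hA₁.nat 13 (by simp), h13]
    have hWN : ∀ s, s < p₀ → ∀ i j : Fin d, N.real 15 [s, i, j] = weight P xs s i j := by
      rw [hA.real 15 (by simp), hA₁.real 15 (by simp)]
      exact hW
    refine terminates_seq (s := 200 * Z ^ 3) (t := 200 * Z ^ 3) ?_ (by omega)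
    refine (terminates_fill (a₁ := 0) (b₁ := d) (a₂ := 0) (b₂ := d) (a := 0) (b := 0) (Z := Z)
      (addr := fun i j => [n, i, j]) (f := fun i j l => 0)
      (g := fun i j _ => N.real 4 [a + n, i] * N.real 4 [a + n, j]) (by norm_num)
      (fun M' hA' => ?_) (fun i j i' j' h => by simpa using h) (by omega) (by omega)
      (by omega) hdZ hdZ (by omega) hZ).mono (Nat.mul_le_mul_right _ (by decide)) ?_
    · simp [NExp.eval, RExp.eval, hA'.nat 0, hA'.nat 12, hA'.nat 13, hA'.real 4, hE₁.dim, h12, h13N]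
    rintro N₁ ⟨hB₁, hF₁, hG₁⟩
    refine (terminates_fill (a₁ := 0) (b₁ := d) (a₂ := 0) (b₂ := d) (a := 0) (b := 0) (Z := Z)
      (addr := fun i j => [i, j, n]) (f := fun i j l => 0)
      (g := fun i j _ => (0 - N.real 5 [] / 4) * N.real 15 [a + n, i, j]) (by norm_num)
      (fun M' hA' => ?_) (fun i j i' j' h => by simpa using h) (by omega) (by omega)
      (by omega) hdZ hdZ (by omega) hZ).mono (Nat.mul_le_mul_right _ (by decide)) ?_
    · simp [NExp.eval, RExp.eval, hA'.nat 0, hA'.nat 12, hA'.nat 13, hA'.real 5, hA'.real 15,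
        hB₁.nat 0, hB₁.nat 12, hB₁.nat 13, hB₁.real 5, hB₁.real 15, hE₁.dim, h12, h13N]
    rintro N₂ ⟨hB₂, hF₂, hG₂⟩
    have hB := (hA.trans (hB₁.mono (by simp) (by simp))).trans (hB₂.mono (by simp) (by simp))
    refine ⟨by simp [hB₂.nat 12, hB₁.nat 12, h12], hB.trans (agreeOff_setNat _ _ (by simp)),
      by simp, fun r hr i j => ?_⟩
    simp only [setNat_real]
    rw [hB₂.real 0 (by simp)]
    rcases Nat.lt_succ_iff_lt_or_eq.1 hr with hlt | rfl
    · rw [hG₁ _ fun i' j' he => hlt.ne (List.cons.inj he).1,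
        hG₂ _ fun i' j' he => hlt.ne
          (List.cons.inj (List.cons.inj (List.cons.inj he).2).2).1,
        hB₁.real 1 (by simp)]
      exact hN r hlt i j
    · rw [hF₁ i j (Nat.zero_le _) i.2 (Nat.zero_le _) j.2,
        hF₂ i j (Nat.zero_le _) i.2 (Nat.zero_le _) j.2, hE₁.step, hE₁.sample, hE₁.sample,
        hWN _ (by omega), zero_sub]
      exact ⟨rfl, rfl⟩
  · rintro N ⟨hA, -, hN⟩
    refine terminates_setNat (by simp [NExp.cost]) ⟨?_, ?_, ?_⟩
    · simp [NExp.eval, hA.nat 15, h15, a]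
    · exact fun r hr i j => (hN r hr i j).1
    · exact fun r hr i j => (hN r hr i j).2
  · simp only [NExp.cost]
    have h1 : (p₀ - a - 0) * (400 * Z ^ 3 + 1 + 7) ≤ Z * (400 * Z ^ 3 + 1 + 7) :=
      Nat.mul_le_mul_right _ (by omega)
    have h2 : Z * (400 * Z ^ 3 + 1 + 7) = 400 * Z ^ 4 + 8 * Z := by ring
    omega

/-- The rows of the encoder are the tensor squares of the examples of the block, and the columns of
the decoder are the scaled weights: the rank-one expansion of the iterate, read as a matrix product.
-/
theorem IsOutput.decoder_mul_encoder {p₀ : ℕ} (hO : IsOutput P xs p₀ M) :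
    M.decoder d * M.encoder d = iterate P xs p₀ := by
  ext u v
  rw [Matrix.mul_apply, iterate_eq_sum]
  simp only [Mem.decoder, Mem.encoder, Matrix.of_apply]
  have h1 : ∑ r : Fin M.codeLength, M.real 1 [u.1, u.2, r] * M.real 0 [r, v.1, v.2] =
      ∑ r ∈ Finset.range (p₀ - blockStart P.len p₀),
        M.real 1 [u.1, u.2, r] * M.real 0 [r, v.1, v.2] := by
    rw [← hO.len]
    exact (Finset.sum_range fun r => M.real 1 [u.1, u.2, r] * M.real 0 [r, v.1, v.2]).symm
  rw [h1, Finset.sum_Ico_eq_sum_range, Matrix.neg_apply, Matrix.smul_apply, Matrix.sum_apply,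
    smul_eq_mul, ← neg_mul, Finset.mul_sum]
  refine Finset.sum_congr rfl fun r hr => ?_
  have hr' := Finset.mem_range.1 hr
  rw [hO.enc r hr', hO.dec r hr']
  simp only [rankOne, Matrix.of_apply, tensorSq]
  ring

end Main

/-! ### The learner -/

/-- The bound on the squared Frobenius norm of the competitors. -/
def frobBound (d k : ℕ) (τ : ℝ) : ℝ := τ * τ * (min k (d * d) : ℕ)

/-- The bound on the norms of the error matrices. -/
noncomputable def errBound (r β : ℝ) : ℝ := 1 + 4 * r / β

/-- The precision of the approximate subgradients. -/
noncomputable def precision (r β : ℝ) : ℝ := β / (64 * (errBound r β + β))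

/-- The parameters of the descent for the target accuracy `β`. -/
noncomputable def learnParams (d : ℕ) (r β : ℝ) : Params where
  -- With T the value of `len`, each regret term gets at most β / 8 per example: the initial
  -- distance 2r/(β(T + 1)), because T + 1 > 16r/β²; the quadratic term, step/2; and the subgradient
  -- error. The iteration count makes both the power method and Newton's method accurate to `prec`.
  step := β / 4
  prec := precision r β
  iters := ⌈((d : ℝ) + 1 + errBound r β * errBound r β) / precision r β⌉₊
  len := ⌊16 * r / (β * β)⌋₊

theorem frobBound_nonneg (d k : ℕ) (τ : ℝ) : 0 ≤ frobBound d k τ :=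
  mul_nonneg (mul_self_nonneg τ) (Nat.cast_nonneg _)

/-! ### The choice of parameters. -/

section Params

variable {d : ℕ} {r β : ℝ}

theorem one_le_errBound (hr : 0 ≤ r) (hβ : 0 < β) : 1 ≤ errBound r β := by
  have : 0 ≤ 4 * r / β := by positivity
  unfold errBound
  linarith

theorem precision_pos (hr : 0 ≤ r) (hβ : 0 < β) : 0 < precision r β := by
  have := one_le_errBound hr hβ
  unfold precision
  positivity

/-- This is the purpose of the error bound in the denominator of the precision: the total
subgradient error is 3β/64. The extra β there keeps the precision below one. -/
theorem precision_mul_errBound_le (hr : 0 ≤ r) (hβ : 0 < β) :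
    precision r β * errBound r β ≤ β / 64 := by
  have := one_le_errBound hr hβ
  rw [precision, div_mul_eq_mul_div, div_le_div_iff₀ (by positivity) (by norm_num)]
  nlinarith

theorem len_mul_le (hr : 0 ≤ r) (hβ : 0 < β) : ((learnParams d r β).len : ℝ) ≤ 16 * r / (β * β) :=
  Nat.floor_le (by positivity)

theorem lt_len_succ_mul (hβ : 0 < β) : 16 * r < ((learnParams d r β).len + 1) * β * β := by
  have h := Nat.lt_floor_add_one (16 * r / (β * β))
  rw [div_lt_iff₀ (by positivity)] at h
  rw [mul_assoc]
  exact h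

theorem le_iters_mul (hr : 0 ≤ r) (hβ : 0 < β) :
    (d : ℝ) + 1 + errBound r β * errBound r β ≤ (learnParams d r β).iters * precision r β := by
  have h := Nat.le_ceil (((d : ℝ) + 1 + errBound r β * errBound r β) / precision r β)
  rw [div_le_iff₀ (precision_pos hr hβ)] at h
  exact h

theorem valid_learnParams (hr : 0 ≤ r) (hβ : 0 < β) :
    (learnParams d r β).Valid d (errBound r β) where
  step_pos := by
    change 0 < β / 4
    positivity
  prec_nonneg := (precision_pos hr hβ).le
  prec_le := by
    have := one_le_errBound hr hβ
    change β / (64 * (errBound r β + β)) ≤ 1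
    rw [div_le_one (by positivity)]
    linarith
  card_le := by
    refine le_trans ?_ (le_iters_mul hr hβ)
    nlinarith [mul_self_nonneg (errBound r β)]
  sq_le := by
    refine le_trans ?_ (le_iters_mul hr hβ)
    have : (0 : ℝ) ≤ d := Nat.cast_nonneg d
    nlinarith
  -- The iterates have norm at most step · T ≤ (β/4)(16r/β²) = 4r/β.
  bound := by
    have h := len_mul_le (d := d) hr hβ
    change 1 + β / 4 * (learnParams d r β).len ≤ errBound r β
    have h2 := mul_le_mul_of_nonneg_left h (by positivity : 0 ≤ β / 4)
    have h3 : β / 4 * (16 * r / (β * β)) = 4 * r / β := by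
      field_simp
      ring
    rw [errBound]
    linarith

theorem regret_le (hr : 0 ≤ r) (hβ : 0 < β) :
    r / (2 * (learnParams d r β).step) + ((learnParams d r β).len + 1) *
      (3 * (learnParams d r β).prec * errBound r β + (learnParams d r β).step / 2) ≤
    ((learnParams d r β).len + 1) * (3 * β / 8) := by
  have h1 := lt_len_succ_mul (d := d) (r := r) hβ
  have h2 := precision_mul_errBound_le hr hβ
  set T : ℝ := ((learnParams d r β).len : ℝ)
  have hT : 0 ≤ T := Nat.cast_nonneg _
  change r / (2 * (β / 4)) + (T + 1) * (3 * precision r β * errBound r β + β / 4 / 2) ≤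
    (T + 1) * (3 * β / 8)
  have h3 : r / (2 * (β / 4)) ≤ (T + 1) * (β / 8) := by
    rw [div_le_iff₀ (by positivity)]
    nlinarith
  have h4 : (T + 1) * (3 * precision r β * errBound r β + β / 4 / 2) ≤
      (T + 1) * (3 * β / 64 + β / 8) :=
    mul_le_mul_of_nonneg_left (by linarith) (by linarith)
  have h5 : 0 ≤ (T + 1) * β := by positivity
  linarith

end Params

/-- Computes the parameters of the descent. -/
def setupProg : Program :=
  -- The target accuracy is β = (δ + α)/4 because reconstruction multiplies the spectral error by
  -- four.
  .seq (.setReal 5 [] (.div (.add (.cell 1 []) (.cell 2 [])) (.const 4)))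
  -- The minimum of k and d² in the bound on the squared Frobenius norm.
  (.seq (.branch (.realLT (.cast (.reg 1)) (.mul (.cast (.reg 0)) (.cast (.reg 0))))
    (.setReal 6 [] (.mul (.mul (.cell 0 []) (.cell 0 [])) (.cast (.reg 1))))
    (.setReal 6 [] (.mul (.mul (.cell 0 []) (.cell 0 []))
      (.mul (.cast (.reg 0)) (.cast (.reg 0))))))
  (.seq (.setReal 7 [] (.add (.const 1) (.div (.mul (.const 4) (.cell 6 [])) (.cell 5 []))))
  (.seq (.setReal 8 [] (.div (.cell 5 []) (.mul (.const 64) (.add (.cell 7 []) (.cell 5 [])))))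
  -- The least n with 16r < (n + 1)β² is ⌊16r/β²⌋.
  (.seq (counter 3 (.neg (.realLT (.mul (.const 16) (.cell 6 []))
    (.mul (.mul (.add (.cast (.reg 3)) (.const 1)) (.cell 5 [])) (.cell 5 [])))))
  -- The least n with 2n ≥ m: the first half of the sample, rounded up, is for descent.
  (.seq (counter 4 (.natLT (.add (.reg 4) (.reg 4)) (.reg 2)))
  (counter 5 (.realLT (.mul (.cast (.reg 5)) (.cell 8 []))
    (.add (.add (.cast (.reg 0)) (.const 1)) (.mul (.cell 7 []) (.cell 7 []))))))))))

/-- The learner. -/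
def learner : Program :=
  .seq setupProg (.seq (forLoop 6 (.const 0) (.reg 4) stepProg) outputProg)

/-! ### Correctness and cost of the whole program. -/

section Learner

variable {d k m : ℕ} {τ δ α η : ℝ} {Z : ℕ}

theorem terminates_setupProg (hβ : 0 < (δ + α) / 4) (X : Fin m → EuclideanSpace ℝ (Fin d))
    (hmZ : m ≤ Z) (hqZ : (learnParams d (frobBound d k τ) ((δ + α) / 4)).iters ≤ Z)
    (hTZ : (learnParams d (frobBound d k τ) ((δ + α) / 4)).len ≤ Z) (hZ : 1 ≤ Z) :
    Terminates setupProg (input d k m τ δ α η X) (500 * Z) fun M =>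
      Env (learnParams d (frobBound d k τ) ((δ + α) / 4)) m ((m + 1) / 2) (extend X) M ∧
        M.nat 7 = 0 ∧ M.nat 13 = 0 ∧ M.nat 14 = 0 ∧ M.real 17 [] = 0 := by
  set M₀ := input d k m τ δ α η X with hM₀
  set r := frobBound d k τ with hr
  set β := (δ + α) / 4 with hβ'
  have hr0 : 0 ≤ r := frobBound_nonneg d k τ
  set P := learnParams d r β with hP
  refine terminates_seq (s := 20) (t := 480 * Z)
    (terminates_setReal (by simp [RExp.cost, addrCost]) ?_) (by omega)
  set M₁ := M₀.setReal 5 (List.map (NExp.eval M₀) [])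
    ((RExp.div (.add (.cell 1 []) (.cell 2 [])) (.const 4)).eval M₀) with hM₁
  have h5 : M₁.real 5 [] = β := by
    simp [hM₁, RExp.eval, hM₀, input, hβ']
  have a₁ : AgreeOff [3, 4, 5] [5, 6, 7, 8] M₀ M₁ := agreeOff_setReal _ _ _ (by simp)
  have key : ∀ M₂, AgreeOff [3, 4, 5] [5, 6, 7, 8] M₀ M₂ → M₂.real 5 [] = β →
      M₂.real 6 [] = r → Terminates
      (.seq (.setReal 7 [] (.add (.const 1) (.div (.mul (.const 4) (.cell 6 [])) (.cell 5 []))))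
      (.seq (.setReal 8 [] (.div (.cell 5 []) (.mul (.const 64) (.add (.cell 7 []) (.cell 5 [])))))
      (.seq (counter 3 (.neg (.realLT (.mul (.const 16) (.cell 6 []))
        (.mul (.mul (.add (.cast (.reg 3)) (.const 1)) (.cell 5 [])) (.cell 5 [])))))
      (.seq (counter 4 (.natLT (.add (.reg 4) (.reg 4)) (.reg 2)))
      (counter 5 (.realLT (.mul (.cast (.reg 5)) (.cell 8 []))
        (.add (.add (.cast (.reg 0)) (.const 1)) (.mul (.cell 7 []) (.cell 7 [])))))))))
      M₂ (400 * Z) fun M => Env P m ((m + 1) / 2) (extend X) M ∧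
        M.nat 7 = 0 ∧ M.nat 13 = 0 ∧ M.nat 14 = 0 ∧ M.real 17 [] = 0 := by
    intro M₂ a₂ h5 h6
    refine terminates_seq (s := 20) (t := 380 * Z)
      (terminates_setReal (by simp [RExp.cost, addrCost]) ?_) (by omega)
    set M₃ := M₂.setReal 7 (List.map (NExp.eval M₂) [])
      ((RExp.add (.const 1) (.div (.mul (.const 4) (.cell 6 [])) (.cell 5 []))).eval M₂) with hM₃
    have h7 : M₃.real 7 [] = errBound r β := by
      simp [hM₃, RExp.eval, h5, h6, errBound]
    have h5₃ : M₃.real 5 [] = β := by simp [hM₃, h5]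
    have h6₃ : M₃.real 6 [] = r := by simp [hM₃, h6]
    refine terminates_seq (s := 20) (t := 360 * Z)
      (terminates_setReal (by simp [RExp.cost, addrCost]) ?_) (by omega)
    set M₄ := M₃.setReal 8 (List.map (NExp.eval M₃) [])
      ((RExp.div (.cell 5 []) (.mul (.const 64) (.add (.cell 7 []) (.cell 5 [])))).eval M₃) with hM₄
    have h8 : M₄.real 8 [] = precision r β := by
      simp [hM₄, RExp.eval, h5₃, h7, precision]
    have h5₄ : M₄.real 5 [] = β := by simp [hM₄, h5₃]
    have h6₄ : M₄.real 6 [] = r := by simp [hM₄, h6₃]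
    have h7₄ : M₄.real 7 [] = errBound r β := by simp [hM₄, h7]
    have a₄ : AgreeOff [3, 4, 5] [5, 6, 7, 8] M₀ M₄ :=
      (a₂.trans (agreeOff_setReal _ _ _ (by simp))).trans (agreeOff_setReal _ _ _ (by simp))
    clear_value M₄
    have n0 : M₄.nat 0 = d := a₄.nat 0 (by simp)
    have n2 : M₄.nat 2 = m := a₄.nat 2 (by simp)
    refine terminates_seq (s := 40 * Z) (t := 120 * Z) ?_ (by omega)
    refine terminates_counter (p := fun n => ¬ 16 * r < ((n : ℝ) + 1) * β * β) (K := P.len)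
      ?_ ?_ ?_ ?_ ?_
    · intro n
      simp [Test.holds, RExp.eval, NExp.eval, h5₄, h6₄]
    · exact not_not.2 (lt_len_succ_mul hβ)
    · intro j hj
      have h1 := len_mul_le (d := d) hr0 hβ
      rw [le_div_iff₀ (by positivity)] at h1
      have h2 : ((j : ℝ) + 1) ≤ P.len := by exact_mod_cast hj
      have h3 := mul_le_mul_of_nonneg_right h2 (by positivity : 0 ≤ β * β)
      rw [not_lt, mul_assoc]
      exact h3.trans h1
    swap
    · simp only [Test.cost, RExp.cost, NExp.cost, addrCost, List.map_nil, List.sum_nil]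
      omega
    set M₅ := M₄.setNat 3 P.len with hM₅
    refine terminates_seq (s := 40 * Z) (t := 80 * Z) ?_ (by omega)
    refine terminates_counter (p := fun n => n + n < m) (K := (m + 1) / 2) ?_ (by omega)
      (by omega) ?_ ?_
    · intro n
      simp [Test.holds, NExp.eval, hM₅, n2]
    swap
    · simp only [Test.cost, NExp.cost]
      omega
    refine terminates_counter (p := fun n : ℕ => (n : ℝ) * precision r β <
      (d : ℝ) + 1 + errBound r β * errBound r β) (K := P.iters) ?_ ?_ ?_ ?_ ?_
    · intro n
      simp [Test.holds, RExp.eval, NExp.eval, hM₅, n0, h7₄, h8]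
    · exact not_lt.2 (le_iters_mul hr0 hβ)
    · intro j hj
      have := Nat.lt_ceil.1 hj
      rwa [lt_div_iff₀ (precision_pos hr0 hβ)] at this
    swap
    · simp only [Test.cost, RExp.cost, NExp.cost, addrCost, List.map_nil, List.sum_nil]
      omega
    refine ⟨⟨?_, ?_, ?_, ?_, ?_, ?_, ?_, ?_⟩, ?_, ?_, ?_, ?_⟩
    · simp [hM₅, n0]
    · simp [hM₅, n2]
    · simp [hM₅]
    · simp
    · simp
    · intro i j
      simp only [setNat_real, hM₅]
      rw [a₄.real 4 (by simp)]
      by_cases hi : i < m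
      · simp [hM₀, input, extend, hi]
      · simp [hM₀, input, extend, hi]
    · simp only [setNat_real, hM₅, h5₄]
      rfl
    · simp only [setNat_real, hM₅, h8]
      rfl
    · simp [hM₅, a₄.nat 7, hM₀, input]
    · simp [hM₅, a₄.nat 13, hM₀, input]
    · simp [hM₅, a₄.nat 14, hM₀, input]
    · simp [hM₅, a₄.real 17, hM₀, input]
  refine terminates_seq (s := 40) (t := 400 * Z) ?_ (by omega)
  have n0 : M₁.nat 0 = d := rfl
  have n1 : M₁.nat 1 = k := rfl
  have hτ : M₁.real 0 [] = τ := by rw [a₁.real 0 (by simp)]; rfl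
  refine terminates_branch (s := 20) (fun hb => ?_) (fun hb => ?_)
    (by simp [Test.cost, RExp.cost, NExp.cost])
  · simp only [Test.holds, RExp.eval, NExp.eval, n0, n1] at hb
    refine terminates_setReal (by simp [RExp.cost, NExp.cost, addrCost])
      (key _ (a₁.trans (agreeOff_setReal _ _ _ (by simp))) (by simp [h5]) ?_)
    have hk : k < d * d := by exact_mod_cast hb
    simp [RExp.eval, NExp.eval, hτ, n1, hr, frobBound, min_eq_left hk.le]
  · simp only [Test.holds, RExp.eval, NExp.eval, n0, n1] at hb
    refine terminates_setReal (by simp [RExp.cost, NExp.cost, addrCost])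
      (key _ (a₁.trans (agreeOff_setReal _ _ _ (by simp))) (by simp [h5]) ?_)
    have hk : d * d ≤ k := by exact_mod_cast not_lt.1 hb
    simp [RExp.eval, NExp.eval, hτ, n0, hr, frobBound, min_eq_right hk]

theorem terminates_learner (hβ : 0 < (δ + α) / 4) (X : Fin m → EuclideanSpace ℝ (Fin d))
    (hdZ : d ≤ Z) (hmZ : m ≤ Z)
    (hqZ : (learnParams d (frobBound d k τ) ((δ + α) / 4)).iters ≤ Z)
    (hTZ : (learnParams d (frobBound d k τ) ((δ + α) / 4)).len ≤ Z) (hZ : 1 ≤ Z) :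
    Terminates learner (input d k m τ δ α η X) (10000 * Z ^ 6) fun M =>
      ∃ p₀, IsOutput (learnParams d (frobBound d k τ) ((δ + α) / 4)) (extend X) p₀ M ∧
        (0 < (m + 1) / 2 → p₀ < (m + 1) / 2 ∧ ∀ p < (m + 1) / 2,
          holdoutScore (learnParams d (frobBound d k τ) ((δ + α) / 4)) ((m + 1) / 2) m
            (extend X) p₀ ≤
          holdoutScore (learnParams d (frobBound d k τ) ((δ + α) / 4)) ((m + 1) / 2) m
            (extend X) p) := by
  set P := learnParams d (frobBound d k τ) ((δ + α) / 4)
  have hP : 0 ≤ P.prec := (precision_pos (frobBound_nonneg d k τ) hβ).le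
  have hZ1 : Z ≤ Z ^ 6 := Nat.le_self_pow (by norm_num) Z
  have hZ4 : Z ^ 4 ≤ Z ^ 6 := Nat.pow_le_pow_right hZ (by norm_num)
  refine terminates_seq (s := 500 * Z) (t := 9500 * Z ^ 6)
    ((terminates_setupProg hβ X hmZ hqZ hTZ hZ).mono le_rfl ?_) (by omega)
  rintro M₁ ⟨hE, h7, h13, h14, h17⟩
  refine terminates_seq (s := 9000 * Z ^ 6) (t := 500 * Z ^ 4)
    ((terminates_main hP hE h7 h13 h14 h17 hdZ hmZ (by omega) hqZ hZ).mono le_rfl ?_) (by omega)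
  rintro M₂ ⟨p₀, hI⟩
  have hp₀ : p₀ ≤ (m + 1) / 2 := by
    rcases hI.score with h | h
    · omega
    · exact h.1.le
  have hW : ∀ s, s < p₀ → ∀ i j : Fin d,
      M₂.real 15 [s, i, j] = weight P (extend X) s i j := fun s hs => hI.weights s (by omega)
  refine (terminates_outputProg hI.env hI.best hI.bestStart hW hdZ (by omega) hZ).mono
    le_rfl fun M hM => ⟨p₀, hM, fun hpos => ?_⟩
  rcases hI.score with h | ⟨h1, h2, h3⟩
  · omega
  · refine ⟨h1, fun p hp => ?_⟩
    have h4 := h3 p hp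
    have n0 := holdoutScore_nonneg (h := (m + 1) / 2) (m := m) (xs := extend X) hP p₀
    have n1 := holdoutScore_nonneg (h := (m + 1) / 2) (m := m) (xs := extend X) hP p
    rw [h2, one_div_le_one_div (by linarith) (by linarith)] at h4
    linarith

end Learner

/-! ### Polynomial bounds -/

section Bounds

variable {d k : ℕ} {τ δ β S r η : ℝ}

/-- One large number c serves both as the constant and as the exponent of every polynomial bound. -/
theorem mul_pow_le_mul_pow {K x : ℝ} {n c : ℕ} (hx : 1 ≤ x) (hK : K ≤ c) (hn : n ≤ c) :
    K * x ^ n ≤ c * x ^ c :=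
  mul_le_mul hK (pow_le_pow_right₀ hx hn) (by positivity) (Nat.cast_nonneg _)

/-- The rank is at most d² whatever k is, so S need not bound k. This keeps k out of the sample
size. -/
theorem frobBound_le_pow (hτ : 0 ≤ τ) (hτS : τ ≤ S) (hdS : (d : ℝ) ≤ S) :
    frobBound d k τ ≤ S ^ 4 := by
  have h : ((min k (d * d) : ℕ) : ℝ) ≤ S * S := by
    calc ((min k (d * d) : ℕ) : ℝ) ≤ ((d * d : ℕ) : ℝ) := by exact_mod_cast min_le_right _ _
      _ = d * d := by push_cast; ring
      _ ≤ S * S := mul_self_le_mul_self (Nat.cast_nonneg d) hdS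
  calc frobBound d k τ ≤ S * S * (S * S) :=
        mul_le_mul (mul_self_le_mul_self hτ hτS) h (Nat.cast_nonneg _) (mul_self_nonneg S)
    _ = S ^ 4 := by ring

/-- The length is in fact at most 256 τ²k/δ². If it is nonzero this number is at least one, hence at
most its square. -/
theorem len_le_mul (hδ : 0 < δ) (hβ : δ / 4 ≤ β) :
    ((learnParams d (frobBound d k τ) β).len : ℝ) ≤ 65536 * (τ ^ 4 * (k : ℝ) ^ 4 / δ ^ 4) := by
  rcases Nat.eq_zero_or_pos (learnParams d (frobBound d k τ) β).len with h0 | h0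
  · rw [h0]
    simp only [Nat.cast_zero]
    positivity
  have hβ0 : 0 < β := by linarith
  have h1 : (1 : ℝ) ≤ (learnParams d (frobBound d k τ) β).len := by exact_mod_cast h0
  have h2 : ((learnParams d (frobBound d k τ) β).len : ℝ) ≤ 256 * (τ ^ 2 * k) / δ ^ 2 := by
    refine (len_mul_le (frobBound_nonneg d k τ) hβ0).trans ?_
    have h3 : frobBound d k τ ≤ τ ^ 2 * k := by
      rw [frobBound, ← sq]
      exact mul_le_mul_of_nonneg_left (by exact_mod_cast min_le_left _ _) (by positivity)
    have h4 : δ / 4 * (δ / 4) ≤ β * β := mul_self_le_mul_self (by positivity) hβ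
    have h5 : 0 ≤ τ ^ 2 * k := by positivity
    rw [div_le_div_iff₀ (by positivity) (by positivity)]
    nlinarith [mul_le_mul_of_nonneg_left h3 (sq_nonneg δ), mul_le_mul_of_nonneg_left h4 h5]
  -- For k = 0 the bound just proved would make the length zero.
  have hk : (1 : ℝ) ≤ k := by
    rcases Nat.eq_zero_or_pos k with hk | hk
    · subst hk
      norm_num at h2
      omega
    · exact_mod_cast hk
  set x : ℝ := 256 * (τ ^ 2 * k) / δ ^ 2 with hx
  calc ((learnParams d (frobBound d k τ) β).len : ℝ) ≤ x := h2
    _ ≤ x ^ 2 := le_self_pow₀ (h1.trans h2) (by norm_num)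
    _ = 65536 * (τ ^ 4 * (k : ℝ) ^ 2 / δ ^ 4) := by
        rw [hx]
        ring
    _ ≤ 65536 * (τ ^ 4 * (k : ℝ) ^ 4 / δ ^ 4) := by
        have := pow_le_pow_right₀ hk (by norm_num : 2 ≤ 4)
        gcongr

/-- Here and below S bounds the input parameters, and 1 ≤ 4Sβ expresses that 1/β is at most 4S. -/
theorem len_succ_le_pow (hS : 1 ≤ S) (hr0 : 0 ≤ r) (hr : r ≤ S ^ 4) (hβ : 0 < β)
    (hβS : 1 ≤ 4 * S * β) : ((learnParams d r β).len : ℝ) + 1 ≤ 257 * S ^ 6 := by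
  have h1 : 16 * r / (β * β) ≤ 256 * S ^ 6 := by
    rw [div_le_iff₀ (by positivity)]
    have h2 : 1 ≤ (4 * S * β) ^ 2 := one_le_pow₀ hβS
    have h3 : S ^ 4 * 1 ≤ S ^ 4 * (4 * S * β) ^ 2 := mul_le_mul_of_nonneg_left h2 (by positivity)
    nlinarith
  have h4 := len_mul_le (d := d) hr0 hβ
  have h5 : 1 ≤ S ^ 6 := one_le_pow₀ hS
  linarith

theorem errBound_le_pow (hS : 1 ≤ S) (hr : r ≤ S ^ 4) (hβ : 0 < β)
    (hβS : 1 ≤ 4 * S * β) : errBound r β ≤ 17 * S ^ 5 := by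
  have h1 : 4 * r / β ≤ 16 * S ^ 5 := by
    rw [div_le_iff₀ hβ]
    have h3 : S ^ 4 * 1 ≤ S ^ 4 * (4 * S * β) := mul_le_mul_of_nonneg_left hβS (by positivity)
    nlinarith
  have h5 : 1 ≤ S ^ 5 := one_le_pow₀ hS
  rw [errBound]
  linarith

theorem errBound_le_mul (hS : 1 ≤ S) (hr : r ≤ S ^ 4) (hβ : 0 < β)
    (hβS : 1 ≤ 4 * S * β) : errBound r β ≤ 68 * S ^ 6 * β := by
  refine (errBound_le_pow hS hr hβ hβS).trans ?_
  have h3 : 17 * S ^ 5 * 1 ≤ 17 * S ^ 5 * (4 * S * β) :=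
    mul_le_mul_of_nonneg_left hβS (by positivity)
  linarith

theorem iters_le_pow (hS : 1 ≤ S) (hr0 : 0 ≤ r) (hr : r ≤ S ^ 4) (hβ : 0 < β)
    (hβS : 1 ≤ 4 * S * β) (hdS : (d : ℝ) ≤ S) :
    ((learnParams d r β).iters : ℝ) ≤ 1285057 * S ^ 16 := by
  have hb := one_le_errBound hr0 hβ
  have h1 : (d : ℝ) + 1 + errBound r β * errBound r β ≤ 291 * S ^ 10 := by
    have h2 := mul_self_le_mul_self (by linarith) (errBound_le_pow hS hr hβ hβS)
    have h3 : S ≤ S ^ 10 := le_self_pow₀ hS (by norm_num)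
    nlinarith
  have h4 : 1 / precision r β ≤ 4416 * S ^ 6 := by
    rw [precision, one_div_div, div_le_iff₀ hβ]
    have h5 := errBound_le_mul hS hr hβ hβS
    have h6 : 1 * β ≤ S ^ 6 * β := mul_le_mul_of_nonneg_right (one_le_pow₀ hS) hβ.le
    linarith
  have h7 : ((d : ℝ) + 1 + errBound r β * errBound r β) / precision r β ≤ 1285056 * S ^ 16 := by
    rw [div_eq_mul_one_div]
    calc _ ≤ 291 * S ^ 10 * (4416 * S ^ 6) :=
          mul_le_mul h1 h4 (one_div_nonneg.2 (precision_pos hr0 hβ).le) (by positivity)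
      _ = 1285056 * S ^ 16 := by ring
  have h8 : ((learnParams d r β).iters : ℝ) <
      ((d : ℝ) + 1 + errBound r β * errBound r β) / precision r β + 1 :=
    Nat.ceil_lt_add_one (div_nonneg (by positivity) (precision_pos hr0 hβ).le)
  have h9 : 1 ≤ S ^ 16 := one_le_pow₀ hS
  linarith

/-- The failure probability of one block is 1 - (β/8)/(1 + β/2) ≤ exp(-1/(36S)), since 36Sβ/8 = 4Sβ
+ Sβ/2 ≥ 1 + β/2. With 36S(S + 1) blocks, exp(-S) gives η and exp(-1) gives the factor 1/2. -/
theorem failure_of_blocks_le {N : ℕ} (hS : 1 ≤ S) (hη : 0 < η) (hηS : Real.log (1 / η) ≤ S)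
    (hβ : 0 < β) (hβS : 1 ≤ 4 * S * β) (hN : 36 * S * (S + 1) ≤ N) :
    ((1 + 3 * β / 8) / (1 + β / 2)) ^ N ≤ η / 2 := by
  have h1 : (1 + 3 * β / 8) / (1 + β / 2) ≤ Real.exp (-(1 / (36 * S))) := by
    refine le_trans ?_ (Real.add_one_le_exp _)
    have h2 : 1 / (36 * S) ≤ (β / 8) / (1 + β / 2) := by
      rw [div_le_div_iff₀ (by positivity) (by positivity)]
      nlinarith
    have h3 : (1 + 3 * β / 8) / (1 + β / 2) = 1 - (β / 8) / (1 + β / 2) := by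
      field_simp
      ring
    linarith
  have h4 : Real.exp (-S) ≤ η := by
    rw [← Real.exp_log hη, Real.exp_le_exp]
    rw [one_div, Real.log_inv] at hηS
    linarith
  have h5 : Real.exp (-1) ≤ 1 / 2 := by
    rw [Real.exp_neg, ← one_div, one_div_le_one_div (Real.exp_pos 1) (by norm_num)]
    linarith [Real.add_one_le_exp (1 : ℝ)]
  calc ((1 + 3 * β / 8) / (1 + β / 2)) ^ N ≤ Real.exp (-(1 / (36 * S))) ^ N :=
        pow_le_pow_left₀ (by positivity) h1 N
    _ = Real.exp (-(N / (36 * S))) := by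
        rw [← Real.exp_nat_mul]
        congr 1
        ring
    _ ≤ Real.exp (-S + -1) := by
        rw [Real.exp_le_exp]
        have : S + 1 ≤ N / (36 * S) := by
          rw [le_div_iff₀ (by positivity)]
          linarith
        linarith
    _ = Real.exp (-S) * Real.exp (-1) := Real.exp_add _ _
    _ ≤ η * (1 / 2) := mul_le_mul h4 h5 (Real.exp_pos _).le hη.le
    _ = η / 2 := by ring

/-- Half of the exponent yields the factor η. The other half beats the factor m of the union bound,
through exp u ≥ 1 + u + u²/2. -/
theorem two_mul_exp_le {m θ : ℝ} (hθ : 0 < θ) (hη : 0 < η) (hηS : Real.log (1 / η) ≤ S)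
    (h1 : 2 * S ≤ m * θ) (h2 : 32 ≤ m * θ ^ 2) (hm : 0 ≤ m) :
    m * (2 * Real.exp (-(m * θ))) ≤ η / 2 := by
  set E := Real.exp (-(m * θ / 2)) with hE
  have hE0 : 0 < E := Real.exp_pos _
  have h3 : E ≤ η := by
    rw [← Real.exp_log hη, hE, Real.exp_le_exp]
    rw [one_div, Real.log_inv] at hηS
    linarith
  have h4 : m * E ≤ 1 / 4 := by
    rw [hE, Real.exp_neg, ← div_eq_mul_inv, div_le_iff₀ (Real.exp_pos _)]
    have h5 := Real.quadratic_le_exp_of_nonneg (by positivity : 0 ≤ m * θ / 2)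
    have h6 : m * 32 ≤ m * (m * θ ^ 2) := mul_le_mul_of_nonneg_left h2 hm
    have h7 : 0 ≤ m * θ := by positivity
    nlinarith
  have h8 : Real.exp (-(m * θ)) = E * E := by
    rw [hE, ← Real.exp_add]
    congr 1
    ring
  rw [h8]
  nlinarith [mul_le_mul h4 h3 hE0.le (by norm_num)]

/-- The range of the losses is at most 68 S⁶β, so β cancels in the Hoeffding exponent: it is at
least mθ with 1/θ = 2 · 64 · 68² S¹², a rate polynomial in S alone. -/
theorem failure_of_holdout_le {m h : ℕ} (hS : 1 ≤ S) (hη : 0 < η) (hηS : Real.log (1 / η) ≤ S)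
    (hr0 : 0 ≤ r) (hr : r ≤ S ^ 4) (hβ : 0 < β) (hβS : 1 ≤ 4 * S * β) (hh : h ≤ m)
    (hmh : (m : ℝ) ≤ 4 * (m - h : ℕ)) (hm : 20000000000000 * S ^ 24 ≤ m) :
    h * (2 * Real.exp (-(2 * (m - h : ℕ) * (β / 8) ^ 2 / errBound r β ^ 2))) ≤ η / 2 := by
  have hb := one_le_errBound hr0 hβ
  have hS12 : 0 < S ^ 12 := by positivity
  set θ : ℝ := 1 / (591872 * S ^ 12) with hθ
  have hθ0 : 0 < θ := by positivity
  have hθS : θ * (591872 * S ^ 12) = 1 := by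
    rw [hθ]
    field_simp
  have h1 : m * θ ≤ 2 * (m - h : ℕ) * (β / 8) ^ 2 / errBound r β ^ 2 := by
    have h2 : 2 * θ ≤ (β / 8) ^ 2 / errBound r β ^ 2 := by
      rw [le_div_iff₀ (by positivity)]
      have h3 : errBound r β ^ 2 ≤ (68 * S ^ 6 * β) ^ 2 :=
        pow_le_pow_left₀ (by linarith) (errBound_le_mul hS hr hβ hβS) 2
      calc 2 * θ * errBound r β ^ 2 ≤ 2 * θ * (68 * S ^ 6 * β) ^ 2 :=
            mul_le_mul_of_nonneg_left h3 (by positivity)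
        _ = θ * (591872 * S ^ 12) * (β / 8) ^ 2 := by ring
        _ = (β / 8) ^ 2 := by rw [hθS, one_mul]
    calc (m : ℝ) * θ ≤ 4 * (m - h : ℕ) * θ := mul_le_mul_of_nonneg_right hmh hθ0.le
      _ = 2 * (m - h : ℕ) * (2 * θ) := by ring
      _ ≤ 2 * (m - h : ℕ) * ((β / 8) ^ 2 / errBound r β ^ 2) :=
          mul_le_mul_of_nonneg_left h2 (by positivity)
      _ = _ := by ring
  have h4 : (h : ℝ) ≤ m := by exact_mod_cast hh
  have h5 : S ^ 13 ≤ S ^ 24 := pow_le_pow_right₀ hS (by norm_num)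
  have h7 : (32 : ℝ) ≤ m * θ ^ 2 := by
    calc (32 : ℝ) ≤ 20000000000000 * S ^ 24 * θ ^ 2 := by
          have : S ^ 24 * θ ^ 2 * 591872 ^ 2 = 1 := by
            calc S ^ 24 * θ ^ 2 * 591872 ^ 2 = (θ * (591872 * S ^ 12)) ^ 2 := by ring
              _ = 1 := by rw [hθS, one_pow]
          linarith
      _ ≤ m * θ ^ 2 := mul_le_mul_of_nonneg_right hm (by positivity)
  have h8 : 2 * S ≤ m * θ := by
    have h9 : 1183744 * S ^ 13 * θ = 2 * S := by
      calc 1183744 * S ^ 13 * θ = 2 * S * (θ * (591872 * S ^ 12)) := by ring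
        _ = 2 * S := by rw [hθS, mul_one]
    rw [← h9]
    exact mul_le_mul_of_nonneg_right (by linarith [pow_pos (by linarith : 0 < S) 13]) hθ0.le
  calc h * (2 * Real.exp (-(2 * (m - h : ℕ) * (β / 8) ^ 2 / errBound r β ^ 2)))
      ≤ m * (2 * Real.exp (-(m * θ))) := by
        refine mul_le_mul h4 (mul_le_mul_of_nonneg_left (Real.exp_le_exp.2 (by linarith))
          (by norm_num)) (by positivity) (by positivity)
    _ ≤ η / 2 := two_mul_exp_le hθ0 hη hηS h8 h7 (Nat.cast_nonneg m)

end Bounds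

/-! ### Guarantees of the learner -/

section Guarantees

variable {d k m : ℕ} {τ δ α η β : ℝ}

/-- The relaxation: a product BA of norm at most τ lies in the Frobenius ball over which the optimum
is taken. -/
theorem optRisk_le_spectralLoss (D : Measure (EuclideanSpace ℝ (Fin d)))
    {A : Matrix (Fin k) (Fin d × Fin d) ℝ} {B : Matrix (Fin d × Fin d) (Fin k) ℝ}
    (h : opNorm (B * A) ≤ τ) : optRisk D (frobBound d k τ) ≤ spectralLoss D A B := by
  rw [spectralLoss_eq]
  have hf : frob (B * A) (B * A) ≤ frobBound d k τ := by
    have h1 := frob_mul_self_le A B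
    rw [Fintype.card_prod, Fintype.card_fin] at h1
    rw [frobBound, mul_comm (τ * τ), ← sq τ]
    have h2 : opNorm (B * A) ^ 2 ≤ τ ^ 2 := pow_le_pow_left₀ (opNorm_nonneg _) h 2
    exact h1.trans (mul_le_mul_of_nonneg_left h2 (Nat.cast_nonneg _))
  exact iInf₂_le (f := fun R (_ : frob R R ≤ frobBound d k τ) => risk D R) (B * A) hf

theorem guarantees_of_loss_le {D : Measure (EuclideanSpace ℝ (Fin d))} [IsProbabilityMeasure D]
    (hD : ∀ᵐ x ∂D, ‖x‖ = 1) {ε : ℝ} (hdec : IsRegularlySpectralDecodable τ k ε D)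
    (hβ : 0 < β) {k' : ℕ} {A' : Matrix (Fin k') (Fin d × Fin d) ℝ}
    {B' : Matrix (Fin d × Fin d) (Fin k') ℝ}
    (h : spectralLoss D A' B' ≤ optRisk D (frobBound d k τ) + ENNReal.ofReal β) :
    (∀ (A : Matrix (Fin k) (Fin d × Fin d) ℝ) (B : Matrix (Fin d × Fin d) (Fin k) ℝ),
      opNorm (B * A) ≤ τ → spectralLoss D A' B' ≤ spectralLoss D A B + ENNReal.ofReal β) ∧
    spectralLoss D A' B' ≤ ENNReal.ofReal (ε + β) ∧
    ∀ f ∈ spectralAutoencoder A' B', reconstructionLoss D f ≤ ENNReal.ofReal (4 * ε + 4 * β) := by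
  obtain ⟨A, B, hAB, hε⟩ := hdec
  -- A probability measure makes the almost sure bound hold at some point, and the spectral error
  -- there is nonnegative.
  have hε0 : 0 ≤ ε := by
    obtain ⟨x, hx⟩ := hε.exists
    exact (spectralError_nonneg A B x).trans hx
  have h2 : spectralLoss D A' B' ≤ ENNReal.ofReal (ε + β) := by
    rw [ENNReal.ofReal_add hε0 hβ.le]
    refine h.trans (add_le_add_left ((optRisk_le_spectralLoss D hAB).trans ?_) _)
    calc spectralLoss D A B ≤ ∫⁻ _, ENNReal.ofReal ε ∂D :=
          lintegral_mono_ae (hε.mono fun x hx => ENNReal.ofReal_le_ofReal hx)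
      _ = ENNReal.ofReal ε := by simp
  refine ⟨fun A B hAB => h.trans (add_le_add_left (optRisk_le_spectralLoss D hAB) _), h2,
    fun f hf => ?_⟩
  calc reconstructionLoss D f ≤ 4 * spectralLoss D A' B' := reconstructionLoss_le hD hf
    _ ≤ ENNReal.ofReal 4 * ENNReal.ofReal (ε + β) := by
        rw [ENNReal.ofReal_ofNat]
        exact mul_le_mul_right h2 _
    _ = ENNReal.ofReal (4 * ε + 4 * β) := by
        rw [← ENNReal.ofReal_mul (by norm_num)]
        congr 1
        ring

end Guarantees

/-! ### Running time, code length and success probability. -/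

section Guarantees

variable {d k m : ℕ} {τ δ α η β : ℝ}

/-- The descent parameters of the learner for the inputs `d`, `k`, `τ`, `δ`, `α`. -/
noncomputable def learnerParams (d k : ℕ) (τ δ α : ℝ) : Params :=
  learnParams d (frobBound d k τ) ((δ + α) / 4)

/-- The result of the learner on a sample. -/
def IsLearned (k m : ℕ) (τ δ α : ℝ) (X : Fin m → EuclideanSpace ℝ (Fin d)) (M : Mem) : Prop :=
  ∃ p₀, IsOutput (learnerParams d k τ δ α) (extend X) p₀ M ∧
    (0 < (m + 1) / 2 → p₀ < (m + 1) / 2 ∧ ∀ p < (m + 1) / 2,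
      holdoutScore (learnerParams d k τ δ α) ((m + 1) / 2) m (extend X) p₀ ≤
        holdoutScore (learnerParams d k τ δ α) ((m + 1) / 2) m (extend X) p)

theorem exists_runs_learner {c : ℕ} (hc : (10 : ℝ) ^ 45 ≤ c) (hτ : 1 ≤ τ) (hδ : 0 < δ)
    (hα : 0 < α) (hη : 0 < η) (hη1 : η < 1) (X : Fin m → EuclideanSpace ℝ (Fin d)) :
    ∃ M, (∃ t : ℕ, Runs learner (input d k m τ δ α η X) M t ∧
      (t : ℝ) ≤ c * (d + k + m + τ + 1 / δ + 1 / α + Real.log (1 / η)) ^ c) ∧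
      IsLearned k m τ δ α X M := by
  have hβ : 0 < (δ + α) / 4 := by positivity
  set P := learnerParams d k τ δ α with hP
  set S : ℝ := d + k + m + τ + 1 / δ + 1 / α + Real.log (1 / η) with hS
  have hd0 : (0 : ℝ) ≤ d := Nat.cast_nonneg d
  have hk0 : (0 : ℝ) ≤ k := Nat.cast_nonneg k
  have hm0 : (0 : ℝ) ≤ m := Nat.cast_nonneg m
  have hδ0 : 0 < 1 / δ := by positivity
  have hα0 : 0 < 1 / α := by positivity
  have hη0 : 0 < Real.log (1 / η) := Real.log_pos (by rwa [lt_div_iff₀ hη, one_mul])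
  have hS1 : 1 ≤ S := by linarith
  have hαS : 1 ≤ S * α := by
    rw [← div_le_iff₀ hα]
    linarith
  have hβS : 1 ≤ 4 * S * ((δ + α) / 4) := by nlinarith
  have hr : frobBound d k τ ≤ S ^ 4 := frobBound_le_pow (by linarith) (by linarith) (by linarith)
  have hr0 := frobBound_nonneg d k τ
  have hdS : (d : ℝ) ≤ S := by linarith
  have hmS : (m : ℝ) ≤ S := by linarith
  clear_value S
  have hlen : (P.len : ℝ) + 1 ≤ 257 * S ^ 6 := len_succ_le_pow hS1 hr0 hr hβ hβS
  have hiters : (P.iters : ℝ) ≤ 1285057 * S ^ 16 := iters_le_pow hS1 hr0 hr hβ hβS hdS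
  -- Z bounds every loop length. It is of order S¹⁶ because of the number of power iterations, so
  -- the running time is of order (S¹⁶)⁶ = S⁹⁶.
  obtain ⟨M, t, hrun, ht, hM⟩ := terminates_learner (k := k) (τ := τ) (η := η)
    (Z := d + m + P.iters + P.len + 1) hβ X (by omega) (by omega)
    (by change P.iters ≤ _; omega) (by change P.len ≤ _; omega) (by omega)
  refine ⟨M, ⟨t, hrun, ?_⟩, hM⟩
  have h6 : S ^ 6 ≤ S ^ 16 := pow_le_pow_right₀ hS1 (by norm_num)
  have h1 : S ≤ S ^ 16 := le_self_pow₀ hS1 (by norm_num)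
  have hZ : ((d + m + P.iters + P.len + 1 : ℕ) : ℝ) ≤ 1300000 * S ^ 16 := by
    push_cast
    linarith
  have hc45 : (96 : ℝ) ≤ c := le_trans (by norm_num) hc
  calc (t : ℝ) ≤ ((10000 * (d + m + P.iters + P.len + 1) ^ 6 : ℕ) : ℝ) := by exact_mod_cast ht
    _ = 10000 * ((d + m + P.iters + P.len + 1 : ℕ) : ℝ) ^ 6 := by push_cast; ring
    _ ≤ 10000 * (1300000 * S ^ 16) ^ 6 := by gcongr
    _ = 10000 * 1300000 ^ 6 * S ^ 96 := by ring
    _ ≤ c * S ^ c := mul_pow_le_mul_pow hS1 (le_trans (by norm_num) hc) (by exact_mod_cast hc45)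

theorem codeLength_le {X : Fin m → EuclideanSpace ℝ (Fin d)} {M : Mem} (hδ : 0 < δ)
    (hα : 0 < α) (hM : IsLearned k m τ δ α X M) :
    (M.codeLength : ℝ) ≤ 65536 * (τ ^ 4 * (k : ℝ) ^ 4 / δ ^ 4) := by
  obtain ⟨p₀, hO, -⟩ := hM
  have h1 : M.codeLength ≤ (learnerParams d k τ δ α).len := by
    have h2 := lt_blockStart_add (learnerParams d k τ δ α).len p₀
    rw [Mem.codeLength, hO.len]
    omega
  exact (Nat.cast_le.2 h1).trans (len_le_mul hδ (by linarith))

/-- Outside the failure event of `measure_selection_le` the guarantee is deterministic for any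
output that minimizes the hold-out score. Hence `out` need not be measurable: its failure set is
merely contained in that event. -/
theorem measure_not_guarantees_le {c : ℕ} (hc : (10 : ℝ) ^ 45 ≤ c) (hτ : 1 ≤ τ) (hδ : 0 < δ)
    (hα : 0 < α) (hη : 0 < η) (hη1 : η < 1)
    (hm : (c : ℝ) * (d + τ + 1 / α + Real.log (1 / η)) ^ c ≤ m)
    {D : Measure (EuclideanSpace ℝ (Fin d))} [IsProbabilityMeasure D] (hD : ∀ᵐ x ∂D, ‖x‖ = 1)
    {out : (Fin m → EuclideanSpace ℝ (Fin d)) → Mem} (hout : ∀ X, IsLearned k m τ δ α X (out X)) :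
    Measure.pi (fun _ : Fin m => D) {X | ¬ spectralLoss D ((out X).encoder d) ((out X).decoder d) ≤
      optRisk D (frobBound d k τ) + ENNReal.ofReal ((δ + α) / 4)} ≤ ENNReal.ofReal η := by
  set β := (δ + α) / 4 with hβ'
  have hβ : 0 < β := by positivity
  set r := frobBound d k τ with hr'
  set P := learnerParams d k τ δ α with hP'
  set S : ℝ := d + τ + 1 / α + Real.log (1 / η) with hS
  have hd0 : (0 : ℝ) ≤ d := Nat.cast_nonneg d
  have hα0 : 0 < 1 / α := by positivity
  have hη0 : 0 < Real.log (1 / η) := Real.log_pos (by rwa [lt_div_iff₀ hη, one_mul])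
  have hS1 : 1 ≤ S := by linarith
  have hηS : Real.log (1 / η) ≤ S := by linarith
  have hαS : 1 ≤ S * α := by
    rw [← div_le_iff₀ hα]
    linarith
  have hβS : 1 ≤ 4 * S * β := by
    rw [hβ']
    nlinarith
  have hr : r ≤ S ^ 4 := frobBound_le_pow (by linarith) (by linarith) (by linarith)
  have hr0 : 0 ≤ r := frobBound_nonneg d k τ
  clear_value S
  have hlen : (P.len : ℝ) + 1 ≤ 257 * S ^ 6 := len_succ_le_pow hS1 hr0 hr hβ hβS
  have hc24 : (24 : ℝ) ≤ c := le_trans (by norm_num) hc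
  have hm24 : 20000000000000 * S ^ 24 ≤ m :=
    (mul_pow_le_mul_pow hS1 (le_trans (by norm_num) hc) (by exact_mod_cast hc24)).trans hm
  have hm2 : 2 ≤ m := by
    have : 1 ≤ S ^ 24 := one_le_pow₀ hS1
    have : (2 : ℝ) ≤ m := by linarith
    exact_mod_cast this
  set h := (m + 1) / 2 with hh
  have hhm : h < m := by omega
  have hmh : (m : ℝ) ≤ 4 * (m - h : ℕ) := by
    have : m ≤ 4 * (m - h) := by omega
    exact_mod_cast this
  -- A block has at most 257 S⁶ examples and the descent half at least m/2. As 37522 = 2 · 257 · 73,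
  -- the sample size gives N + 1 ≥ 73 S², which is enough since S ≥ 1.
  have hN : 36 * S * (S + 1) ≤ (h / (P.len + 1) : ℕ) := by
    have h1 : h < (P.len + 1) * (h / (P.len + 1) + 1) := by
      rw [mul_comm]
      exact Nat.lt_mul_of_div_lt (Nat.lt_succ_self _) (Nat.succ_pos _)
    have h2 : (h : ℝ) ≤ (P.len + 1) * ((h / (P.len + 1) : ℕ) + 1) := by exact_mod_cast h1.le
    have h3 : (m : ℝ) ≤ 2 * h := by
      have : m ≤ 2 * h := by omega
      exact_mod_cast this
    set N : ℝ := ((h / (P.len + 1) : ℕ) : ℝ)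
    have h4 : (P.len + 1) * (N + 1) ≤ 257 * S ^ 6 * (N + 1) :=
      mul_le_mul_of_nonneg_right hlen (by positivity)
    have h5 : S ^ 6 * (37522 * S ^ 2) ≤ S ^ 6 * (514 * (N + 1)) := by
      have : S ^ 8 ≤ S ^ 24 := pow_le_pow_right₀ hS1 (by norm_num)
      have h0 : 0 ≤ S ^ 8 := by positivity
      calc S ^ 6 * (37522 * S ^ 2) = 37522 * S ^ 8 := by ring
        _ ≤ (m : ℝ) := by linarith
        _ ≤ S ^ 6 * (514 * (N + 1)) := by linarith
    have h6 := le_of_mul_le_mul_left h5 (by positivity)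
    nlinarith
  have hsel := measure_selection_le D (P := P) (valid_learnParams hr0 hβ) hD hr0
    (by positivity : 0 ≤ 3 * β / 8) (by linarith : 3 * β / 8 < β / 2)
    (by positivity : 0 ≤ β / 8) (regret_le hr0 hβ) hhm.le (Nat.mul_div_le h (P.len + 1))
  have hprob : ((1 + 3 * β / 8) / (1 + β / 2)) ^ (h / (P.len + 1)) +
      h * (2 * Real.exp (-(2 * (m - h : ℕ) * (β / 8) ^ 2 / errBound r β ^ 2))) ≤ η := by
    have h1 := failure_of_blocks_le hS1 hη hηS hβ hβS hN
    have h2 := failure_of_holdout_le hS1 hη hηS hr0 hr hβ hβS hhm.le hmh hm24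
    linarith
  refine le_trans (measure_mono ?_) (hsel.trans (ENNReal.ofReal_le_ofReal hprob))
  intro X hX hc
  obtain ⟨h1, h2, h3⟩ := hc
  obtain ⟨p₀, hO, hsc⟩ := hout X
  obtain ⟨hp₀, hmin⟩ := hsc (by omega)
  refine hX ?_
  rw [spectralLoss_eq, hO.decoder_mul_encoder]
  refine (risk_le_of_selected D (valid_learnParams hr0 hβ) hD (by positivity) (by positivity) hhm
    h1 h2 h3 hp₀ hmin).trans ?_
  have h4 := precision_mul_errBound_le hr0 hβ
  -- The budget: β/2 for the best iterate of a good block, β/8 twice for hold-out deviations, and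
  -- 3β/64 for the norm estimates.
  have h5 : β / 2 + (2 * (β / 8) + 3 * precision r β * errBound r β) ≤ β := by linarith
  exact add_le_add_right (ENNReal.ofReal_le_ofReal h5) _

end Guarantees

end SpectralAutoencoder

theorem theorem3 :
    ∃ (P : RealRAM.Program) (C : ℝ) (c : ℕ),
      ∀ (d k m : ℕ) (τ δ α η : ℝ), 1 ≤ τ → 0 < δ → 0 < α → 0 < η → η < 1 →
        ∃ out : (Fin m → EuclideanSpace ℝ (Fin d)) → RealRAM.Mem,
          -- the program returns `out X` on every sample `X`, in polynomial time
          (∀ X, ∃ t : ℕ, RealRAM.Runs P (RealRAM.input d k m τ δ α η X) (out X) t ∧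
            (t : ℝ) ≤ c * (d + k + m + τ + 1 / δ + 1 / α + Real.log (1 / η)) ^ c) ∧
          -- encoding length
          (∀ X, ((out X).codeLength : ℝ) ≤ C * (τ ^ 4 * (k : ℝ) ^ 4 / δ ^ 4)) ∧
          -- with polynomially many examples, learning succeeds with probability at least `1 - η`
          ((c : ℝ) * (d + τ + 1 / α + Real.log (1 / η)) ^ c ≤ m →
            ∀ (ε : ℝ) (D : Measure (EuclideanSpace ℝ (Fin d))), IsProbabilityMeasure D →
              (∀ᵐ x ∂D, ‖x‖ = 1) → IsRegularlySpectralDecodable τ k ε D →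
              Measure.pi (fun _ : Fin m => D)
                {X | ¬ ((∀ (A : Matrix (Fin k) (Fin d × Fin d) ℝ)
                          (B : Matrix (Fin d × Fin d) (Fin k) ℝ), opNorm (B * A) ≤ τ →
                          spectralLoss D ((out X).encoder d) ((out X).decoder d) ≤
                            spectralLoss D A B + ENNReal.ofReal (δ + α)) ∧
                      spectralLoss D ((out X).encoder d) ((out X).decoder d) ≤
                        ENNReal.ofReal (ε + δ + α) ∧
                      ∀ f ∈ spectralAutoencoder ((out X).encoder d) ((out X).decoder d),
                        reconstructionLoss D f ≤ ENNReal.ofReal (4 * ε + δ + α))}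
                ≤ ENNReal.ofReal η) := by
  -- The size comes from the running time, whose constant 10000 · 1300000⁶ is about 4.8 · 10⁴⁰; the
  -- other constants and exponents are smaller.
  obtain ⟨c, hc⟩ : ∃ c : ℕ, (10 : ℝ) ^ 45 ≤ c := exists_nat_ge _
  refine ⟨SpectralAutoencoder.learner, 65536, c, fun d k m τ δ α η hτ hδ hα hη hη1 => ?_⟩
  choose out hrun hout using
    SpectralAutoencoder.exists_runs_learner (d := d) (k := k) (m := m) hc hτ hδ hα hη hη1
  refine ⟨out, hrun, fun X => SpectralAutoencoder.codeLength_le hδ hα (hout X),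
    fun hm ε D _ hD hdec => ?_⟩
  refine le_trans (measure_mono ?_)
    (SpectralAutoencoder.measure_not_guarantees_le hc hτ hδ hα hη hη1 hm hD hout)
  intro X hX hloss
  refine hX ?_
  obtain ⟨h1, h2, h3⟩ := SpectralAutoencoder.guarantees_of_loss_le hD hdec (by positivity) hloss
  refine ⟨fun A B hAB => (h1 A B hAB).trans ?_, h2.trans ?_, fun f hf => (h3 f hf).trans ?_⟩
  · exact add_le_add_right (ENNReal.ofReal_le_ofReal (by linarith)) _
  · exact ENNReal.ofReal_le_ofReal (by linarith)
  · exact ENNReal.ofReal_le_ofReal (by linarith)
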